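/- **Setting.** There are $n\ge 1$ nodes, a set $\mathcal C\subseteq[n]$ of $n-f$ correct nodes, and $n\ge 11f$. The remaining $f$ nodes are faulty and behave arbitrarily. Let $q:\mathbb R^d\times\mathcal X\to\mathbb R$ be differentiable in its first argument. Let $\mathcal D_i$ be the data distribution of node $i$, $Q^{(i)}(\theta)=\mathbb E_{x\sim\mathcal D_i}[q(\theta,x)]$, $Q^{(\mathcal C)}=\frac1{|\mathcal C|}\sum_{i\in\mathcal C}Q^{(i)}$, and assume that $Q^*=\inf_\theta Q^{(\mathcal C)}(\theta)$ is finite. Assume that there are $L>0$, $\sigma>0$ and $\zeta\ge 0$ such that for all $i\in\mathcal C$ and all $\theta,\theta'\in\mathbb R^d$: - (smoothness) $Q^{(i)}$ is differentiable and $\|\nabla Q^{(i)}(\theta)-\nabla Q^{(i)}(\theta')\|\le L\|\theta-\theta'\|$; - (bounded variance) $\mathbb E_{x\sim\mathcal D_i}\|\nabla q(\theta,x)-\nabla Q^{(i)}(\theta)\|^2\le\sigma^2$; - (heterogeneity) $\frac1{|\mathcal C|}\sum_{j\in\mathcal C}\|\nabla Q^{(j)}(\theta)-\nabla Q^{(\mathcal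 C)}(\theta)\|^2\le\zeta^2$. **Algorithm (MoNNA with $K=1$ coordination round).** Each $i\in\mathcal C$ starts from $\theta_0^{(i)}=\theta_0$ and $m_{-1}^{(i)}=0$. In iteration $t=0,\dots,T-1$ it does the following. 1. It draws $x_t^{(i)}\sim\mathcal D_i$, independently of the past and of the other correct nodes, and sets $m_t^{(i)}=\beta m_{t-1}^{(i)}+(1-\beta)\nabla q(\theta_t^{(i)},x_t^{(i)})$ and $\theta_{t+1/2}^{(i)}=\theta_t^{(i)}-\gamma m_t^{(i)}$. 2. It broadcasts $\theta_{t+1/2}^{(i)}$. A faulty node may broadcast an arbitrary vector, which may depend on everything that has happened so far but is the same for all receivers. 3. It receives the vectors of $n-f-1$ other nodes, which may be any such nodes, and sets $\theta_{t+1}^{(i)}$ to the average of its own vector and the $n-2f-1$ received vectors nearest to it, with ties broken arbitrarily. It returns $\hat\theta^{(i)}$ chosen uniformly at random from $\theta_0^{(i)},\dots,\theta_{T-1}^{(i)}$. **Theorem.** Let $$\alpha=\frac{9.88f}{n-f},\qquad \lambda=\frac{9f}{n-f},\qquad c_0=12\bigl(Q^{(\mathcal C)}(\theta_0)-Q^*\bigr),\qquad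 c_1=\frac{18\alpha(1+\alpha)}{(1-\alpha)^2},$$ $$c_2=72\Bigl(\frac3{n-f}+2c_1+\frac{9\lambda}2(2c_1+3)\Bigr),\qquad c_3=6\Bigl(6c_1+\frac{9\lambda}2(4c_1+9)\Bigr),\qquad c_4=\frac{9nc_0c_1}{c_2}.$$ Then $\alpha\le 0.988$. Moreover, let $T\ge1$ and run MoNNA with $K=1$, $$\gamma=\min\Bigl\{\frac1{12L},\ \frac1L\sqrt{\frac2{3c_1}},\ \sqrt{\frac{c_0}{c_2LT\sigma^2}}\Bigr\}$$ (the middle entry is $+\infty$ if $c_1=0$, i.e. if $f=0$) and $\beta=\sqrt{1-12\gamma L}$. Then for every $i\in\mathcal C$ the following expectation is finite and $$\mathbb E\bigl\|\nabla Q^{(\mathcal C)}(\hat\theta^{(i)})\bigr\|^2\le 2\sqrt{\frac{c_0c_2L\sigma^2}{T}}+\frac{12Lc_0}{T}+\frac{Lc_0}{T}\sqrt{\frac{3c_1}2}+\frac{36}{T}\cdot\frac{\sigma^2}{n-f}+\frac{c_4L}{T}\Bigl(1+\frac{\zeta^2}{\sigma^2}\Bigr)+c_3\zeta^2 .$$ 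-/

import Mathlib

open MeasureTheory ProbabilityTheory
open scoped ENNReal

noncomputable section

/-- The space of models (and of gradients, momentums, messages): `ℝ^d` with the Euclidean norm. -/
abbrev Param (d : ℕ) : Type := EuclideanSpace ℝ (Fin d)

/-- Local loss of a node with data distribution `μ`: the expectation of the pointwise loss
`q θ x` over a data point `x` drawn from `μ`. -/
def localLoss {d : ℕ} {X : Type*} [MeasurableSpace X] (q : Param d → X → ℝ) (μ : Measure X)
    (θ : Param d) : ℝ :=
  ∫ x, q θ x ∂μ

/-- Average of the local losses over the set `C` of correct nodes. -/
def correctLoss {n d : ℕ} {X : Type*} [MeasurableSpace X] (q : Param d → X → ℝ)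
    (D : Fin n → Measure X) (C : Finset (Fin n)) (θ : Param d) : ℝ :=
  (1 / (C.card : ℝ)) * ∑ i ∈ C, localLoss q (D i) θ

/-- Gradient in the model of the pointwise loss: `∇ q(θ, x)`. -/
def pointGradient {d : ℕ} {X : Type*} (q : Param d → X → ℝ) (θ : Param d) (x : X) : Param d :=
  gradient (fun η => q η x) θ

/-- What is needed for the losses to make sense: `q` is measurable, differentiable in the
model, and integrable in the data point for the distributions of the correct nodes. -/
structure IsPointwiseLoss {n d : ℕ} {X : Type*} [MeasurableSpace X] (q : Param d → X → ℝ)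
    (D : Fin n → Measure X) (C : Finset (Fin n)) : Prop where
  measurable : Measurable (Function.uncurry q)
  differentiable : ∀ x, Differentiable ℝ (fun θ => q θ x)
  integrable : ∀ i ∈ C, ∀ θ, Integrable (q θ) (D i)

/-- Lipschitz smoothness of the local losses of the correct nodes, with constant `L`. -/
def LipschitzSmooth {n d : ℕ} {X : Type*} [MeasurableSpace X] (q : Param d → X → ℝ)
    (D : Fin n → Measure X) (C : Finset (Fin n)) (L : ℝ) : Prop :=
  ∀ i ∈ C, Differentiable ℝ (localLoss q (D i)) ∧
    ∀ θ₁ θ₂ : Param d,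
      ‖gradient (localLoss q (D i)) θ₁ - gradient (localLoss q (D i)) θ₂‖ ≤ L * ‖θ₁ - θ₂‖

/-- The local stochastic gradients of the correct nodes have variance at most `σ ^ 2`. The
expectation is a Lebesgue integral in `[0, ∞]`, so the bound includes its finiteness. -/
def BoundedVariance {n d : ℕ} {X : Type*} [MeasurableSpace X] (q : Param d → X → ℝ)
    (D : Fin n → Measure X) (C : Finset (Fin n)) (σ : ℝ) : Prop :=
  ∀ i ∈ C, ∀ θ : Param d,
    ∫⁻ x, ‖pointGradient q θ x - gradient (localLoss q (D i)) θ‖ₑ ^ 2 ∂(D i)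
      ≤ ENNReal.ofReal (σ ^ 2)

/-- `ζ`-heterogeneity of the local losses of the correct nodes. -/
def BoundedHeterogeneity {n d : ℕ} {X : Type*} [MeasurableSpace X] (q : Param d → X → ℝ)
    (D : Fin n → Measure X) (C : Finset (Fin n)) (ζ : ℝ) : Prop :=
  ∀ θ : Param d,
    (1 / (C.card : ℝ)) *
      ∑ i ∈ C, ‖gradient (localLoss q (D i)) θ - gradient (correctLoss q D C) θ‖ ^ 2 ≤ ζ ^ 2

/-- Nearest neighbor averaging. `y` is an output of the rule at node `i`, which holds the vector
`z i` and has received the vectors `z j` of the `n - f - 1` nodes `j ∈ R`: the average of `z i` and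
of the `n - 2 f - 1` received vectors that are nearest to `z i`, with ties broken arbitrarily. -/
def IsNNA {n d : ℕ} (f : ℕ) (z : Fin n → Param d) (i : Fin n) (R : Finset (Fin n))
    (y : Param d) : Prop :=
  ∃ S : Finset (Fin n), S ⊆ R ∧ S.card = n - 2 * f - 1 ∧
    (∀ j ∈ S, ∀ k ∈ R \ S, ‖z i - z j‖ ≤ ‖z i - z k‖) ∧
    y = (1 / ((n : ℝ) - 2 * f)) • (z i + ∑ j ∈ S, z j)

/-- An execution of MoNNA over `T` iterations `t = 0, …, T - 1` with `K` coordination rounds each,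
on a probability space `(Ω, P)`, with correct nodes `C`, learning rate `γ`, momentum coefficient
`β` and common initial model `θ₀`. Nothing is required of the nodes outside `C`: the vectors that
they broadcast are arbitrary and may depend on everything that has happened in the system, and
so may the choice of the nodes from which a correct node receives its vectors. -/
structure MonnaExecution {n d : ℕ} {X Ω : Type*} [MeasurableSpace X] [mΩ : MeasurableSpace Ω]
    (P : Measure Ω) (q : Param d → X → ℝ) (D : Fin n → Measure X) (C : Finset (Fin n))
    (f K T : ℕ) (γ β : ℝ) (θ₀ : Param d) where
  /-- `history t` is the information of the whole system (faulty nodes and network included)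
  before the data points of iteration `t` are drawn. -/
  history : Filtration ℕ mΩ
  /-- `sample t i` is the data point drawn by node `i` in iteration `t`. -/
  sample : ℕ → Fin n → Ω → X
  /-- `model t i` is the model of node `i` at the start of iteration `t`. -/
  model : ℕ → Fin n → Ω → Param d
  /-- `momentum t i` is the momentum of node `i` at the start of iteration `t`, so that the
  momentum computed in iteration `t` is `momentum (t + 1) i`. -/
  momentum : ℕ → Fin n → Ω → Param d
  /-- `vec t k i` is the vector of node `i` after `k` coordination rounds of iteration `t`, which
  is the vector that node `i` broadcasts (the same one to all nodes) in round `k + 1`. -/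
  vec : ℕ → ℕ → Fin n → Ω → Param d
  /-- `received t k i` is the set of nodes from which node `i` receives the vectors it uses in
  round `k + 1` of iteration `t`. -/
  received : ℕ → ℕ → Fin n → Ω → Finset (Fin n)
  /-- `outputIndex i` is the random index of the model that node `i` returns. -/
  outputIndex : Fin n → Ω → Fin T
  model_zero : ∀ i ∈ C, ∀ ω, model 0 i ω = θ₀
  momentum_zero : ∀ i ∈ C, ∀ ω, momentum 0 i ω = 0
  /-- Local phase: momentum update with a stochastic gradient at the current model. -/
  momentum_succ : ∀ t < T, ∀ i ∈ C, ∀ ω,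
    momentum (t + 1) i ω =
      β • momentum t i ω + (1 - β) • pointGradient q (model t i ω) (sample t i ω)
  /-- Local phase: partial model update, which initializes the coordination phase. -/
  vec_zero : ∀ t < T, ∀ i ∈ C, ∀ ω, vec t 0 i ω = model t i ω - γ • momentum (t + 1) i ω
  /-- Interaction: a correct node receives vectors from `n - f - 1` other nodes. -/
  received_spec : ∀ t < T, ∀ k < K, ∀ i ∈ C, ∀ ω,
    i ∉ received t k i ω ∧ (received t k i ω).card = n - f - 1
  /-- Mixing by nearest neighbor averaging. -/
  vec_succ : ∀ t < T, ∀ k < K, ∀ i ∈ C, ∀ ω,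
    IsNNA f (fun j => vec t k j ω) i (received t k i ω) (vec t (k + 1) i ω)
  model_succ : ∀ t < T, ∀ i ∈ C, ∀ ω, model (t + 1) i ω = vec t K i ω
  /-- The models only depend on the past. -/
  model_adapted : ∀ t ≤ T, ∀ i ∈ C, Measurable[history t] (model t i)
  sample_adapted : ∀ t < T, ∀ i ∈ C, Measurable[history (t + 1)] (sample t i)
  /-- Node `i` samples from its own data distribution, … -/
  sample_law : ∀ t < T, ∀ i ∈ C, P.map (sample t i) = D i
  /-- … independently of the other correct nodes … -/
  sample_indep : ∀ t < T, iIndepFun (fun (i : C) => sample t i) P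
  /-- … and the data points drawn in iteration `t` are jointly independent of the past. -/
  sample_indep_history : ∀ t < T,
    Indep (⨆ i ∈ C, MeasurableSpace.comap (sample t i) inferInstance) (history t) P
  /-- The returned index is uniform on `{0, …, T - 1}` … -/
  outputIndex_measurable : ∀ i ∈ C, Measurable (outputIndex i)
  outputIndex_uniform : ∀ i ∈ C, ∀ s : Fin T, P (outputIndex i ⁻¹' {s}) = (T : ℝ≥0∞)⁻¹
  /-- … and drawn independently of the run. -/
  outputIndex_indep : ∀ i ∈ C,
    Indep (MeasurableSpace.comap (outputIndex i) inferInstance) (history T) P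

/-- The model returned by node `i`. -/
def MonnaExecution.output {n d : ℕ} {X Ω : Type*} [MeasurableSpace X] [MeasurableSpace Ω]
    {P : Measure Ω} {q : Param d → X → ℝ} {D : Fin n → Measure X} {C : Finset (Fin n)}
    {f K T : ℕ} {γ β : ℝ} {θ₀ : Param d}
    (run : MonnaExecution P q D C f K T γ β θ₀) (i : Fin n) (ω : Ω) : Param d :=
  run.model (run.outputIndex i ω) i ω

/-- The learning rate `min {1 / (12 L), (1 / L) √(2 / (3 c₁)), √(c₀ / (c₂ L T σ²))}`. The middle
entry is `+∞`, that is, absent, if `c₁ = 0` (which happens only when there are no faults). -/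
def monnaStepSize (L σ c₀ c₁ c₂ : ℝ) (T : ℕ) : ℝ :=
  if c₁ = 0 then
    min (1 / (12 * L)) (Real.sqrt (c₀ / (c₂ * L * T * σ ^ 2)))
  else
    min (1 / (12 * L))
      (min (1 / L * Real.sqrt (2 / (3 * c₁))) (Real.sqrt (c₀ / (c₂ * L * T * σ ^ 2))))

end

/-! Faulty vectors are controlled by one observation. A node that selects k faulty vectors leaves at
least k received correct vectors unselected, each at least as far from its own vector
(`IsNNA.exists_matching`). Every selected faulty vector can therefore be charged, injectively, to a
correct one, at the price of twice the distance from the node's own vector to the reference point.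
Consequently one coordination round multiplies the mean squared spread of the correct vectors by at
most α and moves their average by a squared distance of at most λ times the spread
(`IsNNA.reduction`). Both constants are of order f / (n - f), and n ≥ 11 f makes α < 1.

What remains is stochastic descent with momentum for the average model, perturbed by this drift.
Stochastic gradients are unbiased (`integral_pointGradient`), so fresh noise is orthogonal to the
past and noises of distinct nodes are orthogonal to each other; the averaged noise has second moment
at most σ² / (n - f). Noise enters a momentum with squared weight (1 - β)², where 1 - β is of order
γL. The spreads of models and momentums obey a coupled recursion: contraction by α keeps the former
of order γ²B, where B, of order ζ² + γLσ², bounds the latter (`spread_recursion_le`). The drift,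
divided by γ², thus contributes λ(ζ² + γLσ²) rather than λσ². This is what momentum is for, and why
only a multiple of ζ² survives as T grows.

Smoothness gives a descent inequality along the average model (`correctLoss_avgModel_succ_le`),
whose errors are the drift and the deviation of the average momentum from the gradient. Adding the
squared deviation, divided by 4L, to the loss gives a Lyapunov function in which the deviation is
absorbed (`lyapunov_step`). Summation over t bounds the gradients at the average model. Passing to a
single node costs a term of order γ², and the step size balances c₀ / (γT) against c₂γLσ²
(`error_bound_le`). -/

/-! ### Averages and mean squared spreads of finite families -/

section Averages

variable {ι E : Type*} [NormedAddCommGroup E] [InnerProductSpace ℝ E]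

/-- Average of a family of vectors over a finite set. -/
noncomputable def finAvg (C : Finset ι) (z : ι → E) : E := (1 / (C.card : ℝ)) • ∑ i ∈ C, z i

/-- Mean squared distance of a family of vectors to its average. -/
noncomputable def finSpread (C : Finset ι) (z : ι → E) : ℝ :=
  (1 / (C.card : ℝ)) * ∑ i ∈ C, ‖z i - finAvg C z‖ ^ 2

lemma finSpread_nonneg (C : Finset ι) (z : ι → E) : 0 ≤ finSpread C z := by
  unfold finSpread; positivity

lemma card_smul_finAvg {C : Finset ι} (hC : C.Nonempty) (z : ι → E) :
    (C.card : ℝ) • finAvg C z = ∑ i ∈ C, z i := by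
  have : (C.card : ℝ) ≠ 0 := by exact_mod_cast hC.card_pos.ne'
  rw [finAvg, smul_smul, mul_one_div_cancel this, one_smul]

lemma card_mul_finSpread {C : Finset ι} (hC : C.Nonempty) (z : ι → E) :
    (C.card : ℝ) * finSpread C z = ∑ i ∈ C, ‖z i - finAvg C z‖ ^ 2 := by
  have : (C.card : ℝ) ≠ 0 := by exact_mod_cast hC.card_pos.ne'
  rw [finSpread, ← mul_assoc, mul_one_div_cancel this, one_mul]

lemma sum_sub_finAvg {C : Finset ι} (hC : C.Nonempty) (z : ι → E) :
    ∑ i ∈ C, (z i - finAvg C z) = 0 := by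
  rw [Finset.sum_sub_distrib, Finset.sum_const, ← Nat.cast_smul_eq_nsmul ℝ,
    card_smul_finAvg hC, sub_self]

lemma finAvg_const {C : Finset ι} (hC : C.Nonempty) (c : E) : finAvg C (fun _ => c) = c := by
  have : (C.card : ℝ) ≠ 0 := by exact_mod_cast hC.card_pos.ne'
  rw [finAvg, Finset.sum_const, ← Nat.cast_smul_eq_nsmul ℝ, smul_smul, one_div_mul_cancel this,
    one_smul]

lemma finSpread_const {C : Finset ι} (hC : C.Nonempty) (c : E) :
    finSpread C (fun _ => c) = 0 := by
  rw [finSpread, finAvg_const hC]; simp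

lemma finAvg_congr {C : Finset ι} {z w : ι → E} (h : ∀ i ∈ C, z i = w i) :
    finAvg C z = finAvg C w := by
  rw [finAvg, finAvg, Finset.sum_congr rfl h]

lemma finSpread_congr {C : Finset ι} {z w : ι → E} (h : ∀ i ∈ C, z i = w i) :
    finSpread C z = finSpread C w := by
  rw [finSpread, finSpread, finAvg_congr h, Finset.sum_congr rfl fun i hi => by rw [h i hi]]

lemma finAvg_add (C : Finset ι) (z w : ι → E) :
    finAvg C (fun i => z i + w i) = finAvg C z + finAvg C w := by
  simp only [finAvg, Finset.sum_add_distrib, smul_add]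

lemma finAvg_sub (C : Finset ι) (z w : ι → E) :
    finAvg C (fun i => z i - w i) = finAvg C z - finAvg C w := by
  simp only [finAvg, Finset.sum_sub_distrib, smul_sub]

lemma finAvg_smul (C : Finset ι) (c : ℝ) (z : ι → E) :
    finAvg C (fun i => c • z i) = c • finAvg C z := by
  simp only [finAvg, ← Finset.smul_sum, smul_comm c]

/-- Parallel axis identity: deviations from the average sum to zero, so no cross term survives.
Minimality of the average as a centre and the formula for pairwise distances follow from it. -/
lemma sum_norm_sub_sq_eq {C : Finset ι} (hC : C.Nonempty) (z : ι → E) (p : E) :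
    ∑ i ∈ C, ‖z i - p‖ ^ 2 =
      C.card * finSpread C z + C.card * ‖finAvg C z - p‖ ^ 2 := by
  have h : ∀ i, ‖z i - p‖ ^ 2 = ‖z i - finAvg C z‖ ^ 2
      + 2 * inner ℝ (z i - finAvg C z) (finAvg C z - p) + ‖finAvg C z - p‖ ^ 2 := fun i => by
    rw [← norm_add_sq_real, sub_add_sub_cancel]
  simp only [h, Finset.sum_add_distrib, ← Finset.mul_sum, ← sum_inner, sum_sub_finAvg hC,
    card_mul_finSpread hC]
  simp

lemma finSpread_le_of_center {C : Finset ι} (z : ι → E) (p : E) :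
    finSpread C z ≤ (1 / (C.card : ℝ)) * ∑ i ∈ C, ‖z i - p‖ ^ 2 := by
  rcases C.eq_empty_or_nonempty with rfl | hC
  · simp [finSpread]
  · have h0 : (0 : ℝ) < C.card := by exact_mod_cast hC.card_pos
    rw [sum_norm_sub_sq_eq hC, one_div, mul_add, inv_mul_cancel_left₀ h0.ne']
    have : 0 ≤ (C.card : ℝ)⁻¹ * (C.card * ‖finAvg C z - p‖ ^ 2) := by positivity
    linarith

lemma sum_sum_norm_sub_sq {C : Finset ι} (hC : C.Nonempty) (z : ι → E) :
    ∑ i ∈ C, ∑ j ∈ C, ‖z i - z j‖ ^ 2 = 2 * (C.card : ℝ) ^ 2 * finSpread C z := by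
  have h : ∀ i ∈ C, ∑ j ∈ C, ‖z i - z j‖ ^ 2 =
      C.card * finSpread C z + C.card * ‖z i - finAvg C z‖ ^ 2 := fun i _ => by
    rw [norm_sub_rev (z i) (finAvg C z), ← sum_norm_sub_sq_eq hC]
    exact Finset.sum_congr rfl fun j _ => by rw [norm_sub_rev]
  rw [Finset.sum_congr rfl h, Finset.sum_add_distrib, Finset.sum_const, ← Finset.mul_sum,
    nsmul_eq_mul, ← card_mul_finSpread hC]
  ring

lemma norm_finAvg_le (C : Finset ι) (z : ι → E) :
    ‖finAvg C z‖ ≤ (1 / (C.card : ℝ)) * ∑ i ∈ C, ‖z i‖ := by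
  rw [finAvg, norm_smul, Real.norm_of_nonneg (by positivity)]
  gcongr
  exact norm_sum_le _ _

lemma norm_finAvg_sq_le (C : Finset ι) (z : ι → E) :
    ‖finAvg C z‖ ^ 2 ≤ (1 / (C.card : ℝ)) * ∑ i ∈ C, ‖z i‖ ^ 2 := by
  rcases C.eq_empty_or_nonempty with rfl | hC
  · simp [finAvg]
  · have h0 : (0 : ℝ) < C.card := by exact_mod_cast hC.card_pos
    have h := sum_norm_sub_sq_eq hC z 0
    simp only [sub_zero] at h
    rw [h, one_div, mul_add, inv_mul_cancel_left₀ h0.ne', inv_mul_cancel_left₀ h0.ne']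
    linarith [finSpread_nonneg C z]

lemma norm_sub_finAvg_sq_le {C : Finset ι} (z : ι → E) {i : ι} (hi : i ∈ C) :
    ‖z i - finAvg C z‖ ^ 2 ≤ C.card * finSpread C z := by
  rw [card_mul_finSpread ⟨i, hi⟩]
  exact Finset.single_le_sum (f := fun j => ‖z j - finAvg C z‖ ^ 2)
    (fun j _ => by positivity) hi

/-- After the triangle inequality, the gap between the two sides is (s‖x‖ - ‖y‖)² / s. The weight s
is tuned at each use. -/
lemma norm_add_sq_le_young {E : Type*} [NormedAddCommGroup E] {s : ℝ} (hs : 0 < s) (x y : E) :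
    ‖x + y‖ ^ 2 ≤ (1 + s) * ‖x‖ ^ 2 + (1 + 1 / s) * ‖y‖ ^ 2 := by
  have h1 : ‖x + y‖ ^ 2 ≤ (‖x‖ + ‖y‖) ^ 2 := by gcongr; exact norm_add_le _ _
  have h2 : (1 + s) * ‖x‖ ^ 2 + (1 + 1 / s) * ‖y‖ ^ 2 - (‖x‖ + ‖y‖) ^ 2
      = (s * ‖x‖ - ‖y‖) ^ 2 / s := by field_simp; ring
  have h3 : 0 ≤ (s * ‖x‖ - ‖y‖) ^ 2 / s := by positivity
  linarith

/-- The gap is b(1 - b)‖x - y‖². Convexity, in place of Young's inequality, preserves the factor β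
in the momentum recursions. -/
lemma norm_convex_comb_sq_le {b : ℝ} (h0 : 0 ≤ b) (h1 : b ≤ 1) (x y : E) :
    ‖b • x + (1 - b) • y‖ ^ 2 ≤ b * ‖x‖ ^ 2 + (1 - b) * ‖y‖ ^ 2 := by
  have h2 : b * ‖x‖ ^ 2 + (1 - b) * ‖y‖ ^ 2 - ‖b • x + (1 - b) • y‖ ^ 2
      = b * (1 - b) * ‖x - y‖ ^ 2 := by
    rw [norm_add_sq_real, norm_sub_sq_real, norm_smul, norm_smul, inner_smul_left,
      inner_smul_right, Real.norm_of_nonneg h0, Real.norm_of_nonneg (sub_nonneg.2 h1)]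
    simp; ring
  have : 0 ≤ b * (1 - b) * ‖x - y‖ ^ 2 :=
    mul_nonneg (mul_nonneg h0 (sub_nonneg.2 h1)) (by positivity)
  linarith

lemma finSpread_add_le {s : ℝ} (hs : 0 < s) (C : Finset ι) (z w : ι → E) :
    finSpread C (fun i => z i + w i) ≤
      (1 + s) * finSpread C z + (1 + 1 / s) * finSpread C w := by
  unfold finSpread
  rw [finAvg_add, mul_left_comm, mul_left_comm (1 + 1 / s), ← mul_add, Finset.mul_sum _ _ (1 + s),
    Finset.mul_sum _ _ (1 + 1 / s), ← Finset.sum_add_distrib]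
  gcongr with i
  rw [add_sub_add_comm]
  exact norm_add_sq_le_young hs _ _

lemma finSpread_smul (c : ℝ) (C : Finset ι) (z : ι → E) :
    finSpread C (fun i => c • z i) = c ^ 2 * finSpread C z := by
  unfold finSpread
  have h : ∀ i, ‖c • z i - c • finAvg C z‖ ^ 2 = c ^ 2 * ‖z i - finAvg C z‖ ^ 2 := fun i => by
    rw [← smul_sub, norm_smul, mul_pow, Real.norm_eq_abs, sq_abs]
  simp only [finAvg_smul, h, ← Finset.mul_sum]
  ring

end Averages

/-! ### Charging selected faulty vectors to unselected correct ones -/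

section Matching

variable {n d f : ℕ} {C R : Finset (Fin n)} {z : Fin n → Param d} {i : Fin n} {y : Param d}

/-- Each faulty vector selected by nearest neighbor averaging can be charged to a correct
vector that is not selected and is at least as far. -/
lemma IsNNA.exists_matching (hn : 11 * f ≤ n) (hC : C.card = n - f) (hi : i ∈ C) (hiR : i ∉ R)
    (hR : R.card = n - f - 1) (h : IsNNA f z i R y) :
    ∃ (A : Finset (Fin n)) (φ : Fin n → Fin n), A.card = n - 2 * f ∧ i ∈ A ∧
      y = (1 / ((n : ℝ) - 2 * f)) • ∑ j ∈ A, z j ∧ (∀ k ∈ A, φ k ∈ C) ∧ Set.InjOn φ A ∧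
      (∀ k ∈ A, k ∈ C → φ k = k) ∧ ∀ k ∈ A, ‖z k - z i‖ ≤ ‖z (φ k) - z i‖ := by
  obtain ⟨S, hSR, hS, hnear, rfl⟩ := h
  have hnpos : 0 < n := i.pos
  have hiS : i ∉ S := fun h => hiR (hSR h)
  -- At most f of the n - f - 1 senders are faulty, so |R ∩ C| ≥ n - 2f - 1 = |S|; subtracting |S ∩
  -- C| gives the claim.
  have hcard : (S \ C).card ≤ ((R \ S) ∩ C).card := by
    have h1 : (R \ C).card ≤ f := by
      calc (R \ C).card ≤ (Cᶜ).card :=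
            Finset.card_le_card fun x hx => by simp at hx ⊢; exact hx.2
        _ = n - (n - f) := by rw [Finset.card_compl, hC, Fintype.card_fin]
        _ ≤ f := by omega
    have h2 := Finset.card_sdiff_add_card_inter R C
    have h3 := Finset.card_sdiff_add_card_inter S C
    have h4 : (R ∩ C).card = ((R \ S) ∩ C).card + (S ∩ C).card := by
      rw [← Finset.card_union_of_disjoint]
      · congr 1; ext x; simp only [Finset.mem_inter, Finset.mem_union, Finset.mem_sdiff]
        have := @hSR x
        tauto
      · rw [Finset.disjoint_left]; intro x; simp; tauto
    omega
  obtain ⟨π, hπmaps, hπinj⟩ : ∃ π : Fin n → Fin n,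
      (∀ k ∈ S \ C, π k ∈ (R \ S) ∩ C) ∧ Set.InjOn π (S \ C : Finset (Fin n)) := by
    have : Nonempty (Fin n) := ⟨i⟩
    obtain ⟨π, h1, h2⟩ := Set.Finite.exists_injOn_of_encard_le (β := Fin n)
      (s := ((S \ C : Finset (Fin n)) : Set (Fin n)))
      (t := (((R \ S) ∩ C : Finset (Fin n)) : Set (Fin n))) (Finset.finite_toSet _)
      (by rw [Set.encard_coe_eq_coe_finsetCard, Set.encard_coe_eq_coe_finsetCard]
          exact_mod_cast hcard)
    exact ⟨π, fun k hk => h1 hk, h2⟩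
  have hAC : ∀ k ∈ insert i S, k ∉ C → k ∈ S \ C := fun k hk hkC => by
    rw [Finset.mem_insert] at hk
    rcases hk with rfl | hk
    · exact absurd hi hkC
    · exact Finset.mem_sdiff.2 ⟨hk, hkC⟩
  -- Charged nodes lie outside the selection, so `π` cannot collide with the identity used on the
  -- correct members; this gives injectivity of the combined map.
  have hπout : ∀ k ∈ S \ C, π k ∉ insert i S := fun k hk hk' => by
    have := hπmaps k hk
    simp only [Finset.mem_inter, Finset.mem_sdiff, Finset.mem_insert] at this hk'
    rcases hk' with h | h
    · exact hiR (h ▸ this.1.1)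
    · exact this.1.2 h
  classical
  refine ⟨insert i S, fun k => if k ∈ C then k else π k, ?_, Finset.mem_insert_self _ _, ?_,
    ?_, ?_, ?_, ?_⟩
  · rw [Finset.card_insert_of_notMem hiS, hS]; omega
  · rw [Finset.sum_insert hiS]
  · intro k hk
    by_cases hkC : k ∈ C
    · simp [hkC]
    · simpa [hkC] using (Finset.mem_inter.1 (hπmaps k (hAC k hk hkC))).2
  · intro k hk l hl hkl
    simp only [Finset.mem_coe] at hk hl
    by_cases hkC : k ∈ C <;> by_cases hlC : l ∈ C <;> simp only [hkC, hlC, if_true, if_false] at hkl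
    · exact hkl
    · exact absurd (hkl ▸ hk) (hπout l (hAC l hl hlC))
    · exact absurd (hkl ▸ hl) (hπout k (hAC k hk hkC))
    · exact hπinj (hAC k hk hkC) (hAC l hl hlC) hkl
  · intro k _ hkC; simp [hkC]
  · intro k hk
    by_cases hkC : k ∈ C
    · simp [hkC]
    · have h1 := hAC k hk hkC
      have h2 := Finset.mem_inter.1 (hπmaps k h1)
      simp only [hkC, if_false]
      rw [norm_sub_rev, norm_sub_rev (z (π k))]
      exact hnear k (Finset.mem_sdiff.1 h1).1 (π k) h2.1

end Matching

/-! ### Comparison of two selections -/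

section Reduction

/-- The selection made by nearest neighbor averaging at a correct node `i`: a set `A` of nodes
that contains `i`, with an injection `φ` into the correct nodes that fixes the correct ones and does not
decrease the distance to `i`. -/
structure IsSelection {n : ℕ} {E : Type*} [NormedAddCommGroup E] (C : Finset (Fin n)) (m : ℕ)
    (z : Fin n → E) (i : Fin n) (A : Finset (Fin n)) (φ : Fin n → Fin n) : Prop where
  card_eq : A.card = m
  self_mem : i ∈ A
  mapsTo : ∀ k ∈ A, φ k ∈ C
  injOn : Set.InjOn φ A
  eq_self : ∀ k ∈ A, k ∈ C → φ k = k
  dist_le : ∀ k ∈ A, ‖z k - z i‖ ≤ ‖z (φ k) - z i‖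

variable {n f m : ℕ} {E : Type*} [NormedAddCommGroup E]
  {C : Finset (Fin n)} {z : Fin n → E} {i j : Fin n} {A B : Finset (Fin n)} {φ ψ : Fin n → Fin n}

/-- For faulty k, the route from `z k` to p goes through `z i`: replacing `z k` by `z (φ k)` does
not shorten the leg to `z i`, and the leg from `z i` to p is paid twice. -/
lemma IsSelection.norm_sub_le (h : IsSelection C m z i A φ) (p : E) {k : Fin n}
    (hk : k ∈ A) : ‖z k - p‖ ≤ ‖z (φ k) - p‖ + if k ∈ C then 0 else 2 * ‖z i - p‖ := by
  split_ifs with hkC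
  · rw [h.eq_self k hk hkC, add_zero]
  · have h1 := h.dist_le k hk
    have h2 : ‖z k - p‖ ≤ ‖z k - z i‖ + ‖z i - p‖ := norm_sub_le_norm_sub_add_norm_sub _ _ _
    have h3 : ‖z (φ k) - z i‖ ≤ ‖z (φ k) - p‖ + ‖z i - p‖ := by
      rw [norm_sub_rev (z i) p]; exact norm_sub_le_norm_sub_add_norm_sub _ _ _
    linarith

lemma sum_ite_mem_eq_card_sdiff (A C : Finset (Fin n)) (c : ℝ) :
    ∑ k ∈ A, (if k ∈ C then 0 else c) = (A \ C).card * c := by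
  rw [Finset.sum_ite, Finset.sum_const_zero, zero_add, Finset.sum_const, nsmul_eq_mul,
    Finset.filter_notMem_eq_sdiff]

lemma IsSelection.sum_norm_sub_le (h : IsSelection C m z i A φ) (p : E) {A' : Finset (Fin n)}
    (hA' : A' ⊆ A) : ∑ k ∈ A', ‖z k - p‖ ≤
      ∑ k ∈ A', ‖z (φ k) - p‖ + (A' \ C).card * (2 * ‖z i - p‖) := by
  rw [← sum_ite_mem_eq_card_sdiff, ← Finset.sum_add_distrib]
  exact Finset.sum_le_sum fun k hk => h.norm_sub_le p (hA' hk)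

/-- Cauchy–Schwarz; injectivity of `φ` turns the sum of squares into a partial sum over `C`. -/
lemma IsSelection.sum_norm_sub_sq_le (h : IsSelection C m z i A φ) (p : E)
    {A' : Finset (Fin n)} (hA' : A' ⊆ A) :
    (∑ k ∈ A', ‖z (φ k) - p‖) ^ 2 ≤ A'.card * ∑ k ∈ C, ‖z k - p‖ ^ 2 := by
  refine (sq_sum_le_card_mul_sum_sq).trans ?_
  gcongr
  rw [← Finset.sum_image (f := fun k => ‖z k - p‖ ^ 2)
    (h.injOn.mono (Finset.coe_subset.2 hA'))]
  refine Finset.sum_le_sum_of_subset_of_nonneg ?_ fun k _ _ => by positivity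
  intro k hk
  obtain ⟨l, hl, rfl⟩ := Finset.mem_image.1 hk
  exact h.mapsTo l (hA' hl)

/-- Common terms cancel, and equal cardinalities allow every vector to be recentred at p. -/
lemma norm_sum_sub_sum_le (A B : Finset (Fin n)) (hAB : A.card = B.card) (z : Fin n → E) (p : E) :
    ‖∑ k ∈ A, z k - ∑ k ∈ B, z k‖ ≤ ∑ k ∈ A \ B, ‖z k - p‖ + ∑ k ∈ B \ A, ‖z k - p‖ := by
  have h1 : ∑ k ∈ A, z k - ∑ k ∈ B, z k = ∑ k ∈ A \ B, (z k - p) - ∑ k ∈ B \ A, (z k - p) := by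
    have e1 := Finset.sum_sdiff_sub_sum_sdiff (s₁ := B) (s₂ := A) (f := fun k => z k - p)
    rw [e1, Finset.sum_sub_distrib, Finset.sum_sub_distrib, Finset.sum_const, Finset.sum_const,
      hAB]
    abel
  rw [h1]
  exact (norm_sub_le _ _).trans (add_le_add (norm_sum_le _ _) (norm_sum_le _ _))

lemma card_sdiff_le_of_card (hB : B.card = n - 2 * f) : (A \ B).card ≤ 2 * f := by
  have h1 : (A \ B).card ≤ (Bᶜ).card :=
    Finset.card_le_card fun x hx => by simp at hx ⊢; exact hx.2
  rw [Finset.card_compl, hB, Fintype.card_fin] at h1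
  omega

/-- The two differences are disjoint, so together they contain each faulty node at most once: the
total is f, not 2f. -/
lemma card_faulty_le (hC : C.card = n - f) (A B : Finset (Fin n)) :
    ((A \ B) \ C).card + ((B \ A) \ C).card ≤ f := by
  rw [← Finset.card_union_of_disjoint]
  · have h1 : ((A \ B) \ C ∪ (B \ A) \ C).card ≤ (Cᶜ).card :=
      Finset.card_le_card fun x hx => by simp at hx ⊢; tauto
    rw [Finset.card_compl, hC, Fintype.card_fin] at h1
    omega
  · rw [Finset.disjoint_left]; intro x; simp; tauto

/-- The scalar estimate behind the comparison of two selections. -/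
lemma sq_le_of_le_charges {N a b e e' u v F V : ℝ} (hN : 0 ≤ N) (ha : a ^ 2 ≤ 2 * F * V)
    (hb : b ^ 2 ≤ 2 * F * V) (he : 0 ≤ e) (he' : 0 ≤ e') (hF : e + e' ≤ F)
    (h : N ≤ (a + b) + 2 * (e * u + e' * v)) :
    N ^ 2 ≤ (32 / 3) * F * V + 16 * F ^ 2 * (u ^ 2 + v ^ 2) := by
  have h1 : N ^ 2 ≤ ((a + b) + 2 * (e * u + e' * v)) ^ 2 := by gcongr
  have h2 : (e * u + e' * v) ^ 2 ≤ F ^ 2 * (u ^ 2 + v ^ 2) := by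
    have t1 : (e * u + e' * v) ^ 2 ≤ (e ^ 2 + e' ^ 2) * (u ^ 2 + v ^ 2) := by
      nlinarith [sq_nonneg (e * v - e' * u)]
    have t2 : e ^ 2 + e' ^ 2 ≤ F ^ 2 := by nlinarith [mul_nonneg he he']
    exact t1.trans (mul_le_mul_of_nonneg_right t2 (by positivity))
  have h3 : (a + b) ^ 2 ≤ 8 * F * V := by linarith [sq_nonneg (a - b)]
  -- Young's inequality with weight 1/3: (x + 2w)² ≤ (4/3)x² + 16w² for x = a + b and w = e u + e'
  -- v, and (4/3) · 8 = 32/3.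
  linarith [sq_nonneg ((a + b) / 3 - 2 * (e * u + e' * v))]

/-- Two selections that share most of their elements have close sums. -/
lemma norm_sum_sub_sum_sq_le (hC : C.card = n - f)
    (hA : IsSelection C (n - 2 * f) z i A φ) (hB : IsSelection C (n - 2 * f) z j B ψ) (p : E) :
    ‖∑ k ∈ A, z k - ∑ k ∈ B, z k‖ ^ 2 ≤ (32 / 3) * f * ∑ k ∈ C, ‖z k - p‖ ^ 2 +
      16 * (f : ℝ) ^ 2 * (‖z i - p‖ ^ 2 + ‖z j - p‖ ^ 2) := by
  have h1 := norm_sum_sub_sum_le A B (hA.card_eq.trans hB.card_eq.symm) z p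
  have h2 := hA.sum_norm_sub_le p (Finset.sdiff_subset (s := A) (t := B))
  have h3 := hB.sum_norm_sub_le p (Finset.sdiff_subset (s := B) (t := A))
  have h4 := hA.sum_norm_sub_sq_le p (Finset.sdiff_subset (s := A) (t := B))
  have h5 := hB.sum_norm_sub_sq_le p (Finset.sdiff_subset (s := B) (t := A))
  have hV : 0 ≤ ∑ k ∈ C, ‖z k - p‖ ^ 2 := by positivity
  have h6 : ((A \ B).card : ℝ) ≤ 2 * f := by
    exact_mod_cast card_sdiff_le_of_card hB.card_eq
  have h7 : ((B \ A).card : ℝ) ≤ 2 * f := by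
    exact_mod_cast card_sdiff_le_of_card hA.card_eq
  have h8 : ((((A \ B) \ C).card : ℕ) : ℝ) + (((B \ A) \ C).card : ℕ) ≤ f := by
    exact_mod_cast card_faulty_le hC A B
  have h4' := h4.trans (mul_le_mul_of_nonneg_right h6 hV)
  have h5' := h5.trans (mul_le_mul_of_nonneg_right h7 hV)
  refine sq_le_of_le_charges (norm_nonneg _) h4' h5' (Nat.cast_nonneg _) (Nat.cast_nonneg _) h8 ?_
  linarith

end Reduction

/-! ### Contraction of the spread and drift of the average -/

section Reduction

variable {n f : ℕ} {E : Type*} [NormedAddCommGroup E] [InnerProductSpace ℝ E]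
  {C : Finset (Fin n)} {z y : Fin n → E} {A : Fin n → Finset (Fin n)} {φ : Fin n → Fin n → Fin n}

/-- Nearest neighbor averaging shrinks the spread of the correct vectors. -/
lemma finSpread_selection_le (hn : 11 * f ≤ n) (hC : C.card = n - f) (hne : C.Nonempty)
    (hA : ∀ i ∈ C, IsSelection C (n - 2 * f) z i (A i) (φ i))
    (hy : ∀ i ∈ C, y i = (1 / ((n : ℝ) - 2 * f)) • ∑ k ∈ A i, z k) :
    finSpread C y ≤ 9.88 * f / ((n : ℝ) - f) * finSpread C z := by
  have hh0 : (0 : ℝ) < C.card := by exact_mod_cast hne.card_pos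
  have hnf : ((C.card : ℕ) : ℝ) = n - f := by rw [hC, Nat.cast_sub (by omega)]
  have hfR : 11 * (f : ℝ) ≤ n := by exact_mod_cast hn
  have hf0 : (0 : ℝ) ≤ f := Nat.cast_nonneg _
  set h : ℝ := (C.card : ℝ)
  -- The assumption n ≥ 11 f reads f ≤ h / 10, and n - 2f = h - f.
  have hm : 9 / 10 * h ≤ (n : ℝ) - 2 * f := by linarith
  set m : ℝ := (n : ℝ) - 2 * f
  have hm0 : 0 < m := by linarith
  -- Centring at the average of `z` makes the right side, once summed over pairs, a multiple of the
  -- spread of `z`.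
  have hpair : ∀ i ∈ C, ∀ j ∈ C, m ^ 2 * ‖y i - y j‖ ^ 2 ≤
      32 / 3 * f * (h * finSpread C z) +
      16 * (f : ℝ) ^ 2 * (‖z i - finAvg C z‖ ^ 2 + ‖z j - finAvg C z‖ ^ 2) := by
    intro i hi j hj
    have h1 := norm_sum_sub_sum_sq_le hC (hA i hi) (hA j hj) (finAvg C z)
    rw [← card_mul_finSpread hne] at h1
    rw [hy i hi, hy j hj, ← smul_sub, norm_smul, mul_pow, Real.norm_eq_abs, sq_abs, ← mul_assoc,
      ← mul_pow, mul_one_div_cancel hm0.ne', one_pow, one_mul]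
    exact h1
  have hsum : m ^ 2 * (2 * h ^ 2 * finSpread C y) ≤
      h ^ 2 * (32 / 3 * f * (h * finSpread C z))
        + 16 * (f : ℝ) ^ 2 * (2 * (h * (h * finSpread C z))) := by
    rw [← sum_sum_norm_sub_sq hne, Finset.mul_sum]
    simp only [Finset.mul_sum _ _ (m ^ 2)]
    refine (Finset.sum_le_sum fun i hi => Finset.sum_le_sum fun j hj => hpair i hi j hj).trans
      (le_of_eq ?_)
    simp only [Finset.sum_add_distrib, Finset.sum_const, ← Finset.mul_sum, nsmul_eq_mul, mul_add]
    rw [← card_mul_finSpread hne]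
    ring
  have hS := finSpread_nonneg C z
  have hkey : m ^ 2 * finSpread C y ≤ (16 / 3 * f * h + 16 * (f : ℝ) ^ 2) * finSpread C z := by
    have : 0 < 2 * h ^ 2 := by positivity
    refine le_of_mul_le_mul_left ?_ this
    linarith
  rw [← hnf, div_mul_eq_mul_div, le_div_iff₀ hh0]
  -- With f ≤ h / 10 the factor is at most (16/3 + 16/10) f h ≤ 7 f h, and 7 / 0.81 < 9.88.
  have h1 : (9 / 10 * h) ^ 2 * finSpread C y ≤ m ^ 2 * finSpread C y := by
    have := finSpread_nonneg C y
    gcongr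
  have h2 : (f : ℝ) ^ 2 ≤ f * (h / 10) := by nlinarith
  have h3 : (16 / 3 * f * h + 16 * (f : ℝ) ^ 2) * finSpread C z
      ≤ (7 * f * h) * finSpread C z := by
    gcongr; nlinarith [mul_nonneg hf0 hh0.le]
  have h4 : 81 / 100 * h * finSpread C y ≤ 7 * f * finSpread C z := by
    refine le_of_mul_le_mul_left ?_ hh0
    nlinarith
  have h5 : 0 ≤ f * finSpread C z := by positivity
  norm_num at *
  linarith

/-- Nearest neighbor averaging moves the average of the correct vectors by a small amount. -/
lemma norm_finAvg_selection_sub_sq_le (hn : 11 * f ≤ n) (hC : C.card = n - f) (hne : C.Nonempty)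
    (hA : ∀ i ∈ C, IsSelection C (n - 2 * f) z i (A i) (φ i))
    (hy : ∀ i ∈ C, y i = (1 / ((n : ℝ) - 2 * f)) • ∑ k ∈ A i, z k) :
    ‖finAvg C y - finAvg C z‖ ^ 2 ≤ 9 * f / ((n : ℝ) - f) * finSpread C z := by
  have hh0 : (0 : ℝ) < C.card := by exact_mod_cast hne.card_pos
  have hnf : ((C.card : ℕ) : ℝ) = n - f := by rw [hC, Nat.cast_sub (by omega)]
  have hfR : 11 * (f : ℝ) ≤ n := by exact_mod_cast hn
  have hf0 : (0 : ℝ) ≤ f := Nat.cast_nonneg _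
  set h : ℝ := (C.card : ℝ)
  have hm : 9 / 10 * h ≤ (n : ℝ) - 2 * f := by linarith
  set m : ℝ := (n : ℝ) - 2 * f with hm_def
  have hm0 : 0 < m := by linarith
  set p := finAvg C z
  set u : Fin n → ℝ := fun k => ‖z k - p‖ with hu
  set P : Fin n → Finset (Fin n) := fun i => (A i \ C).image (φ i) with hP
  -- If the image of a faulty l were selected, `φ` would fix it, being correct; injectivity would
  -- then identify it with l, which is faulty.
  have hPsub : ∀ i ∈ C, P i ⊆ C \ A i := fun i hi k hk => by
    obtain ⟨l, hl, rfl⟩ := Finset.mem_image.1 hk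
    rw [Finset.mem_sdiff] at hl ⊢
    refine ⟨(hA i hi).mapsTo l hl.1, fun hmem => hl.2 ?_⟩
    have h1 := (hA i hi).mapsTo l hl.1
    have h2 := (hA i hi).eq_self _ hmem h1
    rwa [(hA i hi).injOn hmem hl.1 h2] at h1
  have hPcard : ∀ i ∈ C, (P i).card = (A i \ C).card := fun i hi =>
    Finset.card_image_of_injOn ((hA i hi).injOn.mono (by simp))
  have hb : ∀ i ∈ C, (A i \ C).card ≤ f := fun i hi => by
    have h1 : (A i \ C).card ≤ (Cᶜ).card :=
      Finset.card_le_card fun x hx => by simp at hx ⊢; tauto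
    rw [Finset.card_compl, hC, Fintype.card_fin] at h1
    omega
  have hs : ∀ i ∈ C, (C \ A i).card = f + (A i \ C).card := fun i hi => by
    have h1 := Finset.card_sdiff_add_card_inter (A i) C
    have h2 := Finset.card_sdiff_add_card_inter C (A i)
    rw [Finset.inter_comm] at h2
    have := (hA i hi).card_eq
    omega
  have hpt : ∀ i ∈ C, m * ‖y i - p‖ ≤
      ∑ k ∈ C, ((if k ∈ P i then 1 else 0) + if k ∈ C \ A i then 1 else 0) * u k
        + 2 * f * u i := by
    intro i hi
    -- Since the deviations over `C` sum to zero, only the exchange of correct vectors for faulty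
    -- ones displaces the average.
    have e1 : m • (y i - p) = ∑ k ∈ A i \ C, (z k - p) - ∑ k ∈ C \ A i, (z k - p) := by
      have e2 := Finset.sum_sdiff_sub_sum_sdiff (s₁ := C) (s₂ := A i) (f := fun k => z k - p)
      rw [e2, sum_sub_finAvg hne, sub_zero, Finset.sum_sub_distrib, Finset.sum_const,
        (hA i hi).card_eq, hy i hi, smul_sub, smul_smul, mul_one_div_cancel hm0.ne', one_smul,
        ← Nat.cast_smul_eq_nsmul ℝ, Nat.cast_sub (by omega), hm_def]
      push_cast; rfl
    have e3 : m * ‖y i - p‖ = ‖m • (y i - p)‖ := by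
      rw [norm_smul, Real.norm_of_nonneg hm0.le]
    have e4 : ∑ k ∈ A i \ C, ‖z (φ i k) - p‖ = ∑ k ∈ P i, u k := by
      rw [hP, Finset.sum_image ((hA i hi).injOn.mono (by simp))]
    have e5 : ∑ k ∈ P i, u k = ∑ k ∈ C, (if k ∈ P i then 1 else 0) * u k := by
      simp only [ite_mul, one_mul, zero_mul]
      rw [← Finset.sum_filter, Finset.filter_mem_eq_inter, Finset.inter_eq_right.2
        ((hPsub i hi).trans Finset.sdiff_subset)]
    have e6 : ∑ k ∈ C \ A i, u k = ∑ k ∈ C, (if k ∈ C \ A i then 1 else 0) * u k := by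
      simp only [ite_mul, one_mul, zero_mul]
      rw [← Finset.sum_filter, Finset.filter_mem_eq_inter, Finset.inter_eq_right.2
        Finset.sdiff_subset]
    have e7 := (hA i hi).sum_norm_sub_le p (Finset.sdiff_subset (s := A i) (t := C))
    rw [sdiff_idem, e4] at e7
    have e8 : (((A i \ C).card : ℕ) : ℝ) * (2 * u i) ≤ f * (2 * u i) := by
      have : 0 ≤ u i := norm_nonneg _
      gcongr
      exact_mod_cast hb i hi
    simp only [add_mul, Finset.sum_add_distrib]
    rw [e3, e1, ← e5, ← e6]
    have e9 := norm_sub_le (∑ k ∈ A i \ C, (z k - p)) (∑ k ∈ C \ A i, (z k - p))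
    have e10 := norm_sum_le (A i \ C) (fun k => z k - p)
    have e11 := norm_sum_le (C \ A i) (fun k => z k - p)
    simp only [hu] at *
    linarith
  -- average frequencies with which a correct vector is charged or left out
  set a : Fin n → ℝ := fun k => (1 / h) * ∑ i ∈ C, if k ∈ P i then 1 else 0 with ha
  set s : Fin n → ℝ := fun k => (1 / h) * ∑ i ∈ C, if k ∈ C \ A i then 1 else 0 with hs_def
  have ha0 : ∀ k, 0 ≤ a k := fun k => by simp only [ha]; positivity
  have has : ∀ k, a k ≤ s k := fun k => by
    simp only [ha, hs_def]
    refine mul_le_mul_of_nonneg_left (Finset.sum_le_sum fun i hi => ?_) (by positivity)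
    by_cases hk : k ∈ P i
    · rw [if_pos hk, if_pos (hPsub i hi hk)]
    · rw [if_neg hk]; positivity
  have hs1 : ∀ k, s k ≤ 1 := fun k => by
    simp only [hs_def]
    rw [one_div, inv_mul_le_iff₀ hh0, mul_one]
    calc ∑ i ∈ C, (if k ∈ C \ A i then (1 : ℝ) else 0) ≤ ∑ i ∈ C, (1 : ℝ) :=
          Finset.sum_le_sum fun i _ => by split_ifs <;> norm_num
      _ = h := by simp [h]
  have hcount : ∀ B : Fin n → Finset (Fin n), ∀ c : ℝ, (∀ i ∈ C, B i ⊆ C) →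
      (∀ i ∈ C, ((B i).card : ℝ) ≤ c) →
      ∑ k ∈ C, (1 / h) * ∑ i ∈ C, (if k ∈ B i then (1 : ℝ) else 0) ≤ c := by
    intro B c hB hc
    rw [← Finset.mul_sum, Finset.sum_comm, one_div, inv_mul_le_iff₀ hh0]
    calc ∑ i ∈ C, ∑ k ∈ C, (if k ∈ B i then (1 : ℝ) else 0) ≤ ∑ i ∈ C, c := by
          refine Finset.sum_le_sum fun i hi => ?_
          rw [← Finset.sum_filter, Finset.filter_mem_eq_inter, Finset.inter_eq_right.2 (hB i hi),
            Finset.sum_const, nsmul_eq_mul, mul_one]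
          exact hc i hi
      _ = h * c := by simp [h]
  have hasum : ∑ k ∈ C, a k ≤ f := hcount P f
    (fun i hi => (hPsub i hi).trans Finset.sdiff_subset)
    (fun i hi => by rw [hPcard i hi]; exact_mod_cast hb i hi)
  have hssum : ∑ k ∈ C, s k ≤ 2 * f := hcount (fun i => C \ A i) (2 * f)
    (fun i hi => Finset.sdiff_subset)
    (fun i hi => by
      have h1 := hb i hi
      have h2 := hs i hi
      have h3 : (C \ A i).card ≤ 2 * f := by omega
      exact_mod_cast h3)
  -- Summing over the receivers before applying Cauchy–Schwarz leaves one weight per correct vector: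
  -- how often it is charged, how often it is left out, and its own share 2f / h.
  set w : Fin n → ℝ := fun k => a k + s k + 2 * f / h with hw
  have hmean : m * ‖finAvg C y - p‖ ≤ ∑ k ∈ C, w k * u k := by
    have e1 : finAvg C y - p = finAvg C (fun i => y i - p) := by
      rw [finAvg_sub, finAvg_const hne]
    have e2 := norm_finAvg_le C (fun i => y i - p)
    rw [e1]
    calc m * ‖finAvg C fun i => y i - p‖ ≤ m * ((1 / h) * ∑ i ∈ C, ‖y i - p‖) := by gcongr
      _ = (1 / h) * ∑ i ∈ C, m * ‖y i - p‖ := by rw [← Finset.mul_sum]; ring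
      _ ≤ (1 / h) * ∑ i ∈ C, (∑ k ∈ C, ((if k ∈ P i then 1 else 0) +
            if k ∈ C \ A i then 1 else 0) * u k + 2 * f * u i) := by
          refine mul_le_mul_of_nonneg_left (Finset.sum_le_sum hpt) (by positivity)
      _ = ∑ k ∈ C, w k * u k := by
          rw [Finset.sum_add_distrib, Finset.sum_comm, ← Finset.sum_add_distrib, Finset.mul_sum]
          refine Finset.sum_congr rfl fun k _ => ?_
          rw [← Finset.sum_mul, Finset.sum_add_distrib]
          simp only [hw, ha, hs_def]
          ring
  have hwsq : ∑ k ∈ C, w k ^ 2 ≤ 33 / 5 * f := by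
    have hfh : f / h ≤ 1 / 10 := by rw [div_le_iff₀ hh0]; linarith
    have hfh0 : 0 ≤ f / h := by positivity
    -- From a ≤ s ≤ 1, (a + s)² ≤ 3a + s; the cross term adds at most (2/5)(a + s). Over `C` the
    -- three parts give 17/5 f, 14/5 f and 2/5 f, hence 33/5 f, and (33/5) / 0.81 < 9.
    have e1 : ∀ k ∈ C, w k ^ 2 ≤ (17 / 5 * a k + 7 / 5 * s k) + 4 * (f / h) ^ 2 := by
      intro k _
      have h1 := ha0 k
      have h2 := has k
      have h3 := hs1 k
      have h4 : (a k + s k) ^ 2 ≤ 3 * a k + s k := by nlinarith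
      have h5 : (a k + s k) * (f / h) ≤ (a k + s k) * (1 / 10) := by gcongr
      have h6 : w k = a k + s k + 2 * (f / h) := by simp only [hw]; rw [mul_div_assoc]
      rw [h6]
      linarith
    refine (Finset.sum_le_sum e1).trans ?_
    rw [Finset.sum_add_distrib, Finset.sum_add_distrib, ← Finset.mul_sum C a (17 / 5),
      ← Finset.mul_sum C s (7 / 5), Finset.sum_const, nsmul_eq_mul]
    have e2 : h * (4 * (f / h) ^ 2) ≤ 2 / 5 * f := by
      have : h * (4 * (f / h) ^ 2) = 4 * f * (f / h) := by field_simp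
      rw [this]; nlinarith
    linarith
  have hcs : (∑ k ∈ C, w k * u k) ^ 2 ≤ 33 / 5 * f * (h * finSpread C z) := by
    refine (Finset.sum_mul_sq_le_sq_mul_sq C w u).trans ?_
    rw [card_mul_finSpread hne]
    gcongr
  have hfin : m ^ 2 * ‖finAvg C y - p‖ ^ 2 ≤ 33 / 5 * f * (h * finSpread C z) := by
    rw [← mul_pow]
    refine le_trans ?_ hcs
    gcongr
  have hS := finSpread_nonneg C z
  rw [← hnf, div_mul_eq_mul_div, le_div_iff₀ hh0]
  have h1 : (9 / 10 * h) ^ 2 * ‖finAvg C y - p‖ ^ 2 ≤ m ^ 2 * ‖finAvg C y - p‖ ^ 2 := by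
    gcongr
  have h4 : 81 / 100 * h * ‖finAvg C y - p‖ ^ 2 ≤ 33 / 5 * f * finSpread C z := by
    refine le_of_mul_le_mul_left ?_ hh0
    linarith
  have h5 : 0 ≤ f * finSpread C z := by positivity
  linarith

end Reduction

lemma IsNNA.exists_selection {n d f : ℕ} {C R : Finset (Fin n)} {z : Fin n → Param d} {i : Fin n}
    {y : Param d} (hn : 11 * f ≤ n) (hC : C.card = n - f) (hi : i ∈ C) (hiR : i ∉ R)
    (hR : R.card = n - f - 1) (h : IsNNA f z i R y) :
    ∃ (A : Finset (Fin n)) (φ : Fin n → Fin n), IsSelection C (n - 2 * f) z i A φ ∧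
      y = (1 / ((n : ℝ) - 2 * f)) • ∑ j ∈ A, z j := by
  obtain ⟨A, φ, h1, h2, h3, h4, h5, h6, h7⟩ := h.exists_matching hn hC hi hiR hR
  exact ⟨A, φ, ⟨h1, h2, h4, h5, h6, h7⟩, h3⟩

/-- One round of nearest neighbor averaging: contraction of the spread and drift of the average. -/
lemma IsNNA.reduction {n d f : ℕ} {C : Finset (Fin n)} {R : Fin n → Finset (Fin n)}
    {z y : Fin n → Param d} (hn : 11 * f ≤ n) (hC : C.card = n - f) (hne : C.Nonempty)
    (hR : ∀ i ∈ C, i ∉ R i ∧ (R i).card = n - f - 1) (h : ∀ i ∈ C, IsNNA f z i (R i) (y i)) :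
    finSpread C y ≤ 9.88 * f / ((n : ℝ) - f) * finSpread C z ∧
      ‖finAvg C y - finAvg C z‖ ^ 2 ≤ 9 * f / ((n : ℝ) - f) * finSpread C z := by
  have h1 : ∀ i, ∃ (A : Finset (Fin n)) (φ : Fin n → Fin n), i ∈ C →
      IsSelection C (n - 2 * f) z i A φ ∧
        y i = (1 / ((n : ℝ) - 2 * f)) • ∑ j ∈ A, z j := fun i => by
    by_cases hi : i ∈ C
    · obtain ⟨A, φ, h2⟩ := (h i hi).exists_selection hn hC hi (hR i hi).1 (hR i hi).2
      exact ⟨A, φ, fun _ => h2⟩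
    · exact ⟨∅, id, fun h => absurd h hi⟩
  choose A φ h2 using h1
  exact ⟨finSpread_selection_le hn hC hne (fun i hi => (h2 i hi).1) (fun i hi => (h2 i hi).2),
    norm_finAvg_selection_sub_sq_le hn hC hne (fun i hi => (h2 i hi).1)
      (fun i hi => (h2 i hi).2)⟩

open Filter Topology

/-! ### Functions with Lipschitz gradient -/

section Smooth

variable {E : Type*} [NormedAddCommGroup E] [InnerProductSpace ℝ E] [CompleteSpace E]

lemma fderiv_apply_eq_inner_gradient (Q : E → ℝ) (x v : E) :
    fderiv ℝ Q x v = inner ℝ (gradient Q x) v := by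
  rw [← toDual_gradient]; rfl

lemma hasDerivAt_comp_line {Q : E → ℝ} (hQ : Differentiable ℝ Q) (x v : E) (t : ℝ) :
    HasDerivAt (fun s : ℝ => Q (x + s • v)) (inner ℝ (gradient Q (x + t • v)) v) t := by
  rw [← fderiv_apply_eq_inner_gradient]
  have h1 : HasDerivAt (fun s : ℝ => x + s • v) v t := by
    simpa using ((hasDerivAt_id t).smul_const v).const_add x
  exact (hQ (x + t • v)).hasFDerivAt.comp_hasDerivAt t h1

/-- Quadratic upper bound for a function with Lipschitz gradient. -/
lemma le_add_inner_gradient_add_sq {Q : E → ℝ} {L : ℝ} (hQ : Differentiable ℝ Q)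
    (hLip : ∀ x y, ‖gradient Q x - gradient Q y‖ ≤ L * ‖x - y‖) (x v : E) :
    Q (x + v) ≤ Q x + inner ℝ (gradient Q x) v + L / 2 * ‖v‖ ^ 2 := by
  -- Gap between Q on the segment and its quadratic bound; the Lipschitz condition makes its
  -- derivative nonpositive.
  let φ : ℝ → ℝ := fun t =>
    Q (x + t • v) - (t * inner ℝ (gradient Q x) v + t ^ 2 * (L / 2 * ‖v‖ ^ 2))
  have hφ : ∀ t, HasDerivAt φ (inner ℝ (gradient Q (x + t • v)) v -
      (inner ℝ (gradient Q x) v + 2 * t * (L / 2 * ‖v‖ ^ 2))) t := fun t => by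
    refine (hasDerivAt_comp_line hQ x v t).sub (HasDerivAt.add ?_ ?_)
    · simpa using (hasDerivAt_id t).mul_const (inner ℝ (gradient Q x) v)
    · simpa using (hasDerivAt_pow 2 t).mul_const (L / 2 * ‖v‖ ^ 2)
  have hanti : AntitoneOn φ (Set.Icc 0 1) := by
    refine antitoneOn_of_deriv_nonpos (convex_Icc 0 1)
      (fun t _ => (hφ t).continuousAt.continuousWithinAt)
      (fun t _ => (hφ t).differentiableAt.differentiableWithinAt) fun t ht => ?_
    rw [interior_Icc] at ht
    rw [(hφ t).deriv]
    have h1 : inner ℝ (gradient Q (x + t • v) - gradient Q x) v ≤ t * L * ‖v‖ ^ 2 := by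
      refine (real_inner_le_norm _ _).trans ?_
      have h2 := hLip (x + t • v) x
      rw [add_sub_cancel_left, norm_smul, Real.norm_of_nonneg ht.1.le] at h2
      calc _ ≤ L * (t * ‖v‖) * ‖v‖ := by gcongr
        _ = _ := by ring
    rw [inner_sub_left] at h1
    linarith
  have := hanti (Set.left_mem_Icc.2 zero_le_one) (Set.right_mem_Icc.2 zero_le_one) zero_le_one
  simp only [φ, one_smul, zero_smul, add_zero] at this
  linarith

/-- A gradient step of length 1 / L lowers Q by at least ‖∇Q‖² / (2L), yet cannot go below b. It
bounds the initial deviation of the momentum, which starts at zero. -/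
lemma norm_gradient_sq_le {Q : E → ℝ} {L b : ℝ} (hL : 0 < L) (hQ : Differentiable ℝ Q)
    (hLip : ∀ x y, ‖gradient Q x - gradient Q y‖ ≤ L * ‖x - y‖) (hb : ∀ x, b ≤ Q x) (x : E) :
    ‖gradient Q x‖ ^ 2 ≤ 2 * L * (Q x - b) := by
  have h := le_add_inner_gradient_add_sq hQ hLip x (-(1 / L) • gradient Q x)
  rw [inner_smul_right, real_inner_self_eq_norm_sq, norm_smul, mul_pow, Real.norm_eq_abs, sq_abs]
    at h
  have h1 := hb (x + -(1 / L) • gradient Q x)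
  have h2 : L / 2 * ((-(1 / L)) ^ 2 * ‖gradient Q x‖ ^ 2) = 1 / (2 * L) * ‖gradient Q x‖ ^ 2 := by
    field_simp
  have h3 : 1 / (2 * L) * ‖gradient Q x‖ ^ 2 ≤ Q x - b := by
    have : -(1 / L) * ‖gradient Q x‖ ^ 2 = - 2 * (1 / (2 * L) * ‖gradient Q x‖ ^ 2) := by
      field_simp
    linarith
  rwa [one_div, inv_mul_le_iff₀ (by positivity)] at h3

end Smooth

/-! ### Joint measurability of the stochastic gradient -/

section Measurability

lemma gradient_eq_sum_basis {d : ℕ} (Q : Param d → ℝ) (θ : Param d) :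
    gradient Q θ = ∑ k, fderiv ℝ Q θ (EuclideanSpace.basisFun (Fin d) ℝ k) •
      EuclideanSpace.basisFun (Fin d) ℝ k := by
  conv_lhs => rw [← (EuclideanSpace.basisFun (Fin d) ℝ).sum_repr' (gradient Q θ)]
  refine Finset.sum_congr rfl fun k _ => ?_
  rw [fderiv_apply_eq_inner_gradient, real_inner_comm]

lemma tendsto_difference_quotient {E : Type*} [NormedAddCommGroup E] [InnerProductSpace ℝ E]
    [CompleteSpace E] {Q : E → ℝ} (hQ : Differentiable ℝ Q) (x v : E) :
    Tendsto (fun n : ℕ => ((n : ℝ) + 1) * (Q (x + (1 / ((n : ℝ) + 1)) • v) - Q x)) atTop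
      (𝓝 (inner ℝ (gradient Q x) v)) := by
  have h := (hasDerivAt_comp_line hQ x v 0).tendsto_slope
  rw [zero_smul, add_zero] at h
  have h1 : Tendsto (fun n : ℕ => 1 / ((n : ℝ) + 1)) atTop (𝓝[≠] 0) :=
    tendsto_nhdsWithin_iff.2 ⟨tendsto_one_div_add_atTop_nhds_zero_nat,
      Eventually.of_forall fun n => by simp; positivity⟩
  refine (h.comp h1).congr fun n => ?_
  simp [slope_def_field]
  ring

/-- Each coordinate is a pointwise limit of difference quotients of q with increments 1 / (n + 1),
which are jointly measurable. -/
lemma measurable_pointGradient {d : ℕ} {X : Type*} [MeasurableSpace X] {q : Param d → X → ℝ}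
    (hq : Measurable (Function.uncurry q)) (hd : ∀ x, Differentiable ℝ (fun θ => q θ x)) :
    Measurable (fun p : Param d × X => pointGradient q p.1 p.2) := by
  unfold pointGradient
  simp only [gradient_eq_sum_basis]
  refine Finset.measurable_sum _ fun k _ => Measurable.smul_const ?_ _
  refine measurable_of_tendsto_metrizable (f := fun (n : ℕ) (p : Param d × X) =>
    ((n : ℝ) + 1) * (q (p.1 + (1 / ((n : ℝ) + 1)) • EuclideanSpace.basisFun (Fin d) ℝ k) p.2
      - q p.1 p.2)) (fun n => ?_) ?_
  · refine Measurable.const_mul (Measurable.sub ?_ hq) _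
    exact hq.comp ((measurable_fst.add_const _).prodMk measurable_snd)
  · rw [tendsto_pi_nhds]
    intro p
    rw [fderiv_apply_eq_inner_gradient]
    exact tendsto_difference_quotient (hd p.2) p.1 _

end Measurability

/-! ### Convergence of integrals under an `L²` bound -/

section Convergence

variable {X : Type*} [MeasurableSpace X] {μ : Measure X}

lemma eLpNorm_two_sq {E : Type*} [NormedAddCommGroup E] (F : X → E) :
    eLpNorm F 2 μ ^ 2 = ∫⁻ x, ‖F x‖ₑ ^ 2 ∂μ := by
  have h := eLpNorm_nnreal_pow_eq_lintegral (f := F) (μ := μ) (p := 2) two_ne_zero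
  simpa using h

lemma memLp_two_of_lintegral_lt_top {E : Type*} [NormedAddCommGroup E] {F : X → E}
    (hF : AEStronglyMeasurable F μ) (h : ∫⁻ x, ‖F x‖ₑ ^ 2 ∂μ < ∞) : MemLp F 2 μ := by
  refine ⟨hF, ?_⟩
  rw [← eLpNorm_two_sq] at h
  exact (ENNReal.pow_lt_top_iff.1 h).resolve_right two_ne_zero

lemma sq_lintegral_le_lintegral_sq [IsProbabilityMeasure μ] {F : X → ℝ≥0∞}
    (hF : AEMeasurable F μ) : (∫⁻ x, F x ∂μ) ^ 2 ≤ ∫⁻ x, F x ^ 2 ∂μ := by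
  have h := ENNReal.lintegral_mul_le_Lp_mul_Lq μ Real.HolderConjugate.two_two hF
    (aemeasurable_const (b := (1 : ℝ≥0∞)))
  simp only [Pi.mul_apply, mul_one, one_pow, ENNReal.one_rpow, lintegral_one, measure_univ,
    ENNReal.rpow_two] at h
  calc (∫⁻ x, F x ∂μ) ^ 2 ≤ ((∫⁻ x, F x ^ 2 ∂μ) ^ (1 / 2 : ℝ)) ^ 2 := by gcongr
    _ = ∫⁻ x, F x ^ 2 ∂μ := by
      rw [← ENNReal.rpow_natCast, ← ENNReal.rpow_mul]; norm_num

/-- A sequence that is bounded in `L²` and converges pointwise converges in mean. -/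
lemma tendsto_integral_of_sq_bounded [IsProbabilityMeasure μ] {F : ℕ → X → ℝ} {G : X → ℝ}
    {K : ℝ≥0∞} (hK : K ≠ ∞) (hF : ∀ n, AEStronglyMeasurable (F n) μ) (hG : MemLp G 1 μ)
    (hlim : ∀ x, Tendsto (fun n => F n x) atTop (𝓝 (G x)))
    (hb : ∀ n, ∫⁻ x, ‖F n x‖ₑ ^ 2 ∂μ ≤ K) :
    Tendsto (fun n => ∫ x, F n x ∂μ) atTop (𝓝 (∫ x, G x ∂μ)) := by
  have hmem : ∀ n, MemLp (F n) 2 μ := fun n =>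
    memLp_two_of_lintegral_lt_top (hF n) ((hb n).trans_lt hK.lt_top)
  have hui : UnifIntegrable F 1 μ := by
    intro ε hε
    have hc0 : 0 ≤ K.toReal := ENNReal.toReal_nonneg
    -- By Cauchy–Schwarz the integral over s is at most √(K μ(s)); the added 1 avoids division by
    -- zero.
    refine ⟨ε ^ 2 / (K.toReal + 1), by positivity, fun n s hs hμs => ?_⟩
    rw [eLpNorm_indicator_eq_eLpNorm_restrict hs]
    have h1 := ENNReal.lintegral_mul_le_Lp_mul_Lq (μ.restrict s) Real.HolderConjugate.two_two
      (hF n).restrict.enorm (aemeasurable_const (b := (1 : ℝ≥0∞)))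
    simp only [Pi.mul_apply, mul_one, one_pow, lintegral_one, ENNReal.rpow_two,
      Measure.restrict_apply_univ] at h1
    rw [eLpNorm_one_eq_lintegral_enorm]
    refine h1.trans ?_
    rw [← ENNReal.mul_rpow_of_nonneg _ _ (by norm_num)]
    have h2 : (∫⁻ x in s, ‖F n x‖ₑ ^ 2 ∂μ) * μ s ≤ ENNReal.ofReal (ε ^ 2) := by
      calc _ ≤ K * ENNReal.ofReal (ε ^ 2 / (K.toReal + 1)) :=
            mul_le_mul' ((setLIntegral_le_lintegral _ _).trans (hb n)) hμs
        _ = ENNReal.ofReal (K.toReal * (ε ^ 2 / (K.toReal + 1))) := by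
            rw [ENNReal.ofReal_mul hc0, ENNReal.ofReal_toReal hK]
        _ ≤ _ := by
            refine ENNReal.ofReal_le_ofReal ?_
            rw [mul_div_assoc', div_le_iff₀ (by positivity)]
            nlinarith [sq_nonneg ε]
    calc _ ≤ (ENNReal.ofReal (ε ^ 2)) ^ (1 / 2 : ℝ) := by gcongr
      _ = ENNReal.ofReal ε := by
        rw [ENNReal.ofReal_rpow_of_nonneg (by positivity) (by norm_num), ← Real.sqrt_eq_rpow,
          Real.sqrt_sq hε.le]
  have hL1 := tendsto_Lp_finite_of_tendsto_ae le_rfl ENNReal.one_ne_top hF hG hui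
    (Eventually.of_forall hlim)
  exact tendsto_integral_of_L1' G hG.1
    (Eventually.of_forall fun n => (hmem n).integrable (by norm_num)) hL1

end Convergence

/-! ### Unbiasedness of the stochastic gradient -/

section Unbiased

variable {d : ℕ} {X : Type*} [MeasurableSpace X] {q : Param d → X → ℝ} {μ : Measure X}
  {L σ : ℝ}

/-- Fundamental theorem of calculus on the segment, then Jensen. If the right side is infinite there
is nothing to prove; otherwise the derivative is integrable, as the fundamental theorem requires. -/
lemma enorm_sub_line_sq_le {E : Type*} [NormedAddCommGroup E] [InnerProductSpace ℝ E]
    [CompleteSpace E] {Q : E → ℝ} (hQ : Differentiable ℝ Q) (x v : E)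
    (hmeas : Measurable fun s : ℝ => (inner ℝ (gradient Q (x + s • v)) v : ℝ)) :
    ‖Q (x + v) - Q x‖ₑ ^ 2 ≤
      ∫⁻ s in Set.Ioc (0 : ℝ) 1, ‖(inner ℝ (gradient Q (x + s • v)) v : ℝ)‖ₑ ^ 2 := by
  have : IsProbabilityMeasure (volume.restrict (Set.Ioc (0 : ℝ) 1)) := ⟨by simp⟩
  set g : ℝ → ℝ := fun s => inner ℝ (gradient Q (x + s • v)) v
  by_cases htop : ∫⁻ s in Set.Ioc (0 : ℝ) 1, ‖g s‖ₑ ^ 2 = ∞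
  · rw [htop]; exact le_top
  · have hmem : MemLp g 2 (volume.restrict (Set.Ioc (0 : ℝ) 1)) :=
      memLp_two_of_lintegral_lt_top hmeas.aestronglyMeasurable (lt_top_iff_ne_top.2 htop)
    have hint : IntervalIntegrable g volume 0 1 := by
      rw [intervalIntegrable_iff_integrableOn_Ioc_of_le zero_le_one]
      exact hmem.integrable (by norm_num)
    have h1 : ∫ s in (0 : ℝ)..1, g s = Q (x + v) - Q x := by
      have := intervalIntegral.integral_eq_sub_of_hasDerivAt
        (fun s _ => hasDerivAt_comp_line hQ x v s) hint
      simpa only [one_smul, zero_smul, add_zero] using this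
    rw [← h1, intervalIntegral.integral_of_le zero_le_one]
    refine le_trans ?_ (sq_lintegral_le_lintegral_sq hmeas.enorm.aemeasurable)
    gcongr
    exact enorm_integral_le_lintegral_enorm _

lemma lintegral_pointGradient_sq_le (hq : Measurable (Function.uncurry q))
    (hd : ∀ x, Differentiable ℝ (fun θ => q θ x)) [IsProbabilityMeasure μ]
    (hvar : ∀ θ, ∫⁻ x, ‖pointGradient q θ x - gradient (localLoss q μ) θ‖ₑ ^ 2 ∂μ
      ≤ ENNReal.ofReal (σ ^ 2)) (θ : Param d) :
    ∫⁻ x, ‖pointGradient q θ x‖ₑ ^ 2 ∂μ ≤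
      2 * ENNReal.ofReal (σ ^ 2) + 2 * ‖gradient (localLoss q μ) θ‖ₑ ^ 2 := by
  have hm : Measurable (fun x => pointGradient q θ x) :=
    (measurable_pointGradient hq hd).comp measurable_prodMk_left
  set g := gradient (localLoss q μ) θ
  calc ∫⁻ x, ‖pointGradient q θ x‖ₑ ^ 2 ∂μ
      ≤ ∫⁻ x, (2 * ‖pointGradient q θ x - g‖ₑ ^ 2 + 2 * ‖g‖ₑ ^ 2) ∂μ := by
        refine lintegral_mono fun x => ?_
        have h1 : ‖pointGradient q θ x‖ₑ ≤ ‖pointGradient q θ x - g‖ₑ + ‖g‖ₑ := by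
          simpa using enorm_add_le (pointGradient q θ x - g) g
        calc ‖pointGradient q θ x‖ₑ ^ 2 ≤ (‖pointGradient q θ x - g‖ₑ + ‖g‖ₑ) ^ 2 := by gcongr
          _ ≤ _ := by
            have h2 := ENNReal.rpow_add_le_mul_rpow_add_rpow (‖pointGradient q θ x - g‖ₑ) (‖g‖ₑ)
              (one_le_two : (1 : ℝ) ≤ 2)
            norm_num at h2
            rwa [mul_add] at h2
    _ = 2 * ∫⁻ x, ‖pointGradient q θ x - g‖ₑ ^ 2 ∂μ + 2 * ‖g‖ₑ ^ 2 := by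
        rw [lintegral_add_right _ measurable_const, lintegral_const_mul _ (by fun_prop)]
        simp
    _ ≤ _ := by gcongr; exact hvar θ

lemma memLp_pointGradient (hq : Measurable (Function.uncurry q))
    (hd : ∀ x, Differentiable ℝ (fun θ => q θ x)) [IsProbabilityMeasure μ]
    (hvar : ∀ θ, ∫⁻ x, ‖pointGradient q θ x - gradient (localLoss q μ) θ‖ₑ ^ 2 ∂μ
      ≤ ENNReal.ofReal (σ ^ 2)) (θ : Param d) : MemLp (pointGradient q θ) 2 μ := by
  refine memLp_two_of_lintegral_lt_top
    ((measurable_pointGradient hq hd).comp measurable_prodMk_left).aestronglyMeasurable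
    ((lintegral_pointGradient_sq_le hq hd hvar θ).trans_lt ?_)
  exact ENNReal.add_lt_top.2 ⟨ENNReal.mul_lt_top (by simp) ENNReal.ofReal_lt_top,
    ENNReal.mul_lt_top (by simp) (ENNReal.pow_lt_top enorm_lt_top)⟩

lemma lintegral_inner_pointGradient_sq_le (hq : Measurable (Function.uncurry q))
    (hd : ∀ x, Differentiable ℝ (fun θ => q θ x)) [IsProbabilityMeasure μ]
    (hvar : ∀ θ, ∫⁻ x, ‖pointGradient q θ x - gradient (localLoss q μ) θ‖ₑ ^ 2 ∂μ
      ≤ ENNReal.ofReal (σ ^ 2)) (θ v : Param d) {B : ℝ}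
    (hB : ‖gradient (localLoss q μ) θ‖ ≤ B) :
    ∫⁻ x, ‖(inner ℝ (pointGradient q θ x) v : ℝ)‖ₑ ^ 2 ∂μ ≤
      (2 * ENNReal.ofReal (σ ^ 2) + 2 * ENNReal.ofReal B ^ 2) * ‖v‖ₑ ^ 2 := by
  have hm : Measurable (fun x => pointGradient q θ x) :=
    (measurable_pointGradient hq hd).comp measurable_prodMk_left
  calc ∫⁻ x, ‖(inner ℝ (pointGradient q θ x) v : ℝ)‖ₑ ^ 2 ∂μ
      ≤ ∫⁻ x, ‖pointGradient q θ x‖ₑ ^ 2 * ‖v‖ₑ ^ 2 ∂μ := by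
        refine lintegral_mono fun x => ?_
        rw [← mul_pow]
        gcongr
        rw [← ofReal_norm, ← ofReal_norm, ← ofReal_norm,
          ← ENNReal.ofReal_mul (norm_nonneg _)]
        exact ENNReal.ofReal_le_ofReal (norm_inner_le_norm _ _)
    _ = (∫⁻ x, ‖pointGradient q θ x‖ₑ ^ 2 ∂μ) * ‖v‖ₑ ^ 2 :=
        lintegral_mul_const _ (hm.enorm.pow_const 2)
    _ ≤ _ := by
        gcongr
        refine (lintegral_pointGradient_sq_le hq hd hvar _).trans ?_
        gcongr
        rw [← ofReal_norm]
        exact ENNReal.ofReal_le_ofReal hB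

lemma lintegral_lintegral_sq_le_of_forall [SFinite μ] {J : X → ℝ → ℝ}
    (hJ : Measurable (Function.uncurry J)) {K : ℝ≥0∞}
    (hK : ∀ s ∈ Set.Ioc (0 : ℝ) 1, ∫⁻ x, ‖J x s‖ₑ ^ 2 ∂μ ≤ K) :
    ∫⁻ x, (∫⁻ s in Set.Ioc (0 : ℝ) 1, ‖J x s‖ₑ ^ 2) ∂μ ≤ K := by
  have h : AEMeasurable (Function.uncurry fun x s => ‖J x s‖ₑ ^ 2)
      (μ.prod (volume.restrict (Set.Ioc (0 : ℝ) 1))) := (hJ.enorm.pow_const 2).aemeasurable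
  rw [lintegral_lintegral_swap h]
  exact (setLIntegral_mono measurable_const hK).trans (by simp)

/-- By Tonelli, a second moment bound for the directional derivative, uniform along the segment,
passes to the increment. -/
lemma lintegral_sub_sq_le (hq : Measurable (Function.uncurry q))
    (hd : ∀ x, Differentiable ℝ (fun θ => q θ x)) [SFinite μ] (θ w : Param d)
    {K : ℝ≥0∞} (hK : ∀ s ∈ Set.Ioc (0 : ℝ) 1,
      ∫⁻ x, ‖(inner ℝ (pointGradient q (θ + s • w) x) w : ℝ)‖ₑ ^ 2 ∂μ ≤ K) :
    ∫⁻ x, ‖q (θ + w) x - q θ x‖ₑ ^ 2 ∂μ ≤ K := by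
  have h1 : Measurable (fun p : X × ℝ => (θ + p.2 • w, p.1)) :=
    (measurable_const.add (measurable_snd.smul_const w)).prodMk measurable_fst
  have h2 : Measurable (fun p : X × ℝ => pointGradient q (θ + p.2 • w) p.1) :=
    (measurable_pointGradient hq hd).comp h1
  have h3 : Measurable (Function.uncurry fun (x : X) (s : ℝ) =>
      (inner ℝ (pointGradient q (θ + s • w) x) w : ℝ)) := h2.inner_const
  refine le_trans (lintegral_mono fun x => ?_) (lintegral_lintegral_sq_le_of_forall h3 hK)
  have h4 : Measurable fun s : ℝ => (inner ℝ (pointGradient q (θ + s • w) x) w : ℝ) :=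
    h3.of_uncurry_left
  exact enorm_sub_line_sq_le (hd x) θ w h4

/-- The stochastic gradient is unbiased: differentiation under the integral sign is justified by the
bounded variance, which bounds the difference quotients in `L²`. -/
lemma integral_pointGradient (hq : Measurable (Function.uncurry q))
    (hd : ∀ x, Differentiable ℝ (fun θ => q θ x)) [IsProbabilityMeasure μ]
    (hint : ∀ θ, Integrable (q θ) μ) (hQ : Differentiable ℝ (localLoss q μ))
    (hLip : ∀ θ₁ θ₂, ‖gradient (localLoss q μ) θ₁ - gradient (localLoss q μ) θ₂‖ ≤
      L * ‖θ₁ - θ₂‖)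
    (hvar : ∀ θ, ∫⁻ x, ‖pointGradient q θ x - gradient (localLoss q μ) θ‖ₑ ^ 2 ∂μ
      ≤ ENNReal.ofReal (σ ^ 2)) (θ : Param d) :
    ∫ x, pointGradient q θ x ∂μ = gradient (localLoss q μ) θ := by
  have hpg := measurable_pointGradient hq hd
  have hmem := memLp_pointGradient hq hd hvar θ
  refine ext_inner_right ℝ fun v => ?_
  have hI : Integrable (pointGradient q θ) μ := hmem.integrable (by norm_num)
  rw [real_inner_comm, ← integral_inner hI]
  set D : ℕ → X → ℝ := fun n x =>
    ((n : ℝ) + 1) * (q (θ + (1 / ((n : ℝ) + 1)) • v) x - q θ x) with hD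
  have hDmeas : ∀ n, Measurable (D n) := fun n =>
    ((hq.comp measurable_prodMk_left).sub (hq.comp measurable_prodMk_left)).const_mul _
  -- Bound for the local gradient on the whole segment from θ to θ + v. The absolute value is there
  -- because no sign of `L` is assumed here.
  set B : ℝ := ‖gradient (localLoss q μ) θ‖ + |L| * ‖v‖ with hB
  have hB0 : 0 ≤ B := by positivity
  set K : ℝ≥0∞ := (2 * ENNReal.ofReal (σ ^ 2) + 2 * ENNReal.ofReal B ^ 2) * ‖v‖ₑ ^ 2 with hK
  have hKtop : K ≠ ∞ := by
    rw [hK]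
    exact ENNReal.mul_ne_top (ENNReal.add_ne_top.2 ⟨ENNReal.mul_ne_top (by simp) (by simp),
      ENNReal.mul_ne_top (by simp) (by simp)⟩) (by simp)
  -- The increment has second moment of order t² with t = 1 / (n + 1), which cancels the factor (n +
  -- 1)²; hence `K` does not depend on n.
  have hbound : ∀ n, ∫⁻ x, ‖D n x‖ₑ ^ 2 ∂μ ≤ K := by
    intro n
    set t : ℝ := 1 / ((n : ℝ) + 1) with ht
    have ht0 : 0 < t := by positivity
    have ht1 : t ≤ 1 := by rw [ht, div_le_one (by positivity)]; linarith [(n.cast_nonneg : (0:ℝ) ≤ n)]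
    have hnt : ((n : ℝ) + 1) * t = 1 := mul_one_div_cancel (by positivity)
    have h1 : ∫⁻ x, ‖q (θ + t • v) x - q θ x‖ₑ ^ 2 ∂μ ≤
        (2 * ENNReal.ofReal (σ ^ 2) + 2 * ENNReal.ofReal B ^ 2) * ‖t • v‖ₑ ^ 2 := by
      refine lintegral_sub_sq_le hq hd θ (t • v) fun s hs =>
        lintegral_inner_pointGradient_sq_le hq hd hvar _ _ ?_
      have h4 := hLip (θ + s • t • v) θ
      rw [add_sub_cancel_left, norm_smul, norm_smul, Real.norm_of_nonneg hs.1.le,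
        Real.norm_of_nonneg ht0.le] at h4
      have h5 : L * (s * (t * ‖v‖)) ≤ |L| * ‖v‖ := by
        have h6 : s * (t * ‖v‖) ≤ 1 * (1 * ‖v‖) := by
          have := hs.1.le; have := hs.2; gcongr
        calc L * (s * (t * ‖v‖)) ≤ |L| * (s * (t * ‖v‖)) := by
              have := hs.1.le
              gcongr; exact le_abs_self L
          _ ≤ |L| * (1 * (1 * ‖v‖)) := by gcongr
          _ = _ := by ring
      have h7 := norm_add_le (gradient (localLoss q μ) (θ + s • t • v) -
        gradient (localLoss q μ) θ) (gradient (localLoss q μ) θ)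
      rw [sub_add_cancel] at h7
      linarith
    have h2 : ∀ x, ‖D n x‖ₑ ^ 2 = ‖(n : ℝ) + 1‖ₑ ^ 2 * ‖q (θ + t • v) x - q θ x‖ₑ ^ 2 :=
      fun x => by rw [← mul_pow, ← enorm_mul]
    simp only [h2]
    rw [lintegral_const_mul' _ _ (by simp)]
    refine (mul_le_mul_right h1 _).trans (le_of_eq ?_)
    rw [hK, mul_left_comm, ← mul_pow, enorm_smul, ← mul_assoc, ← enorm_mul, hnt, enorm_one, one_mul]
  have hlim := tendsto_integral_of_sq_bounded hKtop (fun n => (hDmeas n).aestronglyMeasurable)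
    (G := fun x => inner ℝ v (pointGradient q θ x))
    (memLp_one_iff_integrable.2 (hI.const_inner v))
    (fun x => by
      rw [real_inner_comm]
      exact tendsto_difference_quotient (hd x) θ v) hbound
  -- The mean of the difference quotients of q is the difference quotient of the local loss, so the
  -- two limits agree.
  have hlim2 := tendsto_difference_quotient hQ θ v
  refine tendsto_nhds_unique hlim (hlim2.congr fun n => ?_)
  simp only [hD, localLoss]
  rw [integral_const_mul, integral_sub (hint _) (hint _)]

end Unbiased

/-! ### Orthogonality of fresh noise -/

section Noise

variable {Ω X S E : Type*} [mΩ : MeasurableSpace Ω] [MeasurableSpace X] [MeasurableSpace S]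
  {P : Measure Ω} [IsProbabilityMeasure P]
  [NormedAddCommGroup E] [InnerProductSpace ℝ E] [CompleteSpace E] [MeasurableSpace E] [BorelSpace E]
  [SecondCountableTopology E]

-- By independence the joint law is a product, so the past state can be frozen and the fresh data
-- integrated first.
omit [InnerProductSpace ℝ E] [CompleteSpace E] [SecondCountableTopology E] in
lemma lintegral_indep_sq_le {Z : Ω → S} {x : Ω → X} (hZ : Measurable Z) (hx : Measurable x)
    (hind : IndepFun Z x P) {H : S → X → E} (hH : Measurable (Function.uncurry H)) {K : ℝ≥0∞}
    (hK : ∀ z, ∫⁻ a, ‖H z a‖ₑ ^ 2 ∂(P.map x) ≤ K) :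
    ∫⁻ ω, ‖H (Z ω) (x ω)‖ₑ ^ 2 ∂P ≤ K := by
  have hlaw := (indepFun_iff_map_prod_eq_prod_map_map hZ.aemeasurable hx.aemeasurable).1 hind
  have := Measure.isProbabilityMeasure_map hZ.aemeasurable (μ := P)
  have := Measure.isProbabilityMeasure_map hx.aemeasurable (μ := P)
  have hm : Measurable fun p : S × X => ‖H p.1 p.2‖ₑ ^ 2 := hH.enorm.pow_const 2
  calc ∫⁻ ω, ‖H (Z ω) (x ω)‖ₑ ^ 2 ∂P
      = ∫⁻ p, ‖H p.1 p.2‖ₑ ^ 2 ∂(P.map fun ω => (Z ω, x ω)) :=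
        (lintegral_map hm (hZ.prodMk hx)).symm
    _ = ∫⁻ z, ∫⁻ a, ‖H z a‖ₑ ^ 2 ∂(P.map x) ∂(P.map Z) := by
        rw [hlaw, lintegral_prod _ hm.aemeasurable]
    _ ≤ ∫⁻ z, K ∂(P.map Z) := lintegral_mono hK
    _ = K := by simp

lemma integral_indep_eq_zero {F : Type*} [NormedAddCommGroup F] [NormedSpace ℝ F]
    [MeasurableSpace F] [BorelSpace F] [SecondCountableTopology F]
    {Z : Ω → S} {x : Ω → X} (hZ : Measurable Z) (hx : Measurable x)
    (hind : IndepFun Z x P) {H : S → X → F} (hH : Measurable (Function.uncurry H))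
    (h0 : ∀ z, ∫ a, H z a ∂(P.map x) = 0) :
    ∫ ω, H (Z ω) (x ω) ∂P = 0 := by
  have hlaw := (indepFun_iff_map_prod_eq_prod_map_map hZ.aemeasurable hx.aemeasurable).1 hind
  have := Measure.isProbabilityMeasure_map hZ.aemeasurable (μ := P)
  have := Measure.isProbabilityMeasure_map hx.aemeasurable (μ := P)
  have h1 : ∫ ω, H (Z ω) (x ω) ∂P = ∫ p, H p.1 p.2 ∂(P.map fun ω => (Z ω, x ω)) :=
    (integral_map (hZ.prodMk hx).aemeasurable hH.aestronglyMeasurable).symm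
  rw [h1, hlaw]
  -- If the integrand is not integrable its Bochner integral is 0 by convention, so no integrability
  -- has to be assumed.
  by_cases hi : Integrable (fun p : S × X => H p.1 p.2) ((P.map Z).prod (P.map x))
  · rw [integral_prod _ hi]
    simp [h0]
  · exact integral_undef hi

/-- A centered function of fresh data is orthogonal to the past. -/
lemma integral_inner_indep_eq_zero {Y : Ω → E} {Z : Ω → S} {x : Ω → X} (hY : Measurable Y)
    (hZ : Measurable Z) (hx : Measurable x) (hind : IndepFun (fun ω => (Y ω, Z ω)) x P)
    {H : S → X → E} (hH : Measurable (Function.uncurry H))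
    (hI : ∀ z, Integrable (H z) (P.map x)) (h0 : ∀ z, ∫ a, H z a ∂(P.map x) = 0) :
    ∫ ω, (inner ℝ (Y ω) (H (Z ω) (x ω)) : ℝ) ∂P = 0 := by
  refine integral_indep_eq_zero (hY.prodMk hZ) hx hind
    (H := fun p a => (inner ℝ p.1 (H p.2 a) : ℝ)) ?_ fun p => ?_
  · have h1 : Measurable fun w : (E × S) × X => H w.1.2 w.2 :=
      hH.comp ((measurable_snd.comp measurable_fst).prodMk measurable_snd)
    exact (measurable_fst.comp measurable_fst).inner h1
  · rw [integral_inner (hI p.2), h0, inner_zero_right]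

/-- Centered functions of independent fresh data are orthogonal. -/
lemma integral_inner_indep_pair_eq_zero {Z : Ω → S} {x y : Ω → X}
    (hZ : Measurable Z) (hx : Measurable x) (hy : Measurable y) (hxy : IndepFun x y P)
    (hind : IndepFun Z (fun ω => (x ω, y ω)) P)
    {H K : S → X → E} (hH : Measurable (Function.uncurry H)) (hK : Measurable (Function.uncurry K))
    (hI : ∀ z, Integrable (K z) (P.map y)) (h0 : ∀ z, ∫ a, K z a ∂(P.map y) = 0) :
    ∫ ω, (inner ℝ (H (Z ω) (x ω)) (K (Z ω) (y ω)) : ℝ) ∂P = 0 := by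
  have hlaw := (indepFun_iff_map_prod_eq_prod_map_map hx.aemeasurable hy.aemeasurable).1 hxy
  have := Measure.isProbabilityMeasure_map hx.aemeasurable (μ := P)
  have := Measure.isProbabilityMeasure_map hy.aemeasurable (μ := P)
  refine integral_indep_eq_zero hZ (hx.prodMk hy) hind
    (H := fun z p => (inner ℝ (H z p.1) (K z p.2) : ℝ)) ?_ fun z => ?_
  · have h1 : Measurable fun w : S × X × X => H w.1 w.2.1 :=
      hH.comp (measurable_fst.prodMk (measurable_fst.comp measurable_snd))
    have h2 : Measurable fun w : S × X × X => K w.1 w.2.2 :=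
      hK.comp (measurable_fst.prodMk (measurable_snd.comp measurable_snd))
    exact h1.inner h2
  · rw [hlaw]
    by_cases hi : Integrable (fun p : X × X => (inner ℝ (H z p.1) (K z p.2) : ℝ))
      ((P.map x).prod (P.map y))
    · rw [integral_prod _ hi]
      simp only [integral_inner (hI z), h0, inner_zero_right, integral_zero]
    · exact integral_undef hi

end Noise

/-! ### Square integrable families and orthogonal noise -/

section SquareIntegrable

variable {Ω ι E : Type*} [MeasurableSpace Ω] {P : Measure Ω}
  [NormedAddCommGroup E] [InnerProductSpace ℝ E]

omit [InnerProductSpace ℝ E] in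
lemma MeasureTheory.MemLp.integrable_norm_sq {F : Ω → E} (hF : MemLp F 2 P) :
    Integrable (fun ω => ‖F ω‖ ^ 2) P :=
  (memLp_two_iff_integrable_sq_norm hF.1).1 hF

lemma MeasureTheory.MemLp.integrable_inner {F G : Ω → E} (hF : MemLp F 2 P) (hG : MemLp G 2 P) :
    Integrable (fun ω => (inner ℝ (F ω) (G ω) : ℝ)) P := by
  have h : ∀ ω, (inner ℝ (F ω) (G ω) : ℝ) =
      (‖F ω + G ω‖ ^ 2 - ‖F ω‖ ^ 2 - ‖G ω‖ ^ 2) / 2 := fun ω => by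
    rw [norm_add_sq_real]; ring
  simp only [h]
  exact (((hF.add hG).integrable_norm_sq.sub hF.integrable_norm_sq).sub
    hG.integrable_norm_sq).div_const 2

lemma memLp_finAvg {C : Finset ι} {z : ι → Ω → E} (hz : ∀ i ∈ C, MemLp (z i) 2 P) :
    MemLp (fun ω => finAvg C fun i => z i ω) 2 P := by
  unfold finAvg
  exact (memLp_finsetSum C hz).const_smul _

lemma integrable_finSpread {C : Finset ι} {z : ι → Ω → E} (hz : ∀ i ∈ C, MemLp (z i) 2 P) :
    Integrable (fun ω => finSpread C fun i => z i ω) P := by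
  unfold finSpread
  exact (integrable_finsetSum C fun i hi =>
    ((hz i hi).sub (memLp_finAvg hz)).integrable_norm_sq).const_mul _

lemma integral_norm_add_sq_of_orthogonal {F G : Ω → E} (hF : MemLp F 2 P) (hG : MemLp G 2 P)
    (h : ∫ ω, (inner ℝ (F ω) (G ω) : ℝ) ∂P = 0) :
    ∫ ω, ‖F ω + G ω‖ ^ 2 ∂P = ∫ ω, ‖F ω‖ ^ 2 ∂P + ∫ ω, ‖G ω‖ ^ 2 ∂P := by
  simp only [norm_add_sq_real]
  have h1 : Integrable (fun ω => ‖F ω‖ ^ 2 + 2 * (inner ℝ (F ω) (G ω) : ℝ)) P :=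
    hF.integrable_norm_sq.add ((hF.integrable_inner hG).const_mul 2)
  rw [integral_add h1
    hG.integrable_norm_sq, integral_add hF.integrable_norm_sq
    ((hF.integrable_inner hG).const_mul 2), integral_const_mul, h]
  ring

/-- The average of pairwise orthogonal vectors. -/
lemma integral_norm_finAvg_sq_le {C : Finset ι} (hC : C.Nonempty) {ν : ι → Ω → E} {s : ℝ}
    (hν : ∀ i ∈ C, MemLp (ν i) 2 P) (hs : ∀ i ∈ C, ∫ ω, ‖ν i ω‖ ^ 2 ∂P ≤ s)
    (horth : ∀ i ∈ C, ∀ j ∈ C, i ≠ j → ∫ ω, (inner ℝ (ν i ω) (ν j ω) : ℝ) ∂P = 0) :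
    ∫ ω, ‖finAvg C fun i => ν i ω‖ ^ 2 ∂P ≤ s / C.card := by
  have hh0 : (0 : ℝ) < C.card := by exact_mod_cast hC.card_pos
  have h : ∀ ω, ‖finAvg C fun i => ν i ω‖ ^ 2 =
      (1 / (C.card : ℝ)) ^ 2 * ∑ i ∈ C, ∑ j ∈ C, inner ℝ (ν i ω) (ν j ω) := fun ω => by
    rw [finAvg, norm_smul, mul_pow, Real.norm_eq_abs, sq_abs, ← real_inner_self_eq_norm_sq,
      sum_inner]
    simp only [inner_sum]
  simp only [h]
  rw [integral_const_mul, integral_finsetSum _ fun i hi => integrable_finsetSum _ fun j hj =>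
    (hν i hi).integrable_inner (hν j hj)]
  have h2 : ∑ i ∈ C, ∫ ω, ∑ j ∈ C, (inner ℝ (ν i ω) (ν j ω) : ℝ) ∂P ≤ ∑ i ∈ C, s := by
    refine Finset.sum_le_sum fun i hi => ?_
    rw [integral_finsetSum _ fun j hj => (hν i hi).integrable_inner (hν j hj),
      Finset.sum_eq_single_of_mem i hi fun j hj hji => horth i hi j hj hji.symm]
    simpa only [real_inner_self_eq_norm_sq] using hs i hi
  rw [Finset.sum_const, nsmul_eq_mul] at h2
  calc _ ≤ (1 / (C.card : ℝ)) ^ 2 * (C.card * s) := by gcongr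
    _ = s / C.card := by field_simp

/-- The spread of a family perturbed by noise that is orthogonal to it. -/
lemma integral_finSpread_add_noise_le {C : Finset ι} (hC : C.Nonempty) {z ν : ι → Ω → E} {s : ℝ}
    (hz : ∀ i ∈ C, MemLp (z i) 2 P) (hν : ∀ i ∈ C, MemLp (ν i) 2 P)
    (hs : ∀ i ∈ C, ∫ ω, ‖ν i ω‖ ^ 2 ∂P ≤ s)
    (horth : ∀ i ∈ C, ∀ j ∈ C, ∫ ω, (inner ℝ (z i ω) (ν j ω) : ℝ) ∂P = 0) :
    ∫ ω, finSpread C (fun i => z i ω + ν i ω) ∂P ≤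
      ∫ ω, finSpread C (fun i => z i ω) ∂P + s := by
  have hh0 : (0 : ℝ) < C.card := by exact_mod_cast hC.card_pos
  -- The cross term is expanded into inner products of uncentred vectors, for which orthogonality is
  -- given. It needs all pairs of nodes, since every `z j` enters through the average.
  have h : ∀ ω, finSpread C (fun i => z i ω + ν i ω) = finSpread C (fun i => z i ω)
      + finSpread C (fun i => ν i ω) + (1 / (C.card : ℝ)) * ∑ i ∈ C,
        2 * (inner ℝ (z i ω) (ν i ω) - (1 / (C.card : ℝ)) * ∑ j ∈ C, inner ℝ (z j ω) (ν i ω)) := by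
    intro ω
    have e1 : ∑ i ∈ C, 2 * (inner ℝ (z i ω) (ν i ω) -
        (1 / (C.card : ℝ)) * ∑ j ∈ C, inner ℝ (z j ω) (ν i ω)) =
        ∑ i ∈ C, 2 * inner ℝ (z i ω - finAvg C fun j => z j ω)
          (ν i ω - finAvg C fun j => ν j ω) := by
      simp only [← Finset.mul_sum, inner_sub_right (z _ ω - _), Finset.sum_sub_distrib, ← sum_inner]
      have e2 := sum_sub_finAvg hC fun j => z j ω
      rw [Finset.sum_sub_distrib] at e2
      rw [e2, inner_zero_left, sub_zero]
      simp only [inner_sub_left, Finset.sum_sub_distrib]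
      congr 2
      rw [Finset.mul_sum]
      refine Finset.sum_congr rfl fun i _ => ?_
      rw [finAvg, inner_smul_left]; simp
    rw [e1]
    simp only [finSpread, finAvg_add, add_sub_add_comm, norm_add_sq_real, Finset.sum_add_distrib]
    ring
  have hin : ∀ i ∈ C, ∀ j ∈ C, Integrable (fun ω => (inner ℝ (z i ω) (ν j ω) : ℝ)) P :=
    fun i hi j hj => (hz i hi).integrable_inner (hν j hj)
  have hin2 : ∀ i ∈ C, Integrable (fun ω => 2 * ((inner ℝ (z i ω) (ν i ω) : ℝ) -
      (1 / (C.card : ℝ)) * ∑ j ∈ C, inner ℝ (z j ω) (ν i ω))) P := fun i hi =>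
    ((hin i hi i hi).sub ((integrable_finsetSum C fun j hj => hin j hj i hi).const_mul _)).const_mul 2
  have hcross : ∫ ω, (1 / (C.card : ℝ)) * ∑ i ∈ C, 2 * ((inner ℝ (z i ω) (ν i ω) : ℝ) -
      (1 / (C.card : ℝ)) * ∑ j ∈ C, inner ℝ (z j ω) (ν i ω)) ∂P = 0 := by
    rw [integral_const_mul, integral_finsetSum _ hin2, Finset.sum_eq_zero, mul_zero]
    intro i hi
    rw [integral_const_mul, integral_sub (hin i hi i hi)
      ((integrable_finsetSum C fun j hj => hin j hj i hi).const_mul _), integral_const_mul,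
      integral_finsetSum _ fun j hj => hin j hj i hi, horth i hi i hi,
      Finset.sum_eq_zero fun j hj => horth j hj i hi]
    simp
  have hnoise : ∫ ω, finSpread C (fun i => ν i ω) ∂P ≤ s := by
    calc ∫ ω, finSpread C (fun i => ν i ω) ∂P
        ≤ ∫ ω, (1 / (C.card : ℝ)) * ∑ i ∈ C, ‖ν i ω‖ ^ 2 ∂P := by
          refine integral_mono (integrable_finSpread hν)
            ((integrable_finsetSum C fun i hi => (hν i hi).integrable_norm_sq).const_mul _)
            fun ω => ?_
          simpa using finSpread_le_of_center (C := C) (fun i => ν i ω) 0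
      _ = (1 / (C.card : ℝ)) * ∑ i ∈ C, ∫ ω, ‖ν i ω‖ ^ 2 ∂P := by
          rw [integral_const_mul, integral_finsetSum _ fun i hi => (hν i hi).integrable_norm_sq]
      _ ≤ (1 / (C.card : ℝ)) * ∑ i ∈ C, s := by gcongr with i hi; exact hs i hi
      _ = s := by rw [Finset.sum_const, nsmul_eq_mul]; field_simp
  simp only [h]
  have hsum : Integrable (fun ω => finSpread C (fun i => z i ω) + finSpread C (fun i => ν i ω)) P :=
    (integrable_finSpread hz).add (integrable_finSpread hν)
  rw [integral_add hsum
    ((integrable_finsetSum C hin2).const_mul _), integral_add (integrable_finSpread hz)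
    (integrable_finSpread hν), hcross]
  linarith

end SquareIntegrable

/-! ### Gradients of the local and average losses -/

section Loss

variable {n d : ℕ} {X : Type*} [MeasurableSpace X] {q : Param d → X → ℝ} {D : Fin n → Measure X}
  {C : Finset (Fin n)} {L σ ζ : ℝ}

lemma LipschitzSmooth.hasFDerivAt_correctLoss (h : LipschitzSmooth q D C L) (θ : Param d) :
    HasFDerivAt (correctLoss q D C)
      ((1 / (C.card : ℝ)) • ∑ i ∈ C, fderiv ℝ (localLoss q (D i)) θ) θ := by
  have h1 : HasFDerivAt (fun η => ∑ i ∈ C, localLoss q (D i) η)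
      (∑ i ∈ C, fderiv ℝ (localLoss q (D i)) θ) θ :=
    HasFDerivAt.fun_sum fun i hi => ((h i hi).1 θ).hasFDerivAt
  exact h1.const_mul _

lemma LipschitzSmooth.differentiable_correctLoss (h : LipschitzSmooth q D C L) :
    Differentiable ℝ (correctLoss q D C) :=
  fun θ => (h.hasFDerivAt_correctLoss θ).differentiableAt

lemma LipschitzSmooth.gradient_correctLoss (h : LipschitzSmooth q D C L) (θ : Param d) :
    gradient (correctLoss q D C) θ = finAvg C fun i => gradient (localLoss q (D i)) θ := by
  rw [gradient, (h.hasFDerivAt_correctLoss θ).fderiv, map_smul, map_sum]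
  rfl

lemma LipschitzSmooth.gradient_correctLoss_lipschitz (h : LipschitzSmooth q D C L)
    (hL : 0 ≤ L) (θ₁ θ₂ : Param d) :
    ‖gradient (correctLoss q D C) θ₁ - gradient (correctLoss q D C) θ₂‖ ≤ L * ‖θ₁ - θ₂‖ := by
  rw [h.gradient_correctLoss, h.gradient_correctLoss, ← finAvg_sub]
  refine (norm_finAvg_le _ _).trans ?_
  rcases C.eq_empty_or_nonempty with rfl | hC
  · simp; positivity
  · have hh0 : (0 : ℝ) < C.card := by exact_mod_cast hC.card_pos
    rw [one_div, inv_mul_le_iff₀ hh0]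
    refine (Finset.sum_le_sum fun i hi => (h i hi).2 θ₁ θ₂).trans (le_of_eq ?_)
    rw [Finset.sum_const, nsmul_eq_mul]

lemma continuous_of_norm_sub_le {g : Param d → Param d} {L : ℝ}
    (h : ∀ x y, ‖g x - g y‖ ≤ L * ‖x - y‖) : Continuous g := by
  have : LipschitzWith L.toNNReal g := LipschitzWith.of_dist_le_mul fun x y => by
    rw [dist_eq_norm, dist_eq_norm]
    refine (h x y).trans ?_
    gcongr
    exact Real.le_coe_toNNReal L
  exact this.continuous

/-- Averages of local gradients at different models. -/
lemma LipschitzSmooth.norm_finAvg_gradient_sub_sq_le (h : LipschitzSmooth q D C L)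
    (θ : Fin n → Param d) :
    ‖finAvg C (fun i => gradient (localLoss q (D i)) (θ i)) -
      gradient (correctLoss q D C) (finAvg C θ)‖ ^ 2 ≤ L ^ 2 * finSpread C θ := by
  rw [h.gradient_correctLoss, ← finAvg_sub]
  refine (norm_finAvg_sq_le _ _).trans ?_
  rw [finSpread, mul_left_comm, Finset.mul_sum _ _ (L ^ 2)]
  gcongr with i hi
  rw [← mul_pow]
  gcongr
  exact (h i hi).2 _ _

/-- Spread of local gradients at different models. -/
lemma finSpread_gradient_le (h : LipschitzSmooth q D C L)
    (hhet : BoundedHeterogeneity q D C ζ) (θ : Fin n → Param d) :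
    finSpread C (fun i => gradient (localLoss q (D i)) (θ i)) ≤
      2 * ζ ^ 2 + 2 * L ^ 2 * finSpread C θ := by
  -- Any centre bounds the spread. This one separates heterogeneity at a single point from the
  -- Lipschitz displacement of each node.
  refine (finSpread_le_of_center _ (gradient (correctLoss q D C) (finAvg C θ))).trans ?_
  have h1 : ∀ i ∈ C, ‖gradient (localLoss q (D i)) (θ i) -
      gradient (correctLoss q D C) (finAvg C θ)‖ ^ 2 ≤
      2 * ‖gradient (localLoss q (D i)) (finAvg C θ) -
        gradient (correctLoss q D C) (finAvg C θ)‖ ^ 2 +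
      2 * L ^ 2 * ‖θ i - finAvg C θ‖ ^ 2 := fun i hi => by
    have h2 := norm_add_sq_le_young one_pos (gradient (localLoss q (D i)) (finAvg C θ) -
        gradient (correctLoss q D C) (finAvg C θ))
      (gradient (localLoss q (D i)) (θ i) - gradient (localLoss q (D i)) (finAvg C θ))
    rw [add_comm (_ - _), sub_add_sub_cancel] at h2
    have h3 : ‖gradient (localLoss q (D i)) (θ i) - gradient (localLoss q (D i)) (finAvg C θ)‖ ^ 2
        ≤ (L * ‖θ i - finAvg C θ‖) ^ 2 := by gcongr; exact (h i hi).2 _ _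
    rw [mul_pow] at h3
    linarith
  calc _ ≤ (1 / (C.card : ℝ)) * ∑ i ∈ C, (2 * ‖gradient (localLoss q (D i)) (finAvg C θ) -
        gradient (correctLoss q D C) (finAvg C θ)‖ ^ 2 +
      2 * L ^ 2 * ‖θ i - finAvg C θ‖ ^ 2) := by gcongr with i hi; exact h1 i hi
    _ = 2 * ((1 / (C.card : ℝ)) * ∑ i ∈ C, ‖gradient (localLoss q (D i)) (finAvg C θ) -
        gradient (correctLoss q D C) (finAvg C θ)‖ ^ 2) + 2 * L ^ 2 * finSpread C θ := by
      rw [Finset.sum_add_distrib, ← Finset.mul_sum, ← Finset.mul_sum, finSpread]; ring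
    _ ≤ _ := by gcongr; exact hhet _

lemma finSpread_convex_comb_le {ι E : Type*} [NormedAddCommGroup E] [InnerProductSpace ℝ E]
    {b : ℝ} (h0 : 0 ≤ b) (h1 : b ≤ 1) (C : Finset ι) (z w : ι → E) :
    finSpread C (fun i => b • z i + (1 - b) • w i) ≤
      b * finSpread C z + (1 - b) * finSpread C w := by
  unfold finSpread
  rw [finAvg_add, finAvg_smul, finAvg_smul, mul_left_comm b, mul_left_comm (1 - b), ← mul_add,
    Finset.mul_sum _ _ b, Finset.mul_sum _ _ (1 - b), ← Finset.sum_add_distrib]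
  gcongr with i
  rw [add_sub_add_comm, ← smul_sub, ← smul_sub]
  exact norm_convex_comb_sq_le h0 h1 _ _

lemma memLp_lipschitz_comp {Ω : Type*} [MeasurableSpace Ω] {P : Measure Ω} [IsFiniteMeasure P]
    {g : Param d → Param d} (hg : ∀ x y, ‖g x - g y‖ ≤ L * ‖x - y‖) {Y : Ω → Param d} (hY : MemLp Y 2 P) : MemLp (fun ω => g (Y ω)) 2 P := by
  have h1 : MemLp (fun ω => g (Y ω) - g 0) 2 P := by
    refine hY.of_le_mul (c := L) (((continuous_of_norm_sub_le hg).comp_aestronglyMeasurable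
      hY.1).sub aestronglyMeasurable_const) (Eventually.of_forall fun ω => ?_)
    simpa using hg (Y ω) 0
  convert h1.add (memLp_const (g 0)) using 1
  funext ω
  simp

end Loss

/-! ### Independence, integrability and noise along a run -/

section Run

variable {n d f T : ℕ} {X Ω : Type*} [MeasurableSpace X] [MeasurableSpace Ω]
  {P : Measure Ω} {q : Param d → X → ℝ} {D : Fin n → Measure X} {C : Finset (Fin n)}
  {L σ ζ γ β : ℝ} {θ₀ : Param d} {t : ℕ} {i j : Fin n}

/-- Deviation of a stochastic gradient from its expectation. -/
noncomputable def gradientNoise (q : Param d → X → ℝ) (μ : Measure X) (θ : Param d) (x : X) :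
    Param d :=
  pointGradient q θ x - gradient (localLoss q μ) θ

lemma measurable_gradientNoise (hq : IsPointwiseLoss q D C) (hsmooth : LipschitzSmooth q D C L)
    (hi : i ∈ C) : Measurable (Function.uncurry (gradientNoise q (D i))) :=
  (measurable_pointGradient hq.measurable hq.differentiable).sub
    ((continuous_of_norm_sub_le (hsmooth i hi).2).measurable.comp measurable_fst)

lemma measurable_uncurry_comp {S U V W : Type*} [MeasurableSpace S] [MeasurableSpace U]
    [MeasurableSpace V] [MeasurableSpace W] {H : U → V → W}
    (hH : Measurable (Function.uncurry H)) {Y : S → U} {Z : S → V} (hY : Measurable Y)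
    (hZ : Measurable Z) : Measurable fun a => H (Y a) (Z a) :=
  hH.comp (hY.prodMk hZ)

namespace MonnaExecution

variable (run : MonnaExecution P q D C f 1 T γ β θ₀)

lemma measurable_sample (ht : t < T) (hi : i ∈ C) : Measurable (run.sample t i) :=
  (run.sample_adapted t ht i hi).mono (run.history.le _) le_rfl

lemma measurable_model (ht : t ≤ T) (hi : i ∈ C) : Measurable (run.model t i) :=
  (run.model_adapted t ht i hi).mono (run.history.le _) le_rfl

lemma indepFun_sample {S : Type*} [MeasurableSpace S] {Z : Ω → S} (ht : t < T) (hi : i ∈ C)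
    (hZ : Measurable[run.history t] Z) : IndepFun Z (run.sample t i) P := by
  rw [IndepFun_iff_Indep]
  refine indep_of_indep_of_le_left (indep_of_indep_of_le_right
    (run.sample_indep_history t ht).symm ?_) hZ.comap_le
  exact le_iSup₂ (f := fun i (_ : i ∈ C) =>
    MeasurableSpace.comap (run.sample t i) inferInstance) i hi

lemma indepFun_sample_pair {S : Type*} [MeasurableSpace S] {Z : Ω → S} (ht : t < T) (hi : i ∈ C)
    (hj : j ∈ C) (hZ : Measurable[run.history t] Z) :
    IndepFun Z (fun ω => (run.sample t i ω, run.sample t j ω)) P := by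
  rw [IndepFun_iff_Indep]
  refine indep_of_indep_of_le_left (indep_of_indep_of_le_right
    (run.sample_indep_history t ht).symm ?_) hZ.comap_le
  have h : ∀ k ∈ C, MeasurableSpace.comap (run.sample t k) inferInstance ≤
      ⨆ k ∈ C, MeasurableSpace.comap (run.sample t k) inferInstance := fun k hk =>
    le_iSup₂ (f := fun i (_ : i ∈ C) =>
      MeasurableSpace.comap (run.sample t i) inferInstance) k hk
  refine Measurable.comap_le (Measurable.prodMk ?_ ?_)
  · exact (comap_measurable (run.sample t i)).mono (h i hi) le_rfl
  · exact (comap_measurable (run.sample t j)).mono (h j hj) le_rfl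

lemma indepFun_samples (ht : t < T) (hi : i ∈ C) (hj : j ∈ C) (hij : i ≠ j) :
    IndepFun (run.sample t i) (run.sample t j) P :=
  (run.sample_indep t ht).indepFun (i := ⟨i, hi⟩) (j := ⟨j, hj⟩) (by simpa using hij)

/-- Deviation of the stochastic gradient of node `i` in iteration `t` from the local gradient. -/
noncomputable def noise (t : ℕ) (i : Fin n) (ω : Ω) : Param d :=
  gradientNoise q (D i) (run.model t i ω) (run.sample t i ω)

lemma measurable_noise (hq : IsPointwiseLoss q D C) (hsmooth : LipschitzSmooth q D C L)
    (ht : t < T) (hi : i ∈ C) : Measurable (run.noise t i) :=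
  measurable_uncurry_comp (measurable_gradientNoise hq hsmooth hi)
    (run.measurable_model ht.le hi) (run.measurable_sample ht hi)

/-- Separates what is determined before the data are drawn from the innovation. -/
lemma momentum_succ_eq (ht : t < T) (hi : i ∈ C) (ω : Ω) :
    run.momentum (t + 1) i ω = (β • run.momentum t i ω +
      (1 - β) • gradient (localLoss q (D i)) (run.model t i ω)) + (1 - β) • run.noise t i ω := by
  rw [run.momentum_succ t ht i hi ω, noise, gradientNoise, smul_sub]
  abel

lemma momentum_adapted (hq : IsPointwiseLoss q D C) :
    ∀ t ≤ T, ∀ i ∈ C, Measurable[run.history t] (run.momentum t i) := by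
  intro t
  induction t with
  | zero =>
    intro _ i hi
    rw [show run.momentum 0 i = fun _ => 0 from funext (run.momentum_zero i hi)]
    exact measurable_const
  | succ t ih =>
    intro ht i hi
    have ht' : t < T := ht
    have hle : run.history t ≤ run.history (t + 1) := run.history.mono t.le_succ
    rw [show run.momentum (t + 1) i = fun ω => β • run.momentum t i ω +
      (1 - β) • pointGradient q (run.model t i ω) (run.sample t i ω) from
        funext (run.momentum_succ t ht' i hi)]
    have h1 := (ih ht'.le i hi).mono hle le_rfl
    have h2 := (run.model_adapted t ht'.le i hi).mono hle le_rfl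
    have h3 := (measurable_pointGradient hq.measurable hq.differentiable).comp
      (h2.prodMk (run.sample_adapted t ht' i hi))
    exact (h1.const_smul β).add (h3.const_smul (1 - β))

/-- The reduction property of one iteration. -/
lemma reduction (hn : 11 * f ≤ n) (hC : C.card = n - f) (hne : C.Nonempty) (ht : t < T) (ω : Ω) :
    finSpread C (fun i => run.model (t + 1) i ω) ≤ 9.88 * f / ((n : ℝ) - f) *
        finSpread C (fun i => run.model t i ω - γ • run.momentum (t + 1) i ω) ∧
      ‖finAvg C (fun i => run.model (t + 1) i ω) -
        finAvg C (fun i => run.model t i ω - γ • run.momentum (t + 1) i ω)‖ ^ 2 ≤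
      9 * f / ((n : ℝ) - f) *
        finSpread C (fun i => run.model t i ω - γ • run.momentum (t + 1) i ω) := by
  have h := IsNNA.reduction (z := fun j => run.vec t 0 j ω) (y := fun j => run.vec t 1 j ω)
    (R := fun i => run.received t 0 i ω) hn hC hne
    (fun i hi => run.received_spec t ht 0 one_pos i hi ω)
    (fun i hi => run.vec_succ t ht 0 one_pos i hi ω)
  rwa [finSpread_congr fun i hi => run.vec_zero t ht i hi ω,
    finAvg_congr fun i hi => run.vec_zero t ht i hi ω,
    finSpread_congr fun i hi => (run.model_succ t ht i hi ω).symm,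
    finAvg_congr fun i hi => (run.model_succ t ht i hi ω).symm] at h

variable [IsProbabilityMeasure P]

lemma lintegral_noise_sq_le (hq : IsPointwiseLoss q D C) (hsmooth : LipschitzSmooth q D C L)
    (hvar : BoundedVariance q D C σ) (ht : t < T) (hi : i ∈ C) :
    ∫⁻ ω, ‖run.noise t i ω‖ₑ ^ 2 ∂P ≤ ENNReal.ofReal (σ ^ 2) := by
  refine lintegral_indep_sq_le (run.measurable_model ht.le hi) (run.measurable_sample ht hi)
    (run.indepFun_sample ht hi (run.model_adapted t ht.le i hi))
    (measurable_gradientNoise hq hsmooth hi) fun θ => ?_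
  rw [run.sample_law t ht i hi]
  exact hvar i hi θ

lemma memLp_noise (hq : IsPointwiseLoss q D C) (hsmooth : LipschitzSmooth q D C L)
    (hvar : BoundedVariance q D C σ) (ht : t < T) (hi : i ∈ C) : MemLp (run.noise t i) 2 P :=
  memLp_two_of_lintegral_lt_top (run.measurable_noise hq hsmooth ht hi).aestronglyMeasurable
    ((run.lintegral_noise_sq_le hq hsmooth hvar ht hi).trans_lt ENNReal.ofReal_lt_top)

lemma integral_noise_sq_le (hq : IsPointwiseLoss q D C) (hsmooth : LipschitzSmooth q D C L)
    (hvar : BoundedVariance q D C σ) (ht : t < T) (hi : i ∈ C) :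
    ∫ ω, ‖run.noise t i ω‖ ^ 2 ∂P ≤ σ ^ 2 := by
  rw [integral_eq_lintegral_of_nonneg_ae (Eventually.of_forall fun ω => by positivity)
    (run.memLp_noise hq hsmooth hvar ht hi).integrable_norm_sq.1]
  refine ENNReal.toReal_le_of_le_ofReal (by positivity) ?_
  refine le_trans (le_of_eq ?_) (run.lintegral_noise_sq_le hq hsmooth hvar ht hi)
  refine lintegral_congr fun ω => ?_
  rw [ENNReal.ofReal_pow (norm_nonneg _), ofReal_norm]

/-- No moment of the faulty vectors is available. The reduction property bounds the new models by
the partial models of correct nodes alone, and square integrability propagates by induction. -/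
lemma memLp_model_momentum (hn : 11 * f ≤ n) (hC : C.card = n - f)
    (hq : IsPointwiseLoss q D C) (hsmooth : LipschitzSmooth q D C L)
    (hvar : BoundedVariance q D C σ) :
    ∀ t ≤ T, ∀ i ∈ C, MemLp (run.model t i) 2 P ∧ MemLp (run.momentum t i) 2 P := by
  intro t
  induction t with
  | zero =>
    intro _ i hi
    rw [show run.momentum 0 i = fun _ => 0 from funext (run.momentum_zero i hi),
      show run.model 0 i = fun _ => θ₀ from funext (run.model_zero i hi)]
    exact ⟨memLp_const _, memLp_const _⟩
  | succ t ih =>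
    intro ht i hi
    have ht' : t < T := ht
    have hmom : ∀ i ∈ C, MemLp (run.momentum (t + 1) i) 2 P := fun i hi => by
      rw [show run.momentum (t + 1) i = fun ω => _ from
        funext fun ω => run.momentum_succ_eq ht' hi ω]
      exact ((((ih ht'.le i hi).2).const_smul β).add
        ((memLp_lipschitz_comp (hsmooth i hi).2 (ih ht'.le i hi).1).const_smul (1 - β))).add
        ((run.memLp_noise hq hsmooth hvar ht' hi).const_smul (1 - β))
    refine ⟨?_, hmom i hi⟩
    have hhalf : ∀ i ∈ C, MemLp (fun ω => run.model t i ω - γ • run.momentum (t + 1) i ω) 2 P :=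
      fun i hi => (ih ht'.le i hi).1.sub ((hmom i hi).const_smul γ)
    have hne : C.Nonempty := ⟨i, hi⟩
    have hmeas := (run.measurable_model ht hi).aestronglyMeasurable (μ := P)
    rw [memLp_two_iff_integrable_sq_norm hmeas]
    refine Integrable.mono' (g := fun ω => 3 * (‖finAvg C (fun i => run.model t i ω -
        γ • run.momentum (t + 1) i ω)‖ ^ 2 + (9 * f / ((n : ℝ) - f) +
        C.card * (9.88 * f / ((n : ℝ) - f))) * finSpread C (fun i => run.model t i ω -
        γ • run.momentum (t + 1) i ω))) (((memLp_finAvg hhalf).integrable_norm_sq.add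
        ((integrable_finSpread hhalf).const_mul _)).const_mul _) (hmeas.norm.pow 2)
        (Eventually.of_forall fun ω => ?_)
    rw [Real.norm_of_nonneg (by positivity)]
    obtain ⟨h1, h2⟩ := run.reduction hn hC hne ht' ω
    have h3 := norm_sub_finAvg_sq_le (fun i => run.model (t + 1) i ω) hi
    have h4 := (mul_le_mul_of_nonneg_left h1 (Nat.cast_nonneg (α := ℝ) C.card))
    set u := run.model (t + 1) i ω
    set v := finAvg C fun i => run.model (t + 1) i ω
    set w := finAvg C fun i => run.model t i ω - γ • run.momentum (t + 1) i ω
    have h5 : ‖u‖ ≤ ‖w‖ + ‖v - w‖ + ‖u - v‖ := by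
      calc ‖u‖ = ‖w + (v - w) + (u - v)‖ := by congr 1; abel
        _ ≤ _ := norm_add₃_le
    have h6 : ‖u‖ ^ 2 ≤ (‖w‖ + ‖v - w‖ + ‖u - v‖) ^ 2 := by gcongr
    have h7 : (‖w‖ + ‖v - w‖ + ‖u - v‖) ^ 2 ≤ 3 * (‖w‖ ^ 2 + ‖v - w‖ ^ 2 + ‖u - v‖ ^ 2) := by
      linarith [sq_nonneg (‖w‖ - ‖v - w‖), sq_nonneg (‖w‖ - ‖u - v‖),
        sq_nonneg (‖v - w‖ - ‖u - v‖)]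
    linarith

variable [∀ i, IsProbabilityMeasure (D i)]

lemma integrable_gradientNoise (hq : IsPointwiseLoss q D C) (hvar : BoundedVariance q D C σ)
    (hi : i ∈ C) (θ : Param d) : Integrable (gradientNoise q (D i) θ) (D i) :=
  ((memLp_pointGradient hq.measurable hq.differentiable (hvar i hi) θ).integrable
    (by norm_num)).sub (integrable_const _)

lemma integral_gradientNoise (hq : IsPointwiseLoss q D C) (hsmooth : LipschitzSmooth q D C L)
    (hvar : BoundedVariance q D C σ) (hi : i ∈ C) (θ : Param d) :
    ∫ x, gradientNoise q (D i) θ x ∂(D i) = 0 := by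
  unfold gradientNoise
  rw [integral_sub ((memLp_pointGradient hq.measurable hq.differentiable (hvar i hi) θ).integrable
    (by norm_num)) (integrable_const _), integral_pointGradient hq.measurable hq.differentiable
    (hq.integrable i hi) (hsmooth i hi).1 (hsmooth i hi).2 (hvar i hi)]
  simp

lemma integral_inner_noise_eq_zero (hq : IsPointwiseLoss q D C)
    (hsmooth : LipschitzSmooth q D C L) (hvar : BoundedVariance q D C σ) (ht : t < T)
    (hi : i ∈ C) {Y : Ω → Param d} (hY : Measurable[run.history t] Y) :
    ∫ ω, (inner ℝ (Y ω) (run.noise t i ω) : ℝ) ∂P = 0 := by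
  have hZ : Measurable[run.history t] (fun ω => (Y ω, run.model t i ω)) :=
    hY.prodMk (run.model_adapted t ht.le i hi)
  refine integral_inner_indep_eq_zero (hY.mono (run.history.le _) le_rfl)
    (run.measurable_model ht.le hi) (run.measurable_sample ht hi)
    (run.indepFun_sample ht hi hZ) (measurable_gradientNoise hq hsmooth hi)
    (fun θ => ?_) fun θ => ?_
  · rw [run.sample_law t ht i hi]; exact integrable_gradientNoise hq hvar hi θ
  · rw [run.sample_law t ht i hi]; exact integral_gradientNoise hq hsmooth hvar hi θ

lemma integral_inner_noise_noise_eq_zero (hq : IsPointwiseLoss q D C)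
    (hsmooth : LipschitzSmooth q D C L) (hvar : BoundedVariance q D C σ) (ht : t < T)
    (hi : i ∈ C) (hj : j ∈ C) (hij : i ≠ j) :
    ∫ ω, (inner ℝ (run.noise t i ω) (run.noise t j ω) : ℝ) ∂P = 0 := by
  -- With both models in the frozen state, the two noises become functions of two independent data
  -- points.
  have hZ : Measurable[run.history t] (fun ω => (run.model t i ω, run.model t j ω)) :=
    (run.model_adapted t ht.le i hi).prodMk (run.model_adapted t ht.le j hj)
  have h1 : Measurable (Function.uncurry fun (p : Param d × Param d) (x : X) =>
      gradientNoise q (D i) p.1 x) :=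
    measurable_uncurry_comp (measurable_gradientNoise hq hsmooth hi)
      (measurable_fst.comp measurable_fst) measurable_snd
  have h2 : Measurable (Function.uncurry fun (p : Param d × Param d) (x : X) =>
      gradientNoise q (D j) p.2 x) :=
    measurable_uncurry_comp (measurable_gradientNoise hq hsmooth hj)
      (measurable_snd.comp measurable_fst) measurable_snd
  refine integral_inner_indep_pair_eq_zero (hZ.mono (run.history.le _) le_rfl)
    (run.measurable_sample ht hi) (run.measurable_sample ht hj)
    (run.indepFun_samples ht hi hj hij) (run.indepFun_sample_pair ht hi hj hZ) h1 h2
    (fun θ => ?_) fun θ => ?_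
  · rw [run.sample_law t ht j hj]; exact integrable_gradientNoise hq hvar hj θ.2
  · rw [run.sample_law t ht j hj]; exact integral_gradientNoise hq hsmooth hvar hj θ.2

end MonnaExecution

end Run

/-! ### One-step inequalities for the expected quantities -/

section Run

variable {n d f T : ℕ} {X Ω : Type*} [MeasurableSpace X] [MeasurableSpace Ω]
  {P : Measure Ω} {q : Param d → X → ℝ} {D : Fin n → Measure X} {C : Finset (Fin n)}
  {L σ ζ γ β s : ℝ} {θ₀ : Param d} {t : ℕ} {i j : Fin n}

lemma measurable_finAvg {S : Type*} [MeasurableSpace S] {z : Fin n → S → Param d}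
    (hz : ∀ i ∈ C, Measurable (z i)) : Measurable fun ω => finAvg C fun i => z i ω := by
  unfold finAvg
  exact (Finset.measurable_fun_sum C hz).const_smul (1 / (C.card : ℝ))

namespace MonnaExecution

variable (run : MonnaExecution P q D C f 1 T γ β θ₀)

/-- Average of the models of the correct nodes. -/
noncomputable def avgModel (t : ℕ) (ω : Ω) : Param d := finAvg C fun i => run.model t i ω

/-- Average of the partial models (after the local phase) of the correct nodes. -/
noncomputable def avgHalf (t : ℕ) (ω : Ω) : Param d :=
  finAvg C fun i => run.model t i ω - γ • run.momentum (t + 1) i ω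

/-- Average of the momentums of the correct nodes at the start of an iteration. -/
noncomputable def avgMomentum (t : ℕ) (ω : Ω) : Param d := finAvg C fun i => run.momentum t i ω

/-- Expected spread of the models. -/
noncomputable def modelSpread (t : ℕ) : ℝ := ∫ ω, finSpread C (fun i => run.model t i ω) ∂P

/-- Expected spread of the partial models. -/
noncomputable def halfSpread (t : ℕ) : ℝ :=
  ∫ ω, finSpread C (fun i => run.model t i ω - γ • run.momentum (t + 1) i ω) ∂P

/-- Expected spread of the momentums. -/
noncomputable def momentumSpread (t : ℕ) : ℝ := ∫ ω, finSpread C (fun i => run.momentum t i ω) ∂P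

/-- Expected squared gradient of the loss at the average model. -/
noncomputable def gradientSq (t : ℕ) : ℝ :=
  ∫ ω, ‖gradient (correctLoss q D C) (run.avgModel t ω)‖ ^ 2 ∂P

/-- Expected squared deviation of the average momentum at the start of iteration `t`. -/
noncomputable def deviationSq (t : ℕ) : ℝ :=
  ∫ ω, ‖run.avgMomentum t ω - gradient (correctLoss q D C) (run.avgModel t ω)‖ ^ 2 ∂P

/-- Expected squared deviation of the average momentum computed in iteration `t`. -/
noncomputable def newDeviationSq (t : ℕ) : ℝ :=
  ∫ ω, ‖run.avgMomentum (t + 1) ω - gradient (correctLoss q D C) (run.avgModel t ω)‖ ^ 2 ∂P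

/-- Expected squared move of the average model in iteration `t`. -/
noncomputable def moveSq (t : ℕ) : ℝ :=
  ∫ ω, ‖run.avgModel (t + 1) ω - run.avgModel t ω‖ ^ 2 ∂P

/-- The loss decreases along the average model up to the deviation of the momentum and the drift
caused by the coordination phase. -/
lemma correctLoss_avgModel_succ_le (hγ : 0 < γ) (hL : 0 ≤ L) (hsmooth : LipschitzSmooth q D C L)
    (t : ℕ) (ω : Ω) :
    correctLoss q D C (run.avgModel (t + 1) ω) ≤ correctLoss q D C (run.avgModel t ω)
      - γ / 2 * ‖gradient (correctLoss q D C) (run.avgModel t ω)‖ ^ 2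
      - (1 / (2 * γ) - L / 2) * ‖run.avgModel (t + 1) ω - run.avgModel t ω‖ ^ 2
      + 3 * γ / 4 *
        ‖run.avgMomentum (t + 1) ω - gradient (correctLoss q D C) (run.avgModel t ω)‖ ^ 2
      + 3 / (2 * γ) * ‖run.avgModel (t + 1) ω - run.avgHalf t ω‖ ^ 2 := by
  have h1 := le_add_inner_gradient_add_sq hsmooth.differentiable_correctLoss
    (hsmooth.gradient_correctLoss_lipschitz hL) (run.avgModel t ω)
    (run.avgModel (t + 1) ω - run.avgModel t ω)
  rw [add_sub_cancel] at h1
  have h2 : run.avgHalf t ω = run.avgModel t ω - γ • run.avgMomentum (t + 1) ω := by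
    rw [avgHalf, finAvg_sub, finAvg_smul]; rfl
  rw [h2]
  set g := gradient (correctLoss q D C) (run.avgModel t ω)
  set x := run.avgModel t ω
  set y := run.avgModel (t + 1) ω
  set m := run.avgMomentum (t + 1) ω
  -- Polarization turns the inner product with the move into squared norms. Then γg + (y - x) is
  -- split into momentum deviation and drift by Young's inequality with weight 1/2, whence the
  -- factors 3/2 and 3.
  have h3 := norm_add_sq_real (γ • g) (y - x)
  rw [norm_smul, mul_pow, Real.norm_of_nonneg hγ.le, inner_smul_left] at h3
  have h4 := norm_add_sq_le_young (s := 1 / 2) (by norm_num) (-(γ • (m - g)))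
    (y - (x - γ • m))
  have h5 : -(γ • (m - g)) + (y - (x - γ • m)) = γ • g + (y - x) := by
    rw [smul_sub]; abel
  rw [h5, norm_neg, norm_smul, mul_pow, Real.norm_of_nonneg hγ.le, h3] at h4
  norm_num at h4
  have h6 : (1 / (2 * γ)) * (γ ^ 2 * ‖g‖ ^ 2 + 2 * (γ * inner ℝ g (y - x)) + ‖y - x‖ ^ 2) ≤
      (1 / (2 * γ)) * (3 / 2 * (γ ^ 2 * ‖m - g‖ ^ 2) + 3 * ‖y - (x - γ • m)‖ ^ 2) := by
    gcongr
  have h7 : (1 / (2 * γ)) * (γ ^ 2 * ‖g‖ ^ 2 + 2 * (γ * inner ℝ g (y - x)) + ‖y - x‖ ^ 2) =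
      γ / 2 * ‖g‖ ^ 2 + inner ℝ g (y - x) + 1 / (2 * γ) * ‖y - x‖ ^ 2 := by
    field_simp
  have h8 : (1 / (2 * γ)) * (3 / 2 * (γ ^ 2 * ‖m - g‖ ^ 2) + 3 * ‖y - (x - γ • m)‖ ^ 2) =
      3 * γ / 4 * ‖m - g‖ ^ 2 + 3 / (2 * γ) * ‖y - (x - γ • m)‖ ^ 2 := by
    field_simp; ring
  linarith

lemma avgModel_zero (hne : C.Nonempty) (ω : Ω) : run.avgModel 0 ω = θ₀ := by
  rw [avgModel, finAvg_congr fun i hi => run.model_zero i hi ω, finAvg_const hne]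

lemma modelSpread_zero (hne : C.Nonempty) : run.modelSpread 0 = 0 := by
  have h : ∀ ω, finSpread C (fun i => run.model 0 i ω) = 0 := fun ω => by
    rw [finSpread_congr fun i hi => run.model_zero i hi ω, finSpread_const hne]
  simp [modelSpread, h]

lemma momentumSpread_zero (hne : C.Nonempty) : run.momentumSpread 0 = 0 := by
  have h : ∀ ω, finSpread C (fun i => run.momentum 0 i ω) = 0 := fun ω => by
    rw [finSpread_congr fun i hi => run.momentum_zero i hi ω, finSpread_const hne]
  simp [momentumSpread, h]

variable [IsProbabilityMeasure P]

lemma deviationSq_zero (hne : C.Nonempty) :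
    run.deviationSq 0 = ‖gradient (correctLoss q D C) θ₀‖ ^ 2 := by
  have h : ∀ ω, run.avgMomentum 0 ω = 0 := fun ω => by
    rw [avgMomentum, finAvg_congr fun i hi => run.momentum_zero i hi ω, finAvg_const hne]
  simp [deviationSq, h, run.avgModel_zero hne]

section Bounds

variable (hn : 11 * f ≤ n) (hC : C.card = n - f) (hq : IsPointwiseLoss q D C)
  (hsmooth : LipschitzSmooth q D C L) (hvar : BoundedVariance q D C σ)

include hn hC hq hsmooth hvar

lemma memLp_model (ht : t ≤ T) (hi : i ∈ C) : MemLp (run.model t i) 2 P :=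
  (run.memLp_model_momentum hn hC hq hsmooth hvar t ht i hi).1

lemma memLp_momentum (ht : t ≤ T) (hi : i ∈ C) : MemLp (run.momentum t i) 2 P :=
  (run.memLp_model_momentum hn hC hq hsmooth hvar t ht i hi).2

lemma memLp_half (ht : t < T) (hi : i ∈ C) :
    MemLp (fun ω => run.model t i ω - γ • run.momentum (t + 1) i ω) 2 P :=
  (run.memLp_model hn hC hq hsmooth hvar ht.le hi).sub
    ((run.memLp_momentum hn hC hq hsmooth hvar ht hi).const_smul γ)

lemma memLp_avgModel (ht : t ≤ T) : MemLp (run.avgModel t) 2 P :=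
  memLp_finAvg fun _ hi => run.memLp_model hn hC hq hsmooth hvar ht hi

lemma memLp_avgMomentum (ht : t ≤ T) : MemLp (run.avgMomentum t) 2 P :=
  memLp_finAvg fun _ hi => run.memLp_momentum hn hC hq hsmooth hvar ht hi

lemma memLp_avgHalf (ht : t < T) : MemLp (run.avgHalf t) 2 P :=
  memLp_finAvg fun _ hi => run.memLp_half hn hC hq hsmooth hvar ht hi

lemma memLp_gradient_avgModel (hL : 0 ≤ L) (ht : t ≤ T) :
    MemLp (fun ω => gradient (correctLoss q D C) (run.avgModel t ω)) 2 P :=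
  memLp_lipschitz_comp (hsmooth.gradient_correctLoss_lipschitz hL)
    (run.memLp_avgModel hn hC hq hsmooth hvar ht)

lemma modelSpread_succ_le (hne : C.Nonempty) (ht : t < T) :
    run.modelSpread (t + 1) ≤ 9.88 * f / ((n : ℝ) - f) * run.halfSpread t := by
  rw [modelSpread, halfSpread, ← integral_const_mul]
  exact integral_mono
    (integrable_finSpread fun i hi => run.memLp_model hn hC hq hsmooth hvar ht hi)
    ((integrable_finSpread fun i hi => run.memLp_half hn hC hq hsmooth hvar ht hi).const_mul _)
    fun ω => (run.reduction hn hC hne ht ω).1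

lemma integral_drift_sq_le (hne : C.Nonempty) (ht : t < T) :
    ∫ ω, ‖run.avgModel (t + 1) ω - run.avgHalf t ω‖ ^ 2 ∂P ≤
      9 * f / ((n : ℝ) - f) * run.halfSpread t := by
  rw [halfSpread, ← integral_const_mul]
  exact integral_mono
    ((run.memLp_avgModel hn hC hq hsmooth hvar ht).sub
      (run.memLp_avgHalf hn hC hq hsmooth hvar ht)).integrable_norm_sq
    ((integrable_finSpread fun i hi => run.memLp_half hn hC hq hsmooth hvar ht hi).const_mul _)
    fun ω => (run.reduction hn hC hne ht ω).2

lemma halfSpread_le (hs : 0 < s) (ht : t < T) :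
    run.halfSpread t ≤ (1 + s) * run.modelSpread t +
      (1 + 1 / s) * (γ ^ 2 * run.momentumSpread (t + 1)) := by
  have h1 := integrable_finSpread fun i hi => run.memLp_model hn hC hq hsmooth hvar ht.le hi
  have h2 := integrable_finSpread fun i hi => run.memLp_momentum hn hC hq hsmooth hvar ht hi
  rw [modelSpread, momentumSpread, halfSpread, ← integral_const_mul, ← integral_const_mul,
    ← integral_const_mul, ← integral_add (h1.const_mul _) ((h2.const_mul _).const_mul _)]
  refine integral_mono
    (integrable_finSpread fun i hi => run.memLp_half hn hC hq hsmooth hvar ht hi)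
    ((h1.const_mul _).add ((h2.const_mul _).const_mul _)) fun ω => ?_
  have h3 := finSpread_add_le hs C (fun i => run.model t i ω)
    (fun i => -γ • run.momentum (t + 1) i ω)
  rw [finSpread_smul, neg_sq] at h3
  simpa only [neg_smul, ← sub_eq_add_neg] using h3

lemma deviationSq_succ_le (hL : 0 ≤ L) (hs : 0 < s) (ht : t < T) :
    run.deviationSq (t + 1) ≤ (1 + s) * run.newDeviationSq t +
      (1 + 1 / s) * (L ^ 2 * run.moveSq t) := by
  have hQ := run.memLp_gradient_avgModel hn hC hq hsmooth hvar hL ht.le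
  have hQ' := run.memLp_gradient_avgModel hn hC hq hsmooth hvar hL (t := t + 1) ht
  have hm := run.memLp_avgMomentum hn hC hq hsmooth hvar (t := t + 1) ht
  have h1 := (hm.sub hQ).integrable_norm_sq
  have h2 := ((run.memLp_avgModel hn hC hq hsmooth hvar (t := t + 1) ht).sub
    (run.memLp_avgModel hn hC hq hsmooth hvar ht.le)).integrable_norm_sq
  rw [deviationSq, newDeviationSq, moveSq, ← integral_const_mul, ← integral_const_mul,
    ← integral_const_mul]
  refine le_trans (integral_mono (hm.sub hQ').integrable_norm_sq
    ((h1.const_mul (1 + s)).add ((h2.const_mul (L ^ 2)).const_mul (1 + 1 / s))) fun ω => ?_)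
    (le_of_eq (integral_add (h1.const_mul (1 + s)) ((h2.const_mul (L ^ 2)).const_mul (1 + 1 / s))))
  have h3 := norm_add_sq_le_young hs
    (run.avgMomentum (t + 1) ω - gradient (correctLoss q D C) (run.avgModel t ω))
    (gradient (correctLoss q D C) (run.avgModel t ω) -
      gradient (correctLoss q D C) (run.avgModel (t + 1) ω))
  rw [sub_add_sub_cancel] at h3
  refine h3.trans ?_
  have h4 := hsmooth.gradient_correctLoss_lipschitz hL (run.avgModel t ω) (run.avgModel (t + 1) ω)
  rw [norm_sub_rev (run.avgModel t ω)] at h4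
  have h5 := pow_le_pow_left₀ (norm_nonneg _) h4 2
  rw [mul_pow] at h5
  simp only [Pi.add_apply, Pi.sub_apply]
  gcongr

/-- The descent inequality is telescoped pathwise and the final loss replaced by its lower bound
before expectations are taken, so integrability of the loss along the run is not needed. -/
lemma sum_gradientSq_le (hne : C.Nonempty) (hγ : 0 < γ) (hL : 0 ≤ L) {b : ℝ}
    (hb : ∀ θ, b ≤ correctLoss q D C θ) :
    b - correctLoss q D C θ₀ ≤ ∑ t ∈ Finset.range T, (- (γ / 2) * run.gradientSq t
      - (1 / (2 * γ) - L / 2) * run.moveSq t + 3 * γ / 4 * run.newDeviationSq t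
      + 3 / (2 * γ) * (9 * f / ((n : ℝ) - f) * run.halfSpread t)) := by
  have hpt : ∀ t < T, Integrable (fun ω =>
      - (γ / 2) * ‖gradient (correctLoss q D C) (run.avgModel t ω)‖ ^ 2
      - (1 / (2 * γ) - L / 2) * ‖run.avgModel (t + 1) ω - run.avgModel t ω‖ ^ 2
      + 3 * γ / 4 *
        ‖run.avgMomentum (t + 1) ω - gradient (correctLoss q D C) (run.avgModel t ω)‖ ^ 2
      + 3 / (2 * γ) * ‖run.avgModel (t + 1) ω - run.avgHalf t ω‖ ^ 2) P ∧
      ∫ ω, (- (γ / 2) * ‖gradient (correctLoss q D C) (run.avgModel t ω)‖ ^ 2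
      - (1 / (2 * γ) - L / 2) * ‖run.avgModel (t + 1) ω - run.avgModel t ω‖ ^ 2
      + 3 * γ / 4 *
        ‖run.avgMomentum (t + 1) ω - gradient (correctLoss q D C) (run.avgModel t ω)‖ ^ 2
      + 3 / (2 * γ) * ‖run.avgModel (t + 1) ω - run.avgHalf t ω‖ ^ 2) ∂P ≤
      - (γ / 2) * run.gradientSq t
      - (1 / (2 * γ) - L / 2) * run.moveSq t + 3 * γ / 4 * run.newDeviationSq t
      + 3 / (2 * γ) * (9 * f / ((n : ℝ) - f) * run.halfSpread t) := by
    intro t ht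
    have hQ := run.memLp_gradient_avgModel hn hC hq hsmooth hvar hL ht.le
    have hm := run.memLp_avgMomentum hn hC hq hsmooth hvar (t := t + 1) ht
    have hθ := run.memLp_avgModel hn hC hq hsmooth hvar (t := t + 1) ht
    have i1 := hQ.integrable_norm_sq.const_mul (- (γ / 2))
    have i2 := (hθ.sub (run.memLp_avgModel hn hC hq hsmooth hvar ht.le)).integrable_norm_sq.const_mul
      (1 / (2 * γ) - L / 2)
    have i3 := (hm.sub hQ).integrable_norm_sq.const_mul (3 * γ / 4)
    have i4 := (hθ.sub (run.memLp_avgHalf hn hC hq hsmooth hvar ht)).integrable_norm_sq.const_mul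
      (3 / (2 * γ))
    refine ⟨((i1.sub i2).add i3).add i4, ?_⟩
    refine le_trans (le_of_eq ((integral_add ((i1.sub i2).add i3) i4).trans
      (congrArg (· + _) ((integral_add (i1.sub i2) i3).trans
        (congrArg (· + _) (integral_sub i1 i2)))))) ?_
    rw [integral_const_mul, integral_const_mul, integral_const_mul, integral_const_mul]
    have := run.integral_drift_sq_le hn hC hq hsmooth hvar hne ht
    exact add_le_add le_rfl (mul_le_mul_of_nonneg_left this (by positivity))
  have htel : ∀ ω, b - correctLoss q D C θ₀ ≤ ∑ t ∈ Finset.range T,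
      (- (γ / 2) * ‖gradient (correctLoss q D C) (run.avgModel t ω)‖ ^ 2
      - (1 / (2 * γ) - L / 2) * ‖run.avgModel (t + 1) ω - run.avgModel t ω‖ ^ 2
      + 3 * γ / 4 *
        ‖run.avgMomentum (t + 1) ω - gradient (correctLoss q D C) (run.avgModel t ω)‖ ^ 2
      + 3 / (2 * γ) * ‖run.avgModel (t + 1) ω - run.avgHalf t ω‖ ^ 2) := fun ω => by
    have h1 := Finset.sum_range_sub (fun t => correctLoss q D C (run.avgModel t ω)) T
    rw [run.avgModel_zero hne] at h1
    have h2 := hb (run.avgModel T ω)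
    refine le_trans (by linarith : _ ≤ ∑ t ∈ Finset.range T,
      (correctLoss q D C (run.avgModel (t + 1) ω) - correctLoss q D C (run.avgModel t ω)))
      (Finset.sum_le_sum fun t _ => ?_)
    have h3 := run.correctLoss_avgModel_succ_le hγ hL hsmooth t ω
    linarith
  have hint := integrable_finsetSum (Finset.range T) fun t ht => (hpt t (Finset.mem_range.1 ht)).1
  have h1 := integral_mono (integrable_const (b - correctLoss q D C θ₀)) hint htel
  rw [integral_finsetSum _ fun t ht => (hpt t (Finset.mem_range.1 ht)).1] at h1
  simp only [integral_const, probReal_univ, smul_eq_mul, one_mul] at h1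
  exact h1.trans (Finset.sum_le_sum fun t ht => (hpt t (Finset.mem_range.1 ht)).2)

/-- The deviation of a single node is only controlled by the sum over all correct nodes, whence the
factor |C|. -/
lemma integral_gradient_model_sq_le (hL : 0 ≤ L) (ht : t < T) (hi : i ∈ C) :
    ∫ ω, ‖gradient (correctLoss q D C) (run.model t i ω)‖ ^ 2 ∂P ≤
      2 * run.gradientSq t + 2 * L ^ 2 * (C.card * run.modelSpread t) := by
  have hQ := (run.memLp_gradient_avgModel hn hC hq hsmooth hvar hL ht.le).integrable_norm_sq
  have hS := integrable_finSpread fun i hi => run.memLp_model hn hC hq hsmooth hvar ht.le hi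
  have hi' := memLp_lipschitz_comp (hsmooth.gradient_correctLoss_lipschitz hL)
    (run.memLp_model hn hC hq hsmooth hvar ht.le hi)
  rw [gradientSq, modelSpread, ← integral_const_mul, ← integral_const_mul, ← integral_const_mul,
    ← integral_add (hQ.const_mul _) ((hS.const_mul _).const_mul _)]
  refine integral_mono hi'.integrable_norm_sq
    ((hQ.const_mul _).add ((hS.const_mul _).const_mul _)) fun ω => ?_
  have h1 := norm_add_sq_le_young one_pos (gradient (correctLoss q D C) (run.avgModel t ω))
    (gradient (correctLoss q D C) (run.model t i ω) -
      gradient (correctLoss q D C) (run.avgModel t ω))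
  rw [add_sub_cancel] at h1
  have h2 := pow_le_pow_left₀ (norm_nonneg _)
    (hsmooth.gradient_correctLoss_lipschitz hL (run.model t i ω) (run.avgModel t ω)) 2
  rw [mul_pow] at h2
  have h3 := mul_le_mul_of_nonneg_left
    (norm_sub_finAvg_sq_le (fun i => run.model t i ω) hi) (sq_nonneg L)
  simp only [avgModel] at *
  linarith

variable [∀ i, IsProbabilityMeasure (D i)]

/-- The innovation is orthogonal to the part known beforehand, so it adds its second moment, with
factor (1 - β)²; convexity handles the rest. -/
lemma momentumSpread_succ_le (hne : C.Nonempty) (hhet : BoundedHeterogeneity q D C ζ)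
    (hβ0 : 0 ≤ β) (hβ1 : β ≤ 1) (ht : t < T) :
    run.momentumSpread (t + 1) ≤ β * run.momentumSpread t +
      (1 - β) * (2 * ζ ^ 2 + 2 * L ^ 2 * run.modelSpread t) + (1 - β) ^ 2 * σ ^ 2 := by
  have hm : ∀ i ∈ C, MemLp (run.momentum t i) 2 P := fun i hi =>
    run.memLp_momentum hn hC hq hsmooth hvar ht.le hi
  have hθ : ∀ i ∈ C, MemLp (run.model t i) 2 P := fun i hi =>
    run.memLp_model hn hC hq hsmooth hvar ht.le hi
  have hg : ∀ i ∈ C, MemLp (fun ω => gradient (localLoss q (D i)) (run.model t i ω)) 2 P :=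
    fun i hi => memLp_lipschitz_comp (hsmooth i hi).2 (hθ i hi)
  have hν : ∀ i ∈ C, MemLp (fun ω => (1 - β) • run.noise t i ω) 2 P :=
    fun i hi => (run.memLp_noise hq hsmooth hvar ht hi).const_smul (1 - β)
  have hz : ∀ i ∈ C, MemLp (fun ω => β • run.momentum t i ω +
      (1 - β) • gradient (localLoss q (D i)) (run.model t i ω)) 2 P := fun i hi =>
    ((hm i hi).const_smul β).add ((hg i hi).const_smul (1 - β))
  have hadapt : ∀ i ∈ C, Measurable[run.history t] (fun ω => β • run.momentum t i ω +
      (1 - β) • gradient (localLoss q (D i)) (run.model t i ω)) := fun i hi =>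
    ((run.momentum_adapted hq t ht.le i hi).const_smul β).add
      (((continuous_of_norm_sub_le (hsmooth i hi).2).measurable.comp
        (run.model_adapted t ht.le i hi)).const_smul (1 - β))
  have h1 := integral_finSpread_add_noise_le hne (s := (1 - β) ^ 2 * σ ^ 2) hz hν
    (fun i hi => by
      simp only [norm_smul, mul_pow, Real.norm_eq_abs, sq_abs]
      rw [integral_const_mul]
      gcongr
      exact run.integral_noise_sq_le hq hsmooth hvar ht hi)
    (fun i hi j hj => by
      simp only [inner_smul_right]
      rw [integral_const_mul, run.integral_inner_noise_eq_zero hq hsmooth hvar ht hj (hadapt i hi),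
        mul_zero])
  have hIm := integrable_finSpread hm
  have hIθ := integrable_finSpread hθ
  have h2 : ∫ ω, finSpread C (fun i => β • run.momentum t i ω +
      (1 - β) • gradient (localLoss q (D i)) (run.model t i ω)) ∂P ≤
      ∫ ω, (β * finSpread C (fun i => run.momentum t i ω) +
        (1 - β) * (2 * ζ ^ 2 + 2 * L ^ 2 * finSpread C (fun i => run.model t i ω))) ∂P := by
    refine integral_mono (integrable_finSpread hz) ((hIm.const_mul _).add
      (((integrable_const _).add (hIθ.const_mul _)).const_mul _)) fun ω => ?_
    refine (finSpread_convex_comb_le hβ0 hβ1 C _ _).trans ?_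
    have := finSpread_gradient_le hsmooth hhet (fun i => run.model t i ω)
    have := sub_nonneg.2 hβ1
    gcongr
  have h3 : ∫ ω, (β * finSpread C (fun i => run.momentum t i ω) +
        (1 - β) * (2 * ζ ^ 2 + 2 * L ^ 2 * finSpread C (fun i => run.model t i ω))) ∂P =
      β * run.momentumSpread t + (1 - β) * (2 * ζ ^ 2 + 2 * L ^ 2 * run.modelSpread t) := by
    have hI2 : Integrable (fun ω => 2 * ζ ^ 2 +
      2 * L ^ 2 * finSpread C (fun i => run.model t i ω)) P :=
      (integrable_const _).add (hIθ.const_mul _)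
    rw [integral_add (hIm.const_mul _) (hI2.const_mul _), integral_const_mul, integral_const_mul,
      integral_add (integrable_const _) (hIθ.const_mul _), integral_const_mul, integral_const_mul,
      integral_const, probReal_univ, one_smul, momentumSpread, modelSpread]
  have h4 : run.momentumSpread (t + 1) = ∫ ω, finSpread C (fun i => (β • run.momentum t i ω +
      (1 - β) • gradient (localLoss q (D i)) (run.model t i ω)) + (1 - β) • run.noise t i ω) ∂P :=
    integral_congr_ae (Eventually.of_forall fun ω =>
      finSpread_congr fun i hi => run.momentum_succ_eq ht hi ω)
  linarith

/-- The new deviation is a convex combination of the old one and of the error from evaluating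
gradients at differing models, plus averaged noise. Orthogonality across nodes gives the gain 1 /
|C|. -/
lemma newDeviationSq_le (hne : C.Nonempty) (hL : 0 ≤ L)
    (hβ0 : 0 ≤ β) (hβ1 : β ≤ 1) (ht : t < T) :
    run.newDeviationSq t ≤ β * run.deviationSq t +
      (1 - β) * (L ^ 2 * run.modelSpread t) + (1 - β) ^ 2 * (σ ^ 2 / C.card) := by
  have hm : ∀ i ∈ C, MemLp (run.momentum t i) 2 P := fun i hi =>
    run.memLp_momentum hn hC hq hsmooth hvar ht.le hi
  have hθ : ∀ i ∈ C, MemLp (run.model t i) 2 P := fun i hi =>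
    run.memLp_model hn hC hq hsmooth hvar ht.le hi
  have hg : ∀ i ∈ C, MemLp (fun ω => gradient (localLoss q (D i)) (run.model t i ω)) 2 P :=
    fun i hi => memLp_lipschitz_comp (hsmooth i hi).2 (hθ i hi)
  have hQ := run.memLp_gradient_avgModel hn hC hq hsmooth hvar hL ht.le
  set F₁ : Ω → Param d := fun ω =>
    run.avgMomentum t ω - gradient (correctLoss q D C) (run.avgModel t ω) with hF₁
  set F₂ : Ω → Param d := fun ω =>
    finAvg C (fun i => gradient (localLoss q (D i)) (run.model t i ω)) -
      gradient (correctLoss q D C) (run.avgModel t ω) with hF₂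
  set N : Ω → Param d := fun ω => finAvg C fun i => run.noise t i ω with hN
  have hF₁m : MemLp F₁ 2 P := (run.memLp_avgMomentum hn hC hq hsmooth hvar ht.le).sub hQ
  have hF₂m : MemLp F₂ 2 P := (memLp_finAvg hg).sub hQ
  have hNm : MemLp N 2 P := memLp_finAvg fun i hi => run.memLp_noise hq hsmooth hvar ht hi
  have hFm : MemLp (fun ω => β • F₁ ω + (1 - β) • F₂ ω) 2 P :=
    (hF₁m.const_smul β).add (hF₂m.const_smul (1 - β))
  -- Measurability with respect to the past, not just the ambient σ-algebra, is what yields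
  -- orthogonality to the fresh noise.
  have hadapt : Measurable[run.history t] (fun ω => β • F₁ ω + (1 - β) • F₂ ω) := by
    have a1 : Measurable[run.history t] (run.avgModel t) :=
      @measurable_finAvg _ _ _ _ (run.history t) _ (run.model_adapted t ht.le)
    have a2 : Measurable[run.history t] (run.avgMomentum t) :=
      @measurable_finAvg _ _ _ _ (run.history t) _ (run.momentum_adapted hq t ht.le)
    have a3 : Measurable[run.history t]
        (fun ω => gradient (correctLoss q D C) (run.avgModel t ω)) :=
      (continuous_of_norm_sub_le
        (hsmooth.gradient_correctLoss_lipschitz hL)).measurable.comp a1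
    have a4 : Measurable[run.history t]
        (fun ω => finAvg C fun i => gradient (localLoss q (D i)) (run.model t i ω)) :=
      @measurable_finAvg _ _ _ _ (run.history t) _ fun i hi =>
        (continuous_of_norm_sub_le (hsmooth i hi).2).measurable.comp
          (run.model_adapted t ht.le i hi)
    exact ((a2.sub a3).const_smul β).add ((a4.sub a3).const_smul (1 - β))
  have horth : ∫ ω, (inner ℝ (β • F₁ ω + (1 - β) • F₂ ω) ((1 - β) • N ω) : ℝ) ∂P = 0 := by
    have e1 : ∀ ω, (inner ℝ (β • F₁ ω + (1 - β) • F₂ ω) ((1 - β) • N ω) : ℝ) =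
        (1 - β) * ((1 / (C.card : ℝ)) *
          ∑ i ∈ C, inner ℝ (β • F₁ ω + (1 - β) • F₂ ω) (run.noise t i ω)) := fun ω => by
      simp only [hN]
      rw [inner_smul_right, finAvg, inner_smul_right, inner_sum]
    simp only [e1]
    rw [integral_const_mul, integral_const_mul, integral_finsetSum _ fun i hi =>
      hFm.integrable_inner (run.memLp_noise hq hsmooth hvar ht hi), Finset.sum_eq_zero fun i hi =>
      run.integral_inner_noise_eq_zero hq hsmooth hvar ht hi hadapt]
    simp
  have h1 : run.newDeviationSq t = ∫ ω, ‖(β • F₁ ω + (1 - β) • F₂ ω) + (1 - β) • N ω‖ ^ 2 ∂P := by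
    refine integral_congr_ae (Eventually.of_forall fun ω => ?_)
    have e1 : run.avgMomentum (t + 1) ω = (β • run.avgMomentum t ω +
        (1 - β) • finAvg C (fun i => gradient (localLoss q (D i)) (run.model t i ω)))
        + (1 - β) • N ω := by
      rw [avgMomentum, finAvg_congr fun i hi => run.momentum_succ_eq ht hi ω, finAvg_add,
        finAvg_add, finAvg_smul, finAvg_smul, finAvg_smul]
      rfl
    simp only [e1, hF₁, hF₂]
    congr 2
    module
  have h2 : ∫ ω, ‖(1 - β) • N ω‖ ^ 2 ∂P ≤ (1 - β) ^ 2 * (σ ^ 2 / C.card) := by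
    simp only [norm_smul, mul_pow, Real.norm_eq_abs, sq_abs]
    rw [integral_const_mul]
    gcongr
    exact integral_norm_finAvg_sq_le hne
      (fun i hi => run.memLp_noise hq hsmooth hvar ht hi)
      (fun i hi => run.integral_noise_sq_le hq hsmooth hvar ht hi)
      (fun i hi j hj hij => run.integral_inner_noise_noise_eq_zero hq hsmooth hvar ht hi hj hij)
  have h3 : ∫ ω, ‖β • F₁ ω + (1 - β) • F₂ ω‖ ^ 2 ∂P ≤
      β * run.deviationSq t + (1 - β) * (L ^ 2 * run.modelSpread t) := by
    rw [deviationSq, modelSpread, ← integral_const_mul, ← integral_const_mul, ← integral_const_mul,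
      ← integral_add (hF₁m.integrable_norm_sq.const_mul _)
        (((integrable_finSpread hθ).const_mul _).const_mul _)]
    refine integral_mono hFm.integrable_norm_sq ((hF₁m.integrable_norm_sq.const_mul _).add
      (((integrable_finSpread hθ).const_mul _).const_mul _)) fun ω => ?_
    refine (norm_convex_comb_sq_le hβ0 hβ1 _ _).trans ?_
    have h4 := hsmooth.norm_finAvg_gradient_sub_sq_le fun i => run.model t i ω
    have := sub_nonneg.2 hβ1
    simp only [hF₁, hF₂]
    gcongr
    exact h4
  have h4 := integral_norm_add_sq_of_orthogonal hFm (hNm.const_smul (1 - β)) horth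
  simp only [Pi.smul_apply] at h4
  rw [h1, h4]
  exact add_le_add h3 h2

end Bounds

end MonnaExecution

end Run

/-! ### Deterministic recursions: spreads and Lyapunov function -/

section Recursion

variable {T : ℕ} {L σ ζ γ β α lam c₁ : ℝ}

/-- Joint induction: `B` is stable for the momentum recursion when the model spread is at most (c₁ /
9)γ²B, and this level is stable for the model recursion when the momentum spread is at most `B`. -/
lemma spread_recursion_le {G M S : ℕ → ℝ} {B : ℝ} (hα0 : 0 ≤ α) (hα1 : α < 1)
    (hc₁ : c₁ = 18 * α * (1 + α) / (1 - α) ^ 2) (hβ0 : 0 ≤ β) (hβ1 : β ≤ 1) (hB : 0 ≤ B)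
    (hBfix : 2 * ζ ^ 2 + 2 / 9 * (c₁ * γ ^ 2 * L ^ 2) * B + (1 - β) * σ ^ 2 ≤ B)
    (hG0 : G 0 = 0) (hM0 : M 0 = 0) (hG : ∀ t < T, G (t + 1) ≤ α * S t)
    (hS : ∀ s > 0, ∀ t < T, S t ≤ (1 + s) * G t + (1 + 1 / s) * (γ ^ 2 * M (t + 1)))
    (hM : ∀ t < T, M (t + 1) ≤ β * M t + (1 - β) * (2 * ζ ^ 2 + 2 * L ^ 2 * G t)
      + (1 - β) ^ 2 * σ ^ 2) :
    ∀ t ≤ T, M t ≤ B ∧ G t ≤ c₁ / 9 * γ ^ 2 * B := by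
  have hα1' : 0 < 1 - α := sub_pos.2 hα1
  have hc0 : 0 ≤ c₁ := by rw [hc₁]; positivity
  intro t
  induction t with
  | zero => intro _; rw [hG0, hM0]; exact ⟨hB, by positivity⟩
  | succ t ih =>
    intro ht
    have ht' : t < T := ht
    obtain ⟨ihM, ihG⟩ := ih ht'.le
    have hβ1' := sub_nonneg.2 hβ1
    have hM' : M (t + 1) ≤ B := by
      calc M (t + 1) ≤ β * M t + (1 - β) * (2 * ζ ^ 2 + 2 * L ^ 2 * G t)
            + (1 - β) ^ 2 * σ ^ 2 := hM t ht'
        _ ≤ β * B + (1 - β) * (2 * ζ ^ 2 + 2 * L ^ 2 * (c₁ / 9 * γ ^ 2 * B))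
            + (1 - β) ^ 2 * σ ^ 2 := by gcongr
        _ = β * B + (1 - β) * (2 * ζ ^ 2 + 2 / 9 * (c₁ * γ ^ 2 * L ^ 2) * B
            + (1 - β) * σ ^ 2) := by ring
        _ ≤ β * B + (1 - β) * B := by gcongr
        _ = B := by ring
    refine ⟨hM', ?_⟩
    -- The Young weight (1 - α) / (2α) turns the factor α into (1 + α) / 2 and fixes the value of
    -- c₁; it requires α > 0.
    rcases hα0.eq_or_lt with h0 | hpos
    · have := hG t ht'
      rw [← h0, zero_mul] at this
      exact this.trans (by positivity)
    · have h1 := hS ((1 - α) / (2 * α)) (by positivity) t ht'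
      have e1 : α * (1 + (1 - α) / (2 * α)) = (1 + α) / 2 := by field_simp; ring
      have e2 : α * (1 + 1 / ((1 - α) / (2 * α))) = c₁ / 9 * ((1 - α) / 2) := by
        rw [hc₁]; field_simp; ring
      calc G (t + 1) ≤ α * S t := hG t ht'
        _ ≤ α * ((1 + (1 - α) / (2 * α)) * G t +
            (1 + 1 / ((1 - α) / (2 * α))) * (γ ^ 2 * M (t + 1))) := by gcongr
        _ = (1 + α) / 2 * G t + c₁ / 9 * ((1 - α) / 2) * (γ ^ 2 * M (t + 1)) := by
            rw [mul_add, ← mul_assoc, e1, ← mul_assoc, e2]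
        _ ≤ (1 + α) / 2 * (c₁ / 9 * γ ^ 2 * B) + c₁ / 9 * ((1 - α) / 2) * (γ ^ 2 * B) := by
            gcongr
        _ = c₁ / 9 * γ ^ 2 * B := by ring

/-- From β² = 1 - 12γL: 1 - β ≤ 1 - β² as β ≤ 1, and √(1 - x) ≤ 1 - x / 2. -/
lemma momentum_coefficient_bounds (hγ : 0 ≤ γ) (hL : 0 < L) (hγL : 12 * (γ * L) ≤ 1)
    (hβ : β = Real.sqrt (1 - 12 * γ * L)) :
    0 ≤ β ∧ β ≤ 1 ∧ 1 - β ≤ 12 * (γ * L) ∧ β ≤ 1 - 6 * (γ * L) := by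
  have hX : 0 ≤ γ * L := by positivity
  have h0 : 0 ≤ β := by rw [hβ]; exact Real.sqrt_nonneg _
  have h1 : β ^ 2 = 1 - 12 * (γ * L) := by rw [hβ, Real.sq_sqrt (by linarith)]; ring
  have h2 : β ≤ 1 := by nlinarith
  refine ⟨h0, h2, by nlinarith, ?_⟩
  refine abs_le_of_sq_le_sq' ?_ (by linarith) |>.2
  nlinarith [sq_nonneg (γ * L)]

/-- Here a, w, d, x stand for the squared gradient, move, new and old deviation. Adding (x' - x) /
(4L) gives d the coefficient (1 + 6γL) / (4L). As (1 + 6γL)β ≤ 1, the old deviation is absorbed; the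
move term produced by x' is dominated because 9γL ≤ 5. -/
lemma lyapunov_step {a w d x x' S G Gmax Smax v : ℝ} (hγ : 0 < γ) (hL : 0 < L)
    (hγL : 12 * (γ * L) ≤ 1) (hβ1 : β ≤ 1) (hβ2 : 1 - β ≤ 12 * (γ * L))
    (hβ3 : β ≤ 1 - 6 * (γ * L)) (hlam : 0 ≤ lam) (hv : 0 ≤ v) (hw : 0 ≤ w) (hx : 0 ≤ x)
    (hGmax : 0 ≤ Gmax) (hG : G ≤ Gmax) (hS : S ≤ Smax)
    (hd : d ≤ β * x + (1 - β) * (L ^ 2 * G) + (1 - β) ^ 2 * v)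
    (hx' : x' ≤ (1 + 3 * (γ * L)) * d + (1 + 1 / (3 * (γ * L))) * (L ^ 2 * w)) :
    - (γ / 2) * a - (1 / (2 * γ) - L / 2) * w + 3 * γ / 4 * d + 3 / (2 * γ) * (lam * S) ≤
      - (γ / 2) * a - (1 / (4 * L)) * (x' - x) + (9 / 2 * γ * L ^ 2 * Gmax + 54 * γ ^ 2 * L * v
        + 3 / (2 * γ) * (lam * Smax)) := by
  have hX : 0 < γ * L := by positivity
  have h1 : 1 / (4 * L) * x' ≤ 1 / (4 * L) *
      ((1 + 3 * (γ * L)) * d + (1 + 1 / (3 * (γ * L))) * (L ^ 2 * w)) := by gcongr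
  have h2 : 1 / (4 * L) * ((1 + 3 * (γ * L)) * d + (1 + 1 / (3 * (γ * L))) * (L ^ 2 * w)) +
      3 * γ / 4 * d = (1 + 6 * (γ * L)) / (4 * L) * d + (L / 4 + 1 / (12 * γ)) * w := by
    field_simp; ring
  have h3 : (L / 4 + 1 / (12 * γ)) * w ≤ (1 / (2 * γ) - L / 2) * w := by
    refine mul_le_mul_of_nonneg_right ?_ hw
    have h4 : 1 / (2 * γ) - L / 2 - (L / 4 + 1 / (12 * γ)) = (5 - 9 * (γ * L)) / (12 * γ) := by
      field_simp; ring
    have h5 : 0 ≤ (5 - 9 * (γ * L)) / (12 * γ) := div_nonneg (by linarith) (by positivity)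
    linarith
  have h6 : (1 + 6 * (γ * L)) / (4 * L) * d ≤ (1 + 6 * (γ * L)) / (4 * L) *
      (β * x + (1 - β) * (L ^ 2 * G) + (1 - β) ^ 2 * v) := by gcongr
  have h7 : (1 + 6 * (γ * L)) / (4 * L) * (β * x) ≤ 1 / (4 * L) * x := by
    have h8 : (1 + 6 * (γ * L)) * β ≤ 1 := by
      calc (1 + 6 * (γ * L)) * β ≤ (1 + 6 * (γ * L)) * (1 - 6 * (γ * L)) := by gcongr
        _ ≤ 1 := by nlinarith [sq_nonneg (γ * L)]
    calc (1 + 6 * (γ * L)) / (4 * L) * (β * x) = ((1 + 6 * (γ * L)) * β) / (4 * L) * x := by ring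
      _ ≤ 1 / (4 * L) * x := by gcongr
  have hK : (1 + 6 * (γ * L)) / (4 * L) ≤ 3 / (8 * L) := by
    rw [div_le_div_iff₀ (by positivity) (by positivity)]
    nlinarith
  have hβ1' := sub_nonneg.2 hβ1
  have h9 : (1 + 6 * (γ * L)) / (4 * L) * ((1 - β) * (L ^ 2 * G)) ≤
      9 / 2 * γ * L ^ 2 * Gmax := by
    calc (1 + 6 * (γ * L)) / (4 * L) * ((1 - β) * (L ^ 2 * G))
        ≤ (1 + 6 * (γ * L)) / (4 * L) * ((1 - β) * (L ^ 2 * Gmax)) := by gcongr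
      _ ≤ 3 / (8 * L) * ((12 * (γ * L)) * (L ^ 2 * Gmax)) := by gcongr
      _ = 9 / 2 * γ * L ^ 2 * Gmax := by field_simp; ring
  have h10 : (1 + 6 * (γ * L)) / (4 * L) * ((1 - β) ^ 2 * v) ≤ 54 * γ ^ 2 * L * v := by
    calc (1 + 6 * (γ * L)) / (4 * L) * ((1 - β) ^ 2 * v)
        ≤ 3 / (8 * L) * ((12 * (γ * L)) ^ 2 * v) := by gcongr
      _ = 54 * γ ^ 2 * L * v := by field_simp; ring
  have h11 : 3 / (2 * γ) * (lam * S) ≤ 3 / (2 * γ) * (lam * Smax) := by gcongr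
  linarith

lemma sum_le_of_lyapunov {a w d x S G : ℕ → ℝ} {Δ Gmax Smax v : ℝ} (hγ : 0 < γ) (hL : 0 < L)
    (hγL : 12 * (γ * L) ≤ 1) (hβ1 : β ≤ 1) (hβ2 : 1 - β ≤ 12 * (γ * L))
    (hβ3 : β ≤ 1 - 6 * (γ * L)) (hlam : 0 ≤ lam) (hv : 0 ≤ v) (hw : ∀ t, 0 ≤ w t)
    (hx : ∀ t, 0 ≤ x t) (hx0 : x 0 ≤ 2 * L * Δ)
    (hGmax : 0 ≤ Gmax) (hG : ∀ t < T, G t ≤ Gmax) (hS : ∀ t < T, S t ≤ Smax)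
    (hd : ∀ t < T, d t ≤ β * x t + (1 - β) * (L ^ 2 * G t) + (1 - β) ^ 2 * v)
    (hxs : ∀ t < T, x (t + 1) ≤ (1 + 3 * (γ * L)) * d t +
      (1 + 1 / (3 * (γ * L))) * (L ^ 2 * w t))
    (hsum : -Δ ≤ ∑ t ∈ Finset.range T, (- (γ / 2) * a t - (1 / (2 * γ) - L / 2) * w t
      + 3 * γ / 4 * d t + 3 / (2 * γ) * (lam * S t))) :
    ∑ t ∈ Finset.range T, a t ≤ 3 * Δ / γ +
      T * (9 * L ^ 2 * Gmax + 108 * γ * L * v + 3 * lam * Smax / γ ^ 2) := by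
  have h1 := hsum.trans (Finset.sum_le_sum fun t ht =>
    have ht := Finset.mem_range.1 ht
    lyapunov_step hγ hL hγL hβ1 hβ2 hβ3 hlam hv (hw t) (hx t) hGmax (hG t ht) (hS t ht)
      (hd t ht) (hxs t ht))
  rw [Finset.sum_add_distrib, Finset.sum_sub_distrib, ← Finset.mul_sum, ← Finset.mul_sum,
    Finset.sum_range_sub, Finset.sum_const, Finset.card_range, nsmul_eq_mul] at h1
  -- The initial deviation costs Δ / 2, so Δ becomes 3Δ / 2, and 3Δ / γ after division by γ / 2.
  have h2 : 1 / (4 * L) * x 0 ≤ Δ / 2 := by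
    calc 1 / (4 * L) * x 0 ≤ 1 / (4 * L) * (2 * L * Δ) := by gcongr
      _ = Δ / 2 := by field_simp; norm_num
  have h3 : 0 ≤ 1 / (4 * L) * x T := mul_nonneg (by positivity) (hx T)
  have h4 : γ / 2 * ∑ t ∈ Finset.range T, a t ≤ γ / 2 * (3 * Δ / γ +
      T * (9 * L ^ 2 * Gmax + 108 * γ * L * v + 3 * lam * Smax / γ ^ 2)) := by
    have e : γ / 2 * (3 * Δ / γ +
        T * (9 * L ^ 2 * Gmax + 108 * γ * L * v + 3 * lam * Smax / γ ^ 2)) = 3 / 2 * Δ +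
        T * (9 / 2 * γ * L ^ 2 * Gmax + 54 * γ ^ 2 * L * v + 3 / (2 * γ) * (lam * Smax)) := by
      field_simp; ring
    rw [e]
    linarith
  exact le_of_mul_le_mul_left h4 (by positivity)

end Recursion

/-! ### Consequences of the choice of step size -/

section StepSize

variable {T : ℕ} {L σ c₀ c₁ c₂ γ : ℝ}

lemma monnaStepSize_of_zero (hL : 0 < L) (hc₁ : 0 ≤ c₁) : monnaStepSize L σ 0 c₁ c₂ T = 0 := by
  unfold monnaStepSize
  rw [zero_div, Real.sqrt_zero]
  split_ifs with h
  · exact min_eq_right (by positivity)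
  · rw [min_eq_right (a := 1 / L * √(2 / (3 * c₁))) (by positivity), min_eq_right (by positivity)]

/-- What the analysis uses of the step size. -/
lemma monnaStepSize_spec (hT : 1 ≤ T) (hL : 0 < L) (hσ : 0 < σ) (hc₀ : 0 < c₀) (hc₁ : 0 ≤ c₁)
    (hc₂ : 0 < c₂) (hγ : γ = monnaStepSize L σ c₀ c₁ c₂ T) :
    0 < γ ∧ 12 * (γ * L) ≤ 1 ∧ c₁ * γ ^ 2 * L ^ 2 ≤ 2 / 3 ∧
      γ ^ 2 ≤ c₀ / (c₂ * L * T * σ ^ 2) ∧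
      1 / γ ≤ 12 * L + L * √(3 * c₁ / 2) + √(c₂ * L * T * σ ^ 2 / c₀) := by
  have hT0 : (0 : ℝ) < T := by exact_mod_cast hT
  have hw : 0 < c₀ / (c₂ * L * T * σ ^ 2) := by positivity
  -- The reciprocal of a minimum is the largest of the reciprocals, hence at most their sum; these
  -- identities compute them.
  have hA : 1 / (1 / (12 * L)) = 12 * L := one_div_one_div _
  have hB : 1 / √(c₀ / (c₂ * L * T * σ ^ 2)) = √(c₂ * L * T * σ ^ 2 / c₀) := by
    rw [← inv_div c₀, Real.sqrt_inv, one_div]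
  have hs1 : 0 ≤ √(c₂ * L * T * σ ^ 2 / c₀) := Real.sqrt_nonneg _
  have hs2 : 0 ≤ L * √(3 * c₁ / 2) := by positivity
  have hL12 : 0 < 12 * L := by positivity
  have hb : ∀ x : ℝ, x ≤ 1 / (12 * L) → 12 * (x * L) ≤ 1 := fun x hx => by
    have := mul_le_mul_of_nonneg_right hx hL12.le
    rw [one_div_mul_cancel hL12.ne'] at this
    linarith
  have hd : ∀ x : ℝ, 0 < x → x ≤ √(c₀ / (c₂ * L * T * σ ^ 2)) →
      x ^ 2 ≤ c₀ / (c₂ * L * T * σ ^ 2) := fun x hx0 hx => by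
    rw [← Real.sq_sqrt hw.le]
    gcongr
  by_cases h : c₁ = 0
  · rw [monnaStepSize, if_pos h] at hγ
    have hpos : 0 < γ := by rw [hγ]; exact lt_min (by positivity) (Real.sqrt_pos.2 hw)
    refine ⟨hpos, hb _ (hγ ▸ min_le_left _ _), by rw [h]; norm_num,
      hd _ hpos (hγ ▸ min_le_right _ _), ?_⟩
    rcases min_choice (1 / (12 * L)) (√(c₀ / (c₂ * L * T * σ ^ 2))) with h' | h' <;>
      rw [hγ, h'] <;> [rw [hA]; rw [hB]] <;> linarith
  · rw [monnaStepSize, if_neg h] at hγ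
    have hc₁' : 0 < c₁ := lt_of_le_of_ne hc₁ (Ne.symm h)
    have hC : 1 / (1 / L * √(2 / (3 * c₁))) = L * √(3 * c₁ / 2) := by
      rw [← inv_div 2, Real.sqrt_inv, one_div, one_div, mul_inv, inv_inv]
    have hpos : 0 < γ := by
      rw [hγ]
      exact lt_min (by positivity) (lt_min (by positivity) (Real.sqrt_pos.2 hw))
    have h2 : γ ≤ 1 / L * √(2 / (3 * c₁)) := hγ ▸ (min_le_right _ _).trans (min_le_left _ _)
    refine ⟨hpos, hb _ (hγ ▸ min_le_left _ _), ?_,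
      hd _ hpos (hγ ▸ (min_le_right _ _).trans (min_le_right _ _)), ?_⟩
    · have h3 : γ ^ 2 ≤ (1 / L * √(2 / (3 * c₁))) ^ 2 := by gcongr
      rw [mul_pow, Real.sq_sqrt (by positivity)] at h3
      calc c₁ * γ ^ 2 * L ^ 2 ≤ c₁ * ((1 / L) ^ 2 * (2 / (3 * c₁))) * L ^ 2 := by gcongr
        _ = 2 / 3 := by field_simp
    · rcases min_choice (1 / (12 * L)) (min (1 / L * √(2 / (3 * c₁)))
        (√(c₀ / (c₂ * L * T * σ ^ 2)))) with h' | h'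
      · rw [hγ, h', hA]; linarith
      · rcases min_choice (1 / L * √(2 / (3 * c₁))) (√(c₀ / (c₂ * L * T * σ ^ 2))) with h'' | h''
        · rw [hγ, h', h'', hC]; linarith
        · rw [hγ, h', h'', hB]; linarith

/-- Substitution of the step size into the error bound. -/
lemma error_bound_le {lam n h ζ c₃ c₄ B Δ T : ℝ} (hT : 0 < T) (hL : 0 < L) (hσ : 0 < σ)
    (hc₀ : 0 < c₀) (hc₁ : 0 ≤ c₁) (hc₂0 : 0 < c₂) (hlam : 0 ≤ lam) (hh : 0 < h) (hhn : h ≤ n)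
    (hΔ : c₀ = 12 * Δ) (hB : B = 27 / 23 * (2 * ζ ^ 2 + 12 * (γ * L) * σ ^ 2))
    (hc₂ : c₂ = 72 * (3 / h + 2 * c₁ + 9 * lam / 2 * (2 * c₁ + 3)))
    (hc₃ : c₃ = 6 * (6 * c₁ + 9 * lam / 2 * (4 * c₁ + 9)))
    (hc₄ : c₄ = 9 * n * c₀ * c₁ / c₂) (hγ : 0 < γ) (hγL : 12 * (γ * L) ≤ 1)
    (hγ2 : γ ^ 2 ≤ c₀ / (c₂ * L * T * σ ^ 2))
    (hγinv : 1 / γ ≤ 12 * L + L * √(3 * c₁ / 2) + √(c₂ * L * T * σ ^ 2 / c₀)) :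
    2 * (3 * Δ / (γ * T) + (9 * L ^ 2 * (c₁ / 9 * γ ^ 2 * B) + 108 * γ * L * (σ ^ 2 / h)
      + 3 * lam * (2 * (c₁ / 9 * γ ^ 2 * B) + 2 * (γ ^ 2 * B)) / γ ^ 2)) +
      2 * L ^ 2 * (h * (c₁ / 9 * γ ^ 2 * B)) ≤
    2 * √(c₀ * c₂ * L * σ ^ 2 / T) + 12 * L * c₀ / T
      + L * c₀ / T * √(3 * c₁ / 2) + 36 / T * (σ ^ 2 / h)
      + c₄ * L / T * (1 + ζ ^ 2 / σ ^ 2) + c₃ * ζ ^ 2 := by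
  have hX : 0 < γ * L := by positivity
  have hn0 : 0 ≤ n := hh.le.trans hhn
  have hB0 : 0 ≤ B := by rw [hB]; positivity
  set r := √(c₀ * c₂ * L * σ ^ 2 / T) with hr
  have hr0 : 0 ≤ r := Real.sqrt_nonneg _
  -- Since c₀ = 12Δ, the left side is half of c₀ / (γT); the bound keeps twice that amount.
  have t1 : 2 * (3 * Δ / (γ * T)) ≤ r + 12 * L * c₀ / T + L * c₀ / T * √(3 * c₁ / 2) := by
    have e1 : 2 * (3 * Δ / (γ * T)) = 1 / 2 * (c₀ / T * (1 / γ)) := by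
      rw [hΔ]; field_simp; ring
    have e2 : c₀ / T * √(c₂ * L * T * σ ^ 2 / c₀) = r := by
      rw [hr, ← Real.sqrt_sq (by positivity : 0 ≤ c₀ / T), ← Real.sqrt_mul (by positivity)]
      congr 1; field_simp
    have e3 : c₀ / T * (1 / γ) ≤
        c₀ / T * (12 * L + L * √(3 * c₁ / 2) + √(c₂ * L * T * σ ^ 2 / c₀)) := by gcongr
    have e4 : 0 ≤ c₀ / T * (1 / γ) := by positivity
    have e5 : c₀ / T * (12 * L + L * √(3 * c₁ / 2) + √(c₂ * L * T * σ ^ 2 / c₀)) =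
        c₀ / T * √(c₂ * L * T * σ ^ 2 / c₀) + 12 * L * c₀ / T + L * c₀ / T * √(3 * c₁ / 2) := by
      ring
    rw [e1]
    linarith
  -- The third entry of the step size makes c₂γLσ² at most the same root as in `t1`, which explains
  -- the factor 2 in front of it.
  have t2 : c₂ * (γ * L) * σ ^ 2 ≤ r := by
    refine Real.le_sqrt_of_sq_le ?_
    calc (c₂ * (γ * L) * σ ^ 2) ^ 2 = c₂ ^ 2 * L ^ 2 * σ ^ 4 * γ ^ 2 := by ring
      _ ≤ c₂ ^ 2 * L ^ 2 * σ ^ 4 * (c₀ / (c₂ * L * T * σ ^ 2)) := by gcongr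
      _ = c₀ * c₂ * L * σ ^ 2 / T := by field_simp
  have t3 : 2 * (9 * L ^ 2 * (c₁ / 9 * γ ^ 2 * B) + 108 * γ * L * (σ ^ 2 / h)
      + 3 * lam * (2 * (c₁ / 9 * γ ^ 2 * B) + 2 * (γ ^ 2 * B)) / γ ^ 2) ≤
      c₂ * (γ * L) * σ ^ 2 + c₃ * ζ ^ 2 := by
    have e1 : 3 * lam * (2 * (c₁ / 9 * γ ^ 2 * B) + 2 * (γ ^ 2 * B)) / γ ^ 2 =
        lam * (2 / 3 * c₁ + 6) * B := by field_simp; ring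
    have e2 : 9 * L ^ 2 * (c₁ / 9 * γ ^ 2 * B) = c₁ * B * (γ * L) ^ 2 := by ring
    have e3 : c₁ * B * (γ * L) ^ 2 ≤ c₁ * B * (1 / 12) ^ 2 := by
      have : γ * L ≤ 1 / 12 := by linarith
      gcongr
    have e4 : 108 * γ * L * (σ ^ 2 / h) = 108 * (γ * L) * σ ^ 2 * (1 / h) := by ring
    have e5 : c₂ * (γ * L) * σ ^ 2 = 216 * (γ * L) * σ ^ 2 * (1 / h) +
        144 * (c₁ * ((γ * L) * σ ^ 2)) + 648 * (lam * c₁ * ((γ * L) * σ ^ 2)) +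
        972 * (lam * ((γ * L) * σ ^ 2)) := by rw [hc₂]; ring
    have e6 : c₃ * ζ ^ 2 = 36 * (c₁ * ζ ^ 2) + 108 * (lam * c₁ * ζ ^ 2) + 243 * (lam * ζ ^ 2) := by
      rw [hc₃]; ring
    have p1 : 0 ≤ c₁ * ζ ^ 2 := by positivity
    have p2 : 0 ≤ lam * c₁ * ζ ^ 2 := by positivity
    have p3 : 0 ≤ lam * ζ ^ 2 := by positivity
    have p4 : 0 ≤ c₁ * ((γ * L) * σ ^ 2) := by positivity
    have p5 : 0 ≤ lam * c₁ * ((γ * L) * σ ^ 2) := by positivity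
    have p6 : 0 ≤ lam * ((γ * L) * σ ^ 2) := by positivity
    rw [e1, e2, e4, e5, e6]
    have e7 : c₁ * B * (1 / 12) ^ 2 + lam * (2 / 3 * c₁ + 6) * B =
        3 / 184 * (c₁ * ζ ^ 2) + 9 / 92 * (c₁ * ((γ * L) * σ ^ 2))
        + 36 / 23 * (lam * c₁ * ζ ^ 2) + 216 / 23 * (lam * c₁ * ((γ * L) * σ ^ 2))
        + 324 / 23 * (lam * ζ ^ 2) + 1944 / 23 * (lam * ((γ * L) * σ ^ 2)) := by
      rw [hB]; ring
    linarith
  -- Here h is enlarged to n, and B to (81/2)(σ² + ζ²), so that 2 · (1/9) · (81/2) = 9, the constant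
  -- in c₄.
  have t4 : 2 * L ^ 2 * (h * (c₁ / 9 * γ ^ 2 * B)) ≤ c₄ * L / T * (1 + ζ ^ 2 / σ ^ 2) := by
    have e1 : B ≤ 81 / 2 * (σ ^ 2 + ζ ^ 2) := by
      have : 12 * (γ * L) * σ ^ 2 ≤ 1 * σ ^ 2 := by gcongr
      rw [hB]
      linarith [sq_nonneg ζ, sq_nonneg σ]
    calc 2 * L ^ 2 * (h * (c₁ / 9 * γ ^ 2 * B))
        ≤ 2 * L ^ 2 * (n * (c₁ / 9 * (c₀ / (c₂ * L * T * σ ^ 2)) *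
            (81 / 2 * (σ ^ 2 + ζ ^ 2)))) := by gcongr
      _ = c₄ * L / T * (1 + ζ ^ 2 / σ ^ 2) := by rw [hc₄]; field_simp; ring
  -- This term of the bound is pure slack.
  have t5 : 0 ≤ 36 / T * (σ ^ 2 / h) := by positivity
  linarith

end StepSize

/-! ### Zero step size and the random output -/

section Run

variable {n d f T : ℕ} {X Ω : Type*} [MeasurableSpace X] [MeasurableSpace Ω]
  {P : Measure Ω} {q : Param d → X → ℝ} {D : Fin n → Measure X} {C : Finset (Fin n)}
  {L σ ζ γ β : ℝ} {θ₀ : Param d} {t : ℕ} {i : Fin n}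

namespace MonnaExecution

/-- With step size zero no correct node ever moves. -/
lemma model_eq_of_zero_step (run : MonnaExecution P q D C f 1 T 0 β θ₀)
    (hn : 11 * f ≤ n) (hC : C.card = n - f) : ∀ t ≤ T, ∀ i ∈ C, ∀ ω, run.model t i ω = θ₀ := by
  intro t
  induction t with
  | zero => exact fun _ i hi ω => run.model_zero i hi ω
  | succ t ih =>
    intro ht i hi ω
    have hne : C.Nonempty := ⟨i, hi⟩
    have hhalf : ∀ j ∈ C, run.model t j ω - (0 : ℝ) • run.momentum (t + 1) j ω = θ₀ :=
      fun j hj => by rw [zero_smul, sub_zero, ih (Nat.le_of_succ_le ht) j hj ω]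
    obtain ⟨h1, h2⟩ := run.reduction hn hC hne ht ω
    rw [finSpread_congr hhalf, finSpread_const hne, mul_zero] at h1 h2
    rw [finAvg_congr hhalf, finAvg_const hne] at h2
    have h3 := norm_sub_finAvg_sq_le (fun i => run.model (t + 1) i ω) hi
    have h4 : ‖run.model (t + 1) i ω - finAvg C fun i => run.model (t + 1) i ω‖ ^ 2 ≤ 0 :=
      h3.trans (mul_nonpos_of_nonneg_of_nonpos (by positivity) h1)
    have h5 := pow_eq_zero_iff two_ne_zero |>.1 (le_antisymm h4 (by positivity))
    have h6 := pow_eq_zero_iff two_ne_zero |>.1 (le_antisymm h2 (by positivity))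
    rw [sub_eq_zero.1 (norm_eq_zero.1 h5), sub_eq_zero.1 (norm_eq_zero.1 h6)]

variable (run : MonnaExecution P q D C f 1 T γ β θ₀)

/-- The expectation at the returned model is the average over the iterations. -/
lemma integral_output [IsProbabilityMeasure P] {g : Param d → ℝ} (hg : Measurable g) (hi : i ∈ C)
    (hint : ∀ t < T, Integrable (fun ω => g (run.model t i ω)) P) :
    Integrable (fun ω => g (run.output i ω)) P ∧
      ∫ ω, g (run.output i ω) ∂P =
        1 / (T : ℝ) * ∑ t ∈ Finset.range T, ∫ ω, g (run.model t i ω) ∂P := by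
  classical
  have hidx := run.outputIndex_measurable i hi
  let χ : Fin T → Ω → ℝ := fun s ω => (run.outputIndex i ⁻¹' {s}).indicator 1 ω
  have hset : ∀ s : Fin T, MeasurableSet (run.outputIndex i ⁻¹' {s}) := fun s =>
    hidx (measurableSet_singleton s)
  have hdec : ∀ ω, g (run.output i ω) = ∑ s : Fin T, χ s ω * g (run.model s i ω) := fun ω => by
    rw [Finset.sum_eq_single (run.outputIndex i ω)]
    · simp [χ, output]
    · intro s _ hs
      simp [χ, hs.symm]
    · simp
  have hχ : ∀ s, Integrable (χ s) P := fun s =>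
    (integrable_const (1 : ℝ)).indicator (hset s)
  have hterm : ∀ s : Fin T, Integrable (fun ω => χ s ω * g (run.model s i ω)) P ∧
      ∫ ω, χ s ω * g (run.model s i ω) ∂P = 1 / (T : ℝ) * ∫ ω, g (run.model s i ω) ∂P := by
    intro s
    -- The index is independent of `run.history T`, which contains all earlier histories and hence
    -- every candidate model.
    have hind0 : IndepFun (run.outputIndex i) (run.model s i) P := by
      rw [IndepFun_iff_Indep]
      refine indep_of_indep_of_le_right (run.outputIndex_indep i hi) ?_
      exact ((run.model_adapted s s.2.le i hi).mono (run.history.mono s.2.le) le_rfl).comap_le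
    have hind : IndepFun (χ s) (fun ω => g (run.model s i ω)) P :=
      hind0.comp (φ := ({s} : Set (Fin T)).indicator (1 : Fin T → ℝ)) (ψ := g)
        (measurable_of_finite _) hg
    refine ⟨hind.integrable_mul (hχ s) (hint s s.2), ?_⟩
    rw [hind.integral_fun_mul_eq_mul_integral (hχ s).1 (hint s s.2).1]
    congr 1
    have h1 : ∫ ω, χ s ω ∂P = P.real (run.outputIndex i ⁻¹' {s}) := integral_indicator_one (hset s)
    rw [h1, Measure.real, run.outputIndex_uniform i hi s]
    simp
  simp only [hdec]
  refine ⟨integrable_finsetSum _ fun s _ => (hterm s).1, ?_⟩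
  rw [integral_finsetSum _ fun s _ => (hterm s).1, Finset.mul_sum, ← Fin.sum_univ_eq_sum_range
    (fun t => 1 / (T : ℝ) * ∫ ω, g (run.model t i ω) ∂P)]
  exact Finset.sum_congr rfl fun s _ => (hterm s).2

end MonnaExecution

end Run

/-! ### Assembly of the convergence bound -/

theorem theorem1
    {n d f T : ℕ} (hn : 11 * f ≤ n) (hT : 1 ≤ T)
    {X Ω : Type*} [MeasurableSpace X] [MeasurableSpace Ω]
    (P : Measure Ω) [IsProbabilityMeasure P]
    (q : Param d → X → ℝ)
    (D : Fin n → Measure X) [∀ i, IsProbabilityMeasure (D i)]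
    (C : Finset (Fin n)) (hC : C.card = n - f)
    (hq : IsPointwiseLoss q D C)
    (hbdd : BddBelow (Set.range (correctLoss q D C)))
    {L σ ζ : ℝ} (hL : 0 < L) (hσ : 0 < σ)
    (hsmooth : LipschitzSmooth q D C L)
    (hvar : BoundedVariance q D C σ)
    (hhet : BoundedHeterogeneity q D C ζ)
    (θ₀ : Param d)
    {α lam c₀ c₁ c₂ c₃ c₄ γ β : ℝ}
    (hα : α = 9.88 * f / ((n : ℝ) - f))
    (hlam : lam = 9 * f / ((n : ℝ) - f))
    (hc₀ : c₀ = 12 * (correctLoss q D C θ₀ - ⨅ θ, correctLoss q D C θ))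
    (hc₁ : c₁ = 18 * α * (1 + α) / (1 - α) ^ 2)
    (hc₂ : c₂ = 72 * (3 / ((n : ℝ) - f) + 2 * c₁ + 9 * lam / 2 * (2 * c₁ + 3)))
    (hc₃ : c₃ = 6 * (6 * c₁ + 9 * lam / 2 * (4 * c₁ + 9)))
    (hc₄ : c₄ = 9 * n * c₀ * c₁ / c₂)
    (hγ : γ = monnaStepSize L σ c₀ c₁ c₂ T)
    (hβ : β = Real.sqrt (1 - 12 * γ * L))
    (run : MonnaExecution P q D C f 1 T γ β θ₀) :
    α ≤ 0.988 ∧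
    ∀ i ∈ C,
      Integrable (fun ω => ‖gradient (correctLoss q D C) (run.output i ω)‖ ^ 2) P ∧
      ∫ ω, ‖gradient (correctLoss q D C) (run.output i ω)‖ ^ 2 ∂P ≤
        2 * Real.sqrt (c₀ * c₂ * L * σ ^ 2 / T) + 12 * L * c₀ / T
          + L * c₀ / T * Real.sqrt (3 * c₁ / 2) + 36 / T * (σ ^ 2 / ((n : ℝ) - f))
          + c₄ * L / T * (1 + ζ ^ 2 / σ ^ 2) + c₃ * ζ ^ 2 := by 
  have hT0 : (0 : ℝ) < T := by exact_mod_cast hT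
  have hfR : 11 * (f : ℝ) ≤ n := by exact_mod_cast hn
  have hf0 : (0 : ℝ) ≤ f := Nat.cast_nonneg _
  have hα0 : 0 ≤ α := by rw [hα]; exact div_nonneg (by positivity) (by linarith)
  have hα1 : α ≤ 0.988 := by
    rw [hα]
    exact div_le_of_le_mul₀ (by linarith) (by norm_num) (by linarith)
  refine ⟨hα1, fun i hi => ?_⟩
  have hne : C.Nonempty := ⟨i, hi⟩
  have hh0 : (0 : ℝ) < C.card := by exact_mod_cast hne.card_pos
  have hh : ((C.card : ℕ) : ℝ) = n - f := by rw [hC, Nat.cast_sub (by omega)]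
  rw [← hh] at hα hlam hc₂ ⊢
  have hα1' : α < 1 := lt_of_le_of_lt hα1 (by norm_num)
  have hlam0 : 0 ≤ lam := by rw [hlam]; positivity
  have hc₁0 : 0 ≤ c₁ := by rw [hc₁]; positivity
  have hc₂0 : 0 < c₂ := by rw [hc₂]; positivity
  have hc₃0 : 0 ≤ c₃ := by rw [hc₃]; positivity
  have hmin : ∀ θ, ⨅ θ, correctLoss q D C θ ≤ correctLoss q D C θ := fun θ => ciInf_le hbdd θ
  have hc₀0 : 0 ≤ c₀ := by rw [hc₀]; linarith [hmin θ₀]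
  have hLip := hsmooth.gradient_correctLoss_lipschitz hL.le
  have hgm : Measurable fun θ => ‖gradient (correctLoss q D C) θ‖ ^ 2 :=
    (continuous_of_norm_sub_le hLip).measurable.norm.pow_const 2
  have hgrad₀ := norm_gradient_sq_le hL hsmooth.differentiable_correctLoss hLip hmin θ₀
  obtain ⟨hint, hout⟩ := run.integral_output hgm hi fun t ht =>
    (memLp_lipschitz_comp hLip
      (run.memLp_model hn hC hq hsmooth hvar ht.le hi)).integrable_norm_sq
  refine ⟨hint, ?_⟩
  rw [hout]
  -- If c₀ = 0, the step size vanishes, the correct nodes never move, and θ₀ is a minimizer with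
  -- zero gradient.
  rcases hc₀0.eq_or_lt with hc₀z | hc₀pos
  · have hγ0 : γ = 0 := by rw [hγ, ← hc₀z]; exact monnaStepSize_of_zero hL hc₁0
    subst hγ0
    have hg0 : ‖gradient (correctLoss q D C) θ₀‖ ^ 2 = 0 :=
      le_antisymm (hgrad₀.trans (by
        rw [show correctLoss q D C θ₀ - ⨅ θ, correctLoss q D C θ = 0 by linarith, mul_zero]))
        (by positivity)
    have hzero : ∑ t ∈ Finset.range T,
        ∫ ω, ‖gradient (correctLoss q D C) (run.model t i ω)‖ ^ 2 ∂P = 0 :=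
      Finset.sum_eq_zero fun t ht => by
        simp only [run.model_eq_of_zero_step hn hC t (Finset.mem_range.1 ht).le i hi, hg0,
          integral_zero]
    rw [hzero, mul_zero]
    have : 0 ≤ c₄ := by rw [hc₄]; positivity
    positivity
  · obtain ⟨hγpos, hγL, hγc, hγ2, hγinv⟩ :=
      monnaStepSize_spec hT hL hσ hc₀pos hc₁0 hc₂0 hγ
    obtain ⟨hβ0, hβ1, hβ2, hβ3⟩ := momentum_coefficient_bounds hγpos.le hL hγL hβ
    have hX : 0 < γ * L := by positivity
    -- Since c₁γ²L² ≤ 2/3, the coefficient of B in the recursion is at most 4/27; 27/23 is the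
    -- reciprocal of 1 - 4/27.
    obtain ⟨B, hB⟩ : ∃ B, B = 27 / 23 * (2 * ζ ^ 2 + 12 * (γ * L) * σ ^ 2) := ⟨_, rfl⟩
    have hB0 : 0 ≤ B := by rw [hB]; positivity
    have hBfix : 2 * ζ ^ 2 + 2 / 9 * (c₁ * γ ^ 2 * L ^ 2) * B + (1 - β) * σ ^ 2 ≤ B := by
      have e1 : 2 / 9 * (c₁ * γ ^ 2 * L ^ 2) * B ≤ 2 / 9 * (2 / 3) * B := by gcongr
      have e2 : (1 - β) * σ ^ 2 ≤ 12 * (γ * L) * σ ^ 2 := by gcongr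
      linarith
    have hMrec : ∀ t < T, run.momentumSpread (t + 1) ≤ β * run.momentumSpread t +
        (1 - β) * (2 * ζ ^ 2 + 2 * L ^ 2 * run.modelSpread t) + (1 - β) ^ 2 * σ ^ 2 :=
      fun t ht => run.momentumSpread_succ_le hn hC hq hsmooth hvar hne hhet hβ0 hβ1 ht
    have hSrec : ∀ s > 0, ∀ t < T, run.halfSpread t ≤ (1 + s) * run.modelSpread t +
        (1 + 1 / s) * (γ ^ 2 * run.momentumSpread (t + 1)) :=
      fun s hs t ht => run.halfSpread_le hn hC hq hsmooth hvar hs ht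
    have hspread := spread_recursion_le hα0 hα1' hc₁ hβ0 hβ1 hB0 hBfix
      (run.modelSpread_zero hne) (run.momentumSpread_zero hne)
      (fun t ht => by
        rw [hα, hh]; exact run.modelSpread_succ_le hn hC hq hsmooth hvar hne ht) hSrec hMrec
    have hG : ∀ t < T, run.modelSpread t ≤ c₁ / 9 * γ ^ 2 * B := fun t ht => (hspread t ht.le).2
    have hS : ∀ t < T, run.halfSpread t ≤ 2 * (c₁ / 9 * γ ^ 2 * B) + 2 * (γ ^ 2 * B) :=
      fun t ht => by
        have h1 := hSrec 1 one_pos t ht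
        have h2 := hG t ht
        have h3 : γ ^ 2 * run.momentumSpread (t + 1) ≤ γ ^ 2 * B := by
          gcongr; exact (hspread (t + 1) ht).1
        linarith
    -- The Young weight in the deviation recursion is 3γL, the value for which `lyapunov_step`
    -- closes.
    have hsum := sum_le_of_lyapunov (T := T) (a := run.gradientSq) (w := run.moveSq)
      (d := run.newDeviationSq) (x := run.deviationSq) (S := run.halfSpread)
      (G := run.modelSpread) (Δ := correctLoss q D C θ₀ - ⨅ θ, correctLoss q D C θ)
      (v := σ ^ 2 / C.card) hγpos hL hγL hβ1 hβ2 hβ3 hlam0 (by positivity)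
      (fun t => integral_nonneg fun ω => by positivity)
      (fun t => integral_nonneg fun ω => by positivity)
      (by rw [run.deviationSq_zero hne]; exact hgrad₀) (by positivity) hG hS
      (fun t ht => run.newDeviationSq_le hn hC hq hsmooth hvar hne hL.le hβ0 hβ1 ht)
      (fun t ht => run.deviationSq_succ_le hn hC hq hsmooth hvar hL.le (by positivity) ht)
      (by
        rw [neg_sub, hlam, hh]
        exact run.sum_gradientSq_le hn hC hq hsmooth hvar hne hγpos hL.le hmin)
    refine le_trans ?_ (error_bound_le hT0 hL hσ hc₀pos hc₁0 hc₂0 hlam0 hh0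
      (by rw [hh]; linarith) hc₀ hB hc₂ hc₃ hc₄ hγpos hγL hγ2 hγinv)
    calc 1 / (T : ℝ) * ∑ t ∈ Finset.range T,
          ∫ ω, ‖gradient (correctLoss q D C) (run.model t i ω)‖ ^ 2 ∂P
        ≤ 1 / (T : ℝ) * ∑ t ∈ Finset.range T, (2 * run.gradientSq t +
            2 * L ^ 2 * (C.card * (c₁ / 9 * γ ^ 2 * B))) := by
          gcongr with t ht
          have ht := Finset.mem_range.1 ht
          refine (run.integral_gradient_model_sq_le hn hC hq hsmooth hvar hL.le ht hi).trans ?_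
          gcongr
          exact hG t ht
      _ = 2 * (1 / (T : ℝ) * ∑ t ∈ Finset.range T, run.gradientSq t) +
            2 * L ^ 2 * (C.card * (c₁ / 9 * γ ^ 2 * B)) := by
          rw [Finset.sum_add_distrib, ← Finset.mul_sum, Finset.sum_const, Finset.card_range,
            nsmul_eq_mul]
          field_simp
      _ ≤ 2 * (1 / (T : ℝ) * (3 * (correctLoss q D C θ₀ - ⨅ θ, correctLoss q D C θ) / γ +
            T * (9 * L ^ 2 * (c₁ / 9 * γ ^ 2 * B) + 108 * γ * L * (σ ^ 2 / C.card) +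
              3 * lam * (2 * (c₁ / 9 * γ ^ 2 * B) + 2 * (γ ^ 2 * B)) / γ ^ 2))) +
            2 * L ^ 2 * (C.card * (c₁ / 9 * γ ^ 2 * B)) := by gcongr
      _ = _ := by
          congr 2
          rw [mul_add, ← mul_assoc (1 / (T : ℝ)) (T : ℝ), one_div_mul_cancel hT0.ne', one_mul]
          congr 1
          field_simp
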